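/- Let $R$ be a commutative ring and let everything be $R$-linear; algebras are associative but not necessarily unital or commutative. A $B$-valued probability space is an algebra $B$, a $B$-bimodule $A$ with an associative product $A\otimes_B A\to A$ of $B$-bimodules, a $B$-bimodule map $B\to A$ respecting products, and a $B$-bimodule map $E:A\to B$ such that $B\to A\xrightarrow{E}B$ is the identity. For a $B$-balanced multilinear $f:A^{m}\to B$, let $f_{i_0,\dots,i_m}(a_1\otimes\cdots\otimes a_m):B^{\otimes(i_0+\cdots+i_m)}\to B$ be $$b_{0,1}\otimes\cdots\otimes b_{m,i_m}\mapsto f(b_{0,1}\cdots b_{0,i_0}\,a_1\,b_{1,1}\cdots b_{1,i_1}\otimes a_2\,b_{2,1}\cdots\otimes\cdots\otimes a_m b_{m,1}\cdots b_{m,i_m}).$$ *Cumulants.* The free cumulants $\kappa_n$ $(n\ge 1)$ are defined recursively by $$E(a_1\cdots a_n)=\sum_{\pi\in NC(n)}\hat\kappa(\pi,a_1\otimes\cdots\otimes a_n),$$ the sum being over noncrossing partitions of $\{1,\dots,n\}$. Here $\hat\kappa(\pi,\cdot)$ is the nested evaluation: if $l_0<\dots<l_k$ is the block of the least index, then the value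 is $\kappa_{k+1}(a_{l_0}c_1\otimes a_{l_1}c_2\otimes\cdots\otimes a_{l_k})\cdot c$, where $c_j$ is the value, computed in the same way, of the part of $\pi$ strictly between $l_{j-1}$ and $l_j$, and $c$ that of the part after $l_k$ (values of empty parts are omitted). *Cooperads.* All (co)operads are nonsymmetric. $\mathrm{End}\,B$ is the endomorphism operad, $(\mathrm{End}\,B)_n=\mathrm{Hom}(B^{\otimes n},B)$. $\mathcal F^c(\mathrm{End}\,B)$ is the cofree conilpotent coaugmented cooperad on it: planar rooted trees with vertices decorated by $\mathrm{End}\,B$, decomposed by cutting trees. It projects to $\mathrm{End}\,B$ through the one-vertex trees. The linear restriction of a morphism of coaugmented cooperads to $\mathcal F^c(\mathrm{End}\,B)$ is its composite with this projection; the restriction on the kernel of the counit determines the morphism. The cooperad $\mathsf{coAs}_A$ is $\bigoplus_{N\ge1}(A\oplus R*)^{\otimes N}$, where the arity of a word is its number of letters $*$, the coaugmentation is the word $*$, the counit is the coefficient of the word $*$, and $$\Delta w=\sum (b_0*b_1*\cdots*b_n)\circ(a_1\otimes\cdots\otimes a_n)$$ over all factorizations $w=b_0a_1b_1\cdots a_nb_n$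 ($n\ge0$) with $b_i$ possibly empty words in $A$ and $a_i$ nonempty words in $*$ and $A$. The *moment morphism* $M:\mathsf{coAs}_A\to\mathcal F^c(\mathrm{End}\,B)$ is the morphism of coaugmented cooperads whose linear restriction sends a word $w=*^{i_0}a_1*^{i_1}\cdots a_m*^{i_m}\neq *$ to the map $b_{0,1}\otimes\cdots\otimes b_{m,i_m}\mapsto E(b_{0,1}\cdots b_{0,i_0}a_1b_{1,1}\cdots a_m b_{m,1}\cdots b_{m,i_m})$. The *canonical twist* $\Phi:\mathcal F^c(\mathrm{End}\,B)\to\mathcal F^c(\mathrm{End}\,B)$ is the morphism of coaugmented cooperads whose linear restriction on the kernel of the counit is the operadic composition of decorated trees. **Theorem.** The morphisms $M$ and $\Phi$ exist and are unique, and $\Phi$ is an isomorphism of coaugmented cooperads. The $\kappa_n$ satisfy the displayed moment–cumulant formula. Let $K=\Phi^{-1}\circ M$ be the free cumulant morphism and let $k:\mathsf{coAs}_A\to\mathrm{End}\,B$ be its linear restriction. Then: 1. For $n\ge2$, $k(*^n)$ is $(-1)^n$ times the $n$-fold multiplication $B^{\otimes n}\to B$. 2. For $m\ge1$, $a_1,\dots,a_m\in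 A$ and $\alpha_1,\dots,\alpha_{m-1}\in\{0,1\}$, $k(a_1*^{\alpha_1}a_2\cdots *^{\alpha_{m-1}}a_m)=(\kappa_m)_{0,\alpha_1,\dots,\alpha_{m-1},0}(a_1\otimes\cdots\otimes a_m)$. 3. $k(w)=0$ for every word $w$ which contains an element of $A$ and which contains two consecutive $*$, or begins with $*$, or ends with $*$. -/

import Mathlib

open scoped TensorProduct DirectSum

noncomputable section

namespace OperadicCumulants

/-! ### Planar rooted trees and modules of decorated trees -/

/-- Planar rooted trees: the trivial tree with one leaf and no vertex, and a root vertex with `n`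
ordered incoming edges, each carrying a tree.  Vertices with `0` or `1` incoming edges are
allowed. -/
inductive PTree : Type
  | leaf : PTree
  | node (n : ℕ) (c : Fin n → PTree) : PTree

instance : DecidableEq PTree := Classical.decEq _

/-- The number of leaves (the arity) of a tree. -/
def PTree.leaves : PTree → ℕ
  | .leaf => 1
  | .node _ c => ∑ i, (c i).leaves

universe u v w

variable (R : Type u) [CommRing R]

section Trees

variable (V : ℕ → Type v) [∀ n, AddCommGroup (V n)] [∀ n, Module R (V n)]

/-- The tensor product over the vertices `x` of a tree of the modules `V (number of inputs of x)`:
decorations of the given tree by the collection `V`. -/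
def Decoration : PTree → ModuleCat.{max u v} R
  | .leaf => ModuleCat.of R (ULift.{max u v} R)
  | .node n c => ModuleCat.of R (V n ⊗[R] (⨂[R] i, Decoration (c i)))

/-- The sum over all arities of the collection `𝒯(V)` of planar rooted trees with vertices
decorated by the collection `V`.  It underlies both the free operad and the cofree conilpotent
coaugmented cooperad on `V`. -/
abbrev DecTrees : Type (max u v) := ⨁ t : PTree, Decoration R V t

variable {R V}

/-- The inclusion of the decorations of one tree. -/
abbrev ofTree (t : PTree) : Decoration R V t →ₗ[R] DecTrees R V :=
  DirectSum.lof R PTree (fun t => Decoration R V t) t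

/-- The trivial tree. -/
def trivialTree : DecTrees R V :=
  ofTree .leaf (ULift.up 1 : ULift.{max u v} R)

/-- A decoration of the root vertex and decorations of the trees planted on it, assembled. -/
def assemble (n : ℕ) (p : Fin n → PTree) :
    V n →ₗ[R] (⨂[R] i, Decoration R V (p i)) →ₗ[R] Decoration R V (.node n p) :=
  TensorProduct.mk R (V n) (⨂[R] i, Decoration R V (p i))

/-- Grafting: `graft n x (t₁, …, tₙ)` is the tree with root vertex decorated by `x`, on whose
incoming edges the trees `t₁, …, tₙ` are planted. -/
def graft (n : ℕ) : V n →ₗ[R] MultilinearMap R (fun _ : Fin n => DecTrees R V) (DecTrees R V) where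
  toFun x := MultilinearMap.fromDirectSumEquiv fun p : Fin n → PTree =>
    (ofTree (.node n p) ∘ₗ assemble n p x).compMultilinearMap (PiTensorProduct.tprod R)
  map_add' x y := by
    rw [← map_add]
    congr 1
    funext p
    refine MultilinearMap.ext fun z => ?_
    simp
  map_smul' r x := by
    rw [RingHom.id_apply, ← map_smul]
    congr 1
    funext p
    refine MultilinearMap.ext fun z => ?_
    simp

theorem graft_ofTree (n : ℕ) (x : V n) (p : Fin n → PTree) (z : ∀ i, Decoration R V (p i)) :
    graft n x (fun i => ofTree (p i) (z i))
      = ofTree (.node n p) (assemble n p x (PiTensorProduct.tprod R z)) := by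
  change MultilinearMap.fromDirectSumEquiv _ _ = _
  rw [MultilinearMap.fromDirectSumEquiv_lof]
  rfl

variable {X : Type w} [AddCommGroup X] [Module R X]

/-- Recursion on decorated trees, on the summand of one tree shape. -/
def foldTree (x₀ : X) (g : ∀ n, V n →ₗ[R] MultilinearMap R (fun _ : Fin n => X) X) :
    ∀ t : PTree, Decoration R V t →ₗ[R] X
  | .leaf => LinearMap.toSpanSingleton R X x₀ ∘ₗ ULift.moduleEquiv.toLinearMap
  | .node n c => TensorProduct.lift
      (PiTensorProduct.lift.toLinearMap ∘ₗ
        MultilinearMap.compLinearMapₗ (fun i => foldTree x₀ g (c i)) ∘ₗ g n)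

/-- Recursion on decorated trees: the linear map sending the trivial tree to `x₀` and a grafting
`graft n x (t₁, …, tₙ)` to `g n x (fold t₁, …, fold tₙ)`. -/
def fold (x₀ : X) (g : ∀ n, V n →ₗ[R] MultilinearMap R (fun _ : Fin n => X) X) :
    DecTrees R V →ₗ[R] X :=
  DirectSum.toModule R PTree X (foldTree x₀ g)

theorem fold_trivialTree (x₀ : X) (g : ∀ n, V n →ₗ[R] MultilinearMap R (fun _ : Fin n => X) X) :
    fold x₀ g trivialTree = x₀ := by
  refine (DirectSum.toModule_lof R _ _).trans ?_
  exact (one_smul R x₀)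

theorem fold_graft (x₀ : X) (g : ∀ n, V n →ₗ[R] MultilinearMap R (fun _ : Fin n => X) X)
    (n : ℕ) (x : V n) (t : Fin n → DecTrees R V) :
    fold x₀ g (graft n x t) = g n x (fun i => fold x₀ g (t i)) := by
  have : (fold x₀ g).compMultilinearMap (graft n x)
      = (g n x).compLinearMap (fun _ => fold x₀ g) := by
    refine MultilinearMap.directSum_ext fun p => MultilinearMap.ext fun z => ?_
    have h₂ : ∀ (t : PTree) (y : Decoration R V t),
        fold x₀ g (ofTree t y) = foldTree x₀ g t y :=
      fun t y => (DirectSum.toModule_lof R (φ := foldTree x₀ g) t y).trans rfl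
    change fold x₀ g (graft n x (fun i => ofTree (p i) (z i)))
      = g n x (fun i => fold x₀ g (ofTree (p i) (z i)))
    simp only [graft_ofTree, h₂]
    change TensorProduct.lift _ (x ⊗ₜ PiTensorProduct.tprod R z) = _
    simp
  exact congrArg (fun f => f t) this

/-- Two linear maps on decorated trees agree if they agree on the trivial tree and their agreement
is preserved by grafting. -/
theorem decTrees_ext (f g : DecTrees R V →ₗ[R] X) (h₀ : f trivialTree = g trivialTree)
    (h : ∀ (n : ℕ) (x : V n) (t : Fin n → DecTrees R V), (∀ i, f (t i) = g (t i)) →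
      f (graft n x t) = g (graft n x t)) : f = g := by
  refine DirectSum.linearMap_ext R fun t => ?_
  induction t with
  | leaf =>
    refine LinearMap.ext fun (y : ULift.{max u v} R) => ?_
    have hf : ∀ f' : DecTrees R V →ₗ[R] X, f' (ofTree .leaf y) = y.down • f' trivialTree := by
      intro f'
      have h₁ := (f' ∘ₗ ofTree (R := R) (V := V) .leaf).map_smul y.down
        ((ULift.up 1 : ULift.{max u v} R) : Decoration R V .leaf)
      refine Eq.trans ?_ h₁
      exact congrArg (fun z => f' (ofTree .leaf z)) (ULift.ext _ _ (mul_one y.down).symm)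
    change f (ofTree .leaf y) = g (ofTree .leaf y)
    rw [hf, hf, h₀]
  | node n p ih =>
    have key : (TensorProduct.AlgebraTensorModule.curry
        (f ∘ₗ ofTree (.node n p) : V n ⊗[R] (⨂[R] i, Decoration R V (p i)) →ₗ[R] X))
        = TensorProduct.AlgebraTensorModule.curry (g ∘ₗ ofTree (.node n p)) := by
      refine LinearMap.ext fun x => PiTensorProduct.ext (MultilinearMap.ext fun z => ?_)
      change f (ofTree (.node n p) (assemble n p x (PiTensorProduct.tprod R z)))
        = g (ofTree (.node n p) (assemble n p x (PiTensorProduct.tprod R z)))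
      rw [← graft_ofTree]
      exact h n x _ fun i => LinearMap.congr_fun (ih i) (z i)
    exact TensorProduct.AlgebraTensorModule.curry_injective key

end Trees

/-! ### Coaugmented cooperads and their morphisms

A collection `C₀, C₁, …` is handled through the sum `C` of its modules.  The sum over all arities
of the composition product `C ∘ C` is `⨁ₖ Cₖ ⊗ C^{⊗ k}`, a direct summand of
`C ⊗ TensorAlgebra C`; the element `c ∘ (c₁ ⊗ ⋯ ⊗ cₖ)` is `c ⊗ₜ (ι c₁ * ⋯ * ι cₖ)`. -/

section Cooperads

/-- The structure maps of a (nonsymmetric) coaugmented cooperad: the arity grading, the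
decomposition map, the counit (zero outside arity one) and the coaugmentation (the image of `1`).
It is used only for the two explicit cooperads below, for which the cooperad laws hold. -/
structure CooperadData (C : Type v) [AddCommGroup C] [Module R C] where
  arity : ℕ → Submodule R C
  decomp : C →ₗ[R] C ⊗[R] TensorAlgebra R C
  counit : C →ₗ[R] R
  coaug : C

variable {R}
variable {C : Type v} [AddCommGroup C] [Module R C] {D : Type w} [AddCommGroup D] [Module R D]

/-- Morphisms of coaugmented cooperads. -/
structure IsCooperadHom (S : CooperadData R C) (T : CooperadData R D) (f : C →ₗ[R] D) : Prop where
  map_arity : ∀ n, ∀ c ∈ S.arity n, f c ∈ T.arity n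
  map_decomp : ∀ c, T.decomp (f c) =
    TensorProduct.map f (TensorAlgebra.lift R (TensorAlgebra.ι R ∘ₗ f)).toLinearMap (S.decomp c)
  map_counit : ∀ c, T.counit (f c) = S.counit c
  map_coaug : f S.coaug = T.coaug

/-- `(c₁ ⊗ q₁, …, cₙ ⊗ qₙ) ↦ (c₁ ⊗ ⋯ ⊗ cₙ) ⊗ (q₁ * ⋯ * qₙ)`. -/
def gather (Q : Type w) [Ring Q] [Algebra R Q] (n : ℕ) :
    MultilinearMap R (fun _ : Fin n => C ⊗[R] Q) ((⨂[R] _ : Fin n, C) ⊗[R] Q) :=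
  (LinearMap.rTensor Q (DirectSum.component R ℕ (fun k => ⨂[R] _ : Fin k, C) n ∘ₗ
      (TensorAlgebra.toDirectSum (R := R) (M := C)).toLinearMap)).compMultilinearMap
    ((MultilinearMap.mkPiAlgebraFin R n (TensorAlgebra R C ⊗[R] Q)).compLinearMap
      fun _ => LinearMap.rTensor Q (TensorAlgebra.ι R))

theorem gather_tmul (Q : Type w) [Ring Q] [Algebra R Q] (n : ℕ) (c : Fin n → C) (q : Fin n → Q) :
    gather Q n (fun i => c i ⊗ₜ[R] q i)
      = (PiTensorProduct.tprod R c) ⊗ₜ[R] (List.ofFn q).prod := by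
  have h : ∀ l : List (C × Q),
      (l.map fun x => (TensorAlgebra.ι R x.1) ⊗ₜ[R] x.2).prod
        = ((l.map fun x => TensorAlgebra.ι R x.1).prod ⊗ₜ[R] (l.map Prod.snd).prod) := by
    intro l
    induction l with
    | nil => simp [Algebra.TensorProduct.one_def]
    | cons x l ih => simp [ih]
  have h' := h (List.ofFn fun i => (c i, q i))
  simp only [List.map_ofFn, Function.comp_def] at h'
  simp [gather, h', ← TensorAlgebra.tprod_apply, TensorAlgebra.toDirectSum_tensorPower_tprod]
  exact congrArg (fun z => z ⊗ₜ[R] (List.ofFn q).prod) (DirectSum.component.lof_self R _ _)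

end Cooperads

/-! ### The cofree cooperad on a collection -/

section Cofree

variable (V : ℕ → Type v) [∀ n, AddCommGroup (V n)] [∀ n, Module R (V n)]

variable {R} in
/-- `graftLower n x` grafts `n` elements `tᵢ ∘ uᵢ` of the composition product, where `uᵢ` is a list
of trees, to `graft n x (t₁, …, tₙ) ∘ (u₁ ⋯ uₙ)`. -/
def graftLower (n : ℕ) : V n →ₗ[R]
    MultilinearMap R (fun _ : Fin n => DecTrees R V ⊗[R] TensorAlgebra R (DecTrees R V))
      (DecTrees R V ⊗[R] TensorAlgebra R (DecTrees R V)) where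
  toFun x := (LinearMap.rTensor _ (PiTensorProduct.lift (graft n x))).compMultilinearMap
    (gather (TensorAlgebra R (DecTrees R V)) n)
  map_add' x y := by
    ext z
    simp [LinearMap.rTensor_add]
  map_smul' r x := by
    ext z
    simp [LinearMap.rTensor_smul]

/-- The decomposition of a decorated tree: the sum over all ways to cut it into a lower tree and
trees on its leaves.  Either the cut is below the root vertex, or it consists of cuts of the trees
planted on the root vertex:
`Δ(|) = | ∘ |` and
`Δ(graft x (t₁, …, tₙ)) = | ∘ graft x (t₁, …, tₙ) + graft x (t₁', …, tₙ') ∘ (u₁ ⋯ uₙ)`, where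
`Δ tᵢ = ∑ tᵢ' ∘ uᵢ`.  The recursion carries the tree itself along. -/
def treeDecomp : DecTrees R V →ₗ[R] DecTrees R V ⊗[R] TensorAlgebra R (DecTrees R V) :=
  LinearMap.snd R _ _ ∘ₗ
    fold (X := DecTrees R V × (DecTrees R V ⊗[R] TensorAlgebra R (DecTrees R V)))
      (trivialTree, trivialTree ⊗ₜ TensorAlgebra.ι R trivialTree)
      (fun n =>
        (LinearMap.inl R _ _ + LinearMap.inr R _ _ ∘ₗ
            TensorProduct.mk R _ _ trivialTree ∘ₗ TensorAlgebra.ι R).compMultilinearMapₗ R ∘ₗ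
          MultilinearMap.compLinearMapₗ (fun _ => LinearMap.fst R _ _) ∘ₗ graft n
        + (LinearMap.inr R _ _).compMultilinearMapₗ R ∘ₗ
          MultilinearMap.compLinearMapₗ (fun _ => LinearMap.snd R _ _) ∘ₗ graftLower V n)

/-- The coefficient of the trivial tree and the corolla component of an element of `𝒯(V)`. -/
def lowPart : DecTrees R V →ₗ[R] R × ⨁ n, V n :=
  fold (1, 0) (fun n =>
    MultilinearMap.compLinearMapₗ (fun _ => LinearMap.fst R R (⨁ n, V n)) ∘ₗ
      (MultilinearMap.piRingEquiv (R := R) (ι := Fin n)).toLinearMap ∘ₗ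
        LinearMap.inr R R (⨁ n, V n) ∘ₗ DirectSum.lof R ℕ V n)

variable {R V} in
/-- The linear projection from the cofree cooperad on `V` to `V`: the component at the trees with
exactly one vertex. -/
def corollaPart : DecTrees R V →ₗ[R] ⨁ n, V n := LinearMap.snd R _ _ ∘ₗ lowPart R V

/-- The cofree (conilpotent coaugmented) cooperad on the collection `V`. -/
def cofree : CooperadData R (DecTrees R V) where
  arity n := ⨆ (t : PTree) (_ : t.leaves = n), LinearMap.range (ofTree (R := R) (V := V) t)
  decomp := treeDecomp R V
  counit := LinearMap.fst R _ _ ∘ₗ lowPart R V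
  coaug := trivialTree

variable {V}

theorem treeDecomp_trivialTree :
    treeDecomp R V trivialTree = trivialTree ⊗ₜ TensorAlgebra.ι R trivialTree := by
  simp [treeDecomp, fold_trivialTree]

theorem treeDecomp_graft (n : ℕ) (x : V n) (t : Fin n → DecTrees R V) :
    treeDecomp R V (graft n x t) = trivialTree ⊗ₜ TensorAlgebra.ι R (graft n x t)
      + graftLower V n x (fun i => treeDecomp R V (t i)) := by
  set F := fold (X := DecTrees R V × (DecTrees R V ⊗[R] TensorAlgebra R (DecTrees R V)))
      (trivialTree, trivialTree ⊗ₜ TensorAlgebra.ι R trivialTree)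
      (fun n =>
        (LinearMap.inl R _ _ + LinearMap.inr R _ _ ∘ₗ
            TensorProduct.mk R _ _ trivialTree ∘ₗ TensorAlgebra.ι R).compMultilinearMapₗ R ∘ₗ
          MultilinearMap.compLinearMapₗ (fun _ => LinearMap.fst R _ _) ∘ₗ graft n
        + (LinearMap.inr R _ _).compMultilinearMapₗ R ∘ₗ
          MultilinearMap.compLinearMapₗ (fun _ => LinearMap.snd R _ _) ∘ₗ graftLower V n) with hF
  have h₁ : LinearMap.fst R _ _ ∘ₗ F = LinearMap.id := by
    refine decTrees_ext _ _ (by simp [hF, fold_trivialTree]) fun n x t ht => ?_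
    simp only [LinearMap.comp_apply, LinearMap.fst_apply, LinearMap.id_apply] at ht
    simp [hF, fold_graft]
    simp [← hF, ht]
  have h₂ : ∀ y, (F y).1 = y := fun y => LinearMap.congr_fun h₁ y
  have h₃ : ∀ y, treeDecomp R V y = (F y).2 := fun y => rfl
  simp only [h₃]
  conv_lhs => rw [hF, fold_graft, ← hF]
  simp [h₂]


theorem lowPart_graft (n : ℕ) (x : V n) (t : Fin n → DecTrees R V) :
    lowPart R V (graft n x t) = (0, (∏ i, (lowPart R V (t i)).1) • DirectSum.lof R ℕ V n x) := by
  refine (fold_graft _ _ n x t).trans ?_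
  change (∏ i, (lowPart R V (t i)).1) • ((0 : R), DirectSum.lof R ℕ V n x) = _
  rw [Prod.smul_mk, smul_zero]

end Cofree

/-! ### The endomorphism operad and the canonical twist -/

section EndOperad

variable (B : Type v) [AddCommGroup B] [Module R B]

/-- The endomorphism collection `(End B)ₙ = Hom(B^{⊗ n}, B)`. -/
abbrev EndB (n : ℕ) : Type v := MultilinearMap R (fun _ : Fin n => B) B

variable {R B} in
/-- Operadic composition in `End B`:
`x (f₁, …, fₙ)` evaluated at the concatenation of the lists of arguments of the `fᵢ`. -/
def endComp (n : ℕ) (x : EndB R B n) (p : Fin n → ℕ) :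
    MultilinearMap R (fun i => EndB R B (p i)) (EndB R B (∑ i, p i)) where
  toFun f := (x.compMultilinearMap f).domDomCongr finSigmaFinEquiv
  map_update_add' f i y z := by
    refine MultilinearMap.ext fun b => ?_
    let c : ∀ j, Fin (p j) → B := fun j l => b (finSigmaFinEquiv ⟨j, l⟩)
    have hc : ∀ w, (fun j => Function.update f i w j (c j))
        = Function.update (fun j => f j (c j)) i (w (c i)) := fun w =>
      funext fun j => Function.apply_update (fun j (g : EndB R B (p j)) => g (c j)) f i w j
    change x (fun j => Function.update f i (y + z) j (c j))
      = x (fun j => Function.update f i y j (c j)) + x (fun j => Function.update f i z j (c j))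
    rw [hc, hc, hc, ← MultilinearMap.map_update_add]
    rfl
  map_update_smul' f i r y := by
    refine MultilinearMap.ext fun b => ?_
    let c : ∀ j, Fin (p j) → B := fun j l => b (finSigmaFinEquiv ⟨j, l⟩)
    have hc : ∀ w, (fun j => Function.update f i w j (c j))
        = Function.update (fun j => f j (c j)) i (w (c i)) := fun w =>
      funext fun j => Function.apply_update (fun j (g : EndB R B (p j)) => g (c j)) f i w j
    change x (fun j => Function.update f i (r • y) j (c j))
      = r • x (fun j => Function.update f i y j (c j))
    rw [hc, hc, ← MultilinearMap.map_update_smul]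
    rfl

/-- Operadic composition of an `n`-ary operation with `n` operations of arbitrary arities. -/
def endGraft (n : ℕ) : EndB R B n →ₗ[R]
    MultilinearMap R (fun _ : Fin n => ⨁ k, EndB R B k) (⨁ k, EndB R B k) where
  toFun x := MultilinearMap.fromDirectSumEquiv fun p : Fin n → ℕ =>
    (DirectSum.lof R ℕ (EndB R B) (∑ i, p i)).compMultilinearMap (endComp n x p)
  map_add' x y := by
    rw [← map_add]
    congr 1
    funext p
    refine MultilinearMap.ext fun f => ?_
    exact map_add (DirectSum.lof R ℕ (EndB R B) (∑ i, p i)) (endComp n x p f) (endComp n y p f)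
  map_smul' r x := by
    rw [RingHom.id_apply, ← map_smul]
    congr 1
    funext p
    refine MultilinearMap.ext fun f => ?_
    exact map_smul (DirectSum.lof R ℕ (EndB R B) (∑ i, p i)) r (endComp n x p f)

/-- The composition of trees decorated by `End B`: the counit `𝓕(End B) → End B` of the
free-forgetful adjunction.  The trivial tree is sent to the identity of `B`. -/
def treeComposition : DecTrees R (EndB R B) →ₗ[R] ⨁ n, EndB R B n :=
  fold (DirectSum.lof R ℕ (EndB R B) 1 (MultilinearMap.ofSubsingleton R B B 0 LinearMap.id))
    (endGraft R B)

/-- The canonical twist of `End B`: the endomorphism of the cofree cooperad on `End B` whose linear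
restriction is the composition of decorated trees.  (A morphism to a cofree cooperad preserves the
coaugmentation, so it is its restriction to the kernel of the counit that is prescribed.) -/
structure IsCanonicalTwist (Φ : DecTrees R (EndB R B) →ₗ[R] DecTrees R (EndB R B)) : Prop where
  isHom : IsCooperadHom (cofree R (EndB R B)) (cofree R (EndB R B)) Φ
  restriction : ∀ t, (cofree R (EndB R B)).counit t = 0 → corollaPart (Φ t) = treeComposition R B t

variable {R B}

/-- The value at the list of arguments `b₁, …, bₙ` of the component of arity `n`. -/
def evalAt (x : ⨁ n, EndB R B n) (b : List B) : B := x b.length b.get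

end EndOperad

/-! ### The cooperad of words in `A` and `*` -/

section Words

variable (A : Type v) [AddCommGroup A] [Module R A]

/-- `⨁_{n ≥ 1} (A ⊕ V)^{⊗ n}` with `V = R *` free of rank one, as `(A ⊕ V) ⊗ T(A ⊕ V)`. -/
abbrev Words : Type (max u v) := (A × R) ⊗[R] TensorAlgebra R (A × R)

variable {A}

/-- The letter `*` (`none`) or the letter `a` (`some a`). -/
def letter : Option A → A × R
  | none => (0, 1)
  | some a => (a, 0)

/-- A word in `*` and elements of `A`; the empty word is not an element and is sent to `0`. -/
def word : List (Option A) → Words R A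
  | [] => 0
  | x :: w => letter R x ⊗ₜ (w.map fun y => TensorAlgebra.ι R (letter R y)).prod

variable (A) in
/-- Multiplication of nonempty words into all words. -/
def wordIncl : Words R A →ₗ[R] TensorAlgebra R (A × R) :=
  LinearMap.mul' R _ ∘ₗ LinearMap.rTensor _ (TensorAlgebra.ι R)

variable (A) in
/-- Elements `b ∘ (a₁ ⊗ ⋯ ⊗ aₙ)` of the composition product, where `b` may be empty. -/
abbrev WordPairs : Type (max u v) :=
  TensorAlgebra R (A × R) ⊗[R] TensorAlgebra R (Words R A)

variable (A) in
/-- `a₁ ⊗ (b ∘ (a₂ ⊗ ⋯ ⊗ aₙ)) ↦ (*b) ∘ (a₁ ⊗ a₂ ⊗ ⋯ ⊗ aₙ)`. -/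
def closePiece : Words R A ⊗[R] WordPairs R A →ₗ[R] Words R A ⊗[R] TensorAlgebra R (Words R A) :=
  LinearMap.rTensor _ (TensorProduct.mk R _ _ (letter R none)) ∘ₗ
    LinearMap.mul' R (WordPairs R A) ∘ₗ
      LinearMap.rTensor _ (TensorProduct.mk R _ _ 1 ∘ₗ TensorAlgebra.ι R)

variable (A) in
/-- One step of the decomposition, reading a word from right to left.  The state of a word `w` is
the pair of the sum of `(b₀ * b₁ * ⋯ * bₙ) ∘ (a₁ ⊗ ⋯ ⊗ aₙ)` over all factorizations
`w = b₀ a₁ b₁ ⋯ aₙ bₙ` and the sum of `a₁ ⊗ ((b₁ * ⋯ * bₙ) ∘ (a₂ ⊗ ⋯ ⊗ aₙ))` over those in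
which `n ≥ 1` and `b₀` is empty.  A new letter `x` on the left either is a new `a₁`, or is added to
`a₁`, or (if it is in `A`) is added to `b₀`. -/
def decompOpen : A × R →ₗ[R] WordPairs R A × (Words R A ⊗[R] WordPairs R A) →ₗ[R]
    Words R A ⊗[R] WordPairs R A :=
  LinearMap.mk₂ R
    (fun x s => (x ⊗ₜ 1) ⊗ₜ s.1
      + LinearMap.rTensor _ (TensorProduct.mk R _ _ x ∘ₗ wordIncl R A) s.2)
    (fun x y s => by
      simp only [TensorProduct.add_tmul, map_add, LinearMap.add_comp, LinearMap.rTensor_add,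
        LinearMap.add_apply]
      abel)
    (fun c x s => by
      simp only [TensorProduct.smul_tmul', map_smul, LinearMap.smul_comp, LinearMap.rTensor_smul,
        LinearMap.smul_apply, smul_add])
    (fun x s t => by
      simp only [Prod.fst_add, Prod.snd_add, TensorProduct.tmul_add, map_add]
      abel)
    (fun c x s => by
      simp only [Prod.smul_fst, Prod.smul_snd, TensorProduct.tmul_smul, map_smul, smul_add])

variable (A) in
/-- The sum over the factorizations after adding a letter on the left of a word. -/
def decompTotal : A × R →ₗ[R] WordPairs R A × (Words R A ⊗[R] WordPairs R A) →ₗ[R]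
    Words R A ⊗[R] TensorAlgebra R (Words R A) :=
  LinearMap.mk₂ R
    (fun x s => LinearMap.rTensor _ (TensorProduct.mk R _ _ (x.1, (0 : R))) s.1
      + closePiece R A (decompOpen R A x s))
    (fun x y s => by
      have : ((x + y).1, (0 : R)) = (x.1, 0) + (y.1, 0) := by simp
      simp only [this, map_add, LinearMap.rTensor_add, LinearMap.add_apply]
      abel)
    (fun c x s => by
      have : ((c • x).1, (0 : R)) = c • (x.1, 0) := by simp
      simp only [this, map_smul, LinearMap.rTensor_smul, LinearMap.smul_apply, smul_add])
    (fun x s t => by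
      simp only [Prod.fst_add, map_add]
      abel)
    (fun c x s => by
      simp only [Prod.smul_fst, map_smul, smul_add])

variable (A) in
/-- The action of a letter on states. -/
def decompAct : A × R →ₗ[R]
    Module.End R (WordPairs R A × (Words R A ⊗[R] WordPairs R A)) where
  toFun x := LinearMap.prod (LinearMap.rTensor _ (wordIncl R A) ∘ₗ decompTotal R A x)
    (decompOpen R A x)
  map_add' x y := by
    ext s <;> simp
  map_smul' c x := by
    ext s <;> simp

variable (A) in
/-- The decomposition map of words. -/
def wordDecomp : Words R A →ₗ[R] Words R A ⊗[R] TensorAlgebra R (Words R A) :=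
  TensorProduct.lift ((LinearMap.lcomp R _
    (LinearMap.applyₗ (1 ⊗ₜ 1, 0) ∘ₗ (TensorAlgebra.lift R (decompAct R A)).toLinearMap)) ∘ₗ
      decompTotal R A)

/-- Adds a letter on the left to `a₁`, if `n ≥ 1` and `b₀` is empty. -/
def addToFirst (x : Option A) : List (Option A) × List (List (Option A) × List (Option A)) →
    Option (List (Option A) × List (List (Option A) × List (Option A)))
  | ([], (a, b) :: l) => some ([], (x :: a, b) :: l)
  | _ => none

/-- The factorizations of a word as `b₀ a₁ b₁ ⋯ aₙ bₙ` with the `bᵢ` possibly empty words in `A` and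
the `aᵢ` nonempty words in `*` and `A`, as pairs `(b₀, [(a₁, b₁), …, (aₙ, bₙ)])`. -/
def factorizations : List (Option A) →
    List (List (Option A) × List (List (Option A) × List (Option A)))
  | [] => [([], [])]
  | x :: w =>
    (if x.isSome then (factorizations w).map fun f => (x :: f.1, f.2) else []) ++
    ((factorizations w).map (fun f => ([], ([x], f.1) :: f.2)) ++
    (factorizations w).filterMap (addToFirst x))

/-- The word `b₀ * b₁ * ⋯ * bₙ`. -/
def lowerWord (b : List (Option A)) (l : List (List (Option A) × List (Option A))) :
    List (Option A) :=
  b ++ l.flatMap fun ab => none :: ab.2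

theorem factorizations_ne_nil {A : Type v} (w : List (Option A)) :
    ∀ f ∈ factorizations w, ∀ ab ∈ f.2, ab.1 ≠ [] := by
  induction w with
  | nil => simp [factorizations]
  | cons x w ih =>
    intro f hf ab hab
    simp only [factorizations, List.mem_append] at hf
    rcases hf with hf | hf | hf
    · split_ifs at hf
      · obtain ⟨g, hg, rfl⟩ := List.mem_map.1 hf
        exact ih g hg ab hab
      · simp at hf
    · obtain ⟨g, hg, rfl⟩ := List.mem_map.1 hf
      rcases List.mem_cons.1 hab with rfl | hab
      · simp
      · exact ih g hg ab hab
    · obtain ⟨g, hg, hgf⟩ := List.mem_filterMap.1 hf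
      rcases g with ⟨_ | ⟨y, b₀⟩, _ | ⟨⟨a, b⟩, l⟩⟩ <;> simp [addToFirst] at hgf
      subst hgf
      rcases List.mem_cons.1 hab with rfl | hab
      · simp
      · exact ih _ hg ab (List.mem_cons_of_mem _ hab)

set_option maxHeartbeats 1000000 in
/-- The decomposition of a word: the sum of `(b₀ * b₁ * ⋯ * bₙ) ∘ (a₁ ⊗ ⋯ ⊗ aₙ)` over all
factorizations `b₀ a₁ b₁ ⋯ aₙ bₙ`. -/
theorem wordDecomp_word (x : Option A) (w : List (Option A)) :
    wordDecomp R A (word R (x :: w)) = ((factorizations (x :: w)).map fun f =>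
      word R (lowerWord f.1 f.2) ⊗ₜ[R]
        (f.2.map fun ab => TensorAlgebra.ι R (word R ab.1)).prod).sum := by
  let W : List (Option A) → TensorAlgebra R (A × R) := fun w =>
    (w.map fun y => TensorAlgebra.ι R (letter R y)).prod
  let Q : List (List (Option A) × List (Option A)) → TensorAlgebra R (Words R A) := fun l =>
    (l.map fun ab => TensorAlgebra.ι R (word R ab.1)).prod
  let op : List (Option A) × List (List (Option A) × List (Option A)) →
      Words R A ⊗[R] WordPairs R A := fun f => match f with
    | ([], (a, b) :: l) => word R a ⊗ₜ (W (lowerWord b l) ⊗ₜ Q l)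
    | _ => 0
  let state : List (Option A) → WordPairs R A × (Words R A ⊗[R] WordPairs R A) := fun w =>
    TensorAlgebra.lift R (decompAct R A) (W w) (1 ⊗ₜ 1, 0)
  have hincl : ∀ w : List (Option A), w ≠ [] → wordIncl R A (word R w) = W w := by
    rintro (_ | ⟨x, w⟩) h
    · exact absurd rfl h
    · simp [wordIncl, word, W]
  have hclose : ∀ a b l, closePiece R A (word R a ⊗ₜ (W (lowerWord b l) ⊗ₜ Q l))
      = word R (none :: lowerWord b l) ⊗ₜ Q ((a, b) :: l) := by
    intro a b l
    simp [closePiece, word, W, Q]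
  have hstep : ∀ w,
      (state w = (((factorizations w).map fun f => W (lowerWord f.1 f.2) ⊗ₜ Q f.2).sum,
        ((factorizations w).map op).sum)) → ∀ x,
      decompOpen R A (letter R x) (state w) = ((factorizations (x :: w)).map op).sum ∧
      decompTotal R A (letter R x) (state w) = ((factorizations (x :: w)).map fun f =>
        word R (lowerWord f.1 f.2) ⊗ₜ[R] Q f.2).sum := by
    intro w hw x
    have hne := factorizations_ne_nil w
    have h₁ : decompOpen R A (letter R x) (state w)
        = ((factorizations (x :: w)).map op).sum := by
      have e₁ : ∀ F : List (List (Option A) × List (List (Option A) × List (Option A))),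
          ((F.map fun f => (x :: f.1, f.2)).map op).sum = 0 := by
        intro F
        induction F with
        | nil => rfl
        | cons f F ih => simpa [op] using ih
      have e₂ : ∀ F : List (List (Option A) × List (List (Option A) × List (Option A))),
          ((F.map fun f => (([] : List (Option A)), ([x], f.1) :: f.2)).map op).sum
            = (letter R x ⊗ₜ 1) ⊗ₜ (F.map fun f => W (lowerWord f.1 f.2) ⊗ₜ Q f.2).sum := by
        intro F
        induction F with
        | nil => simp
        | cons f F ih =>
          simp only [List.map_cons, List.sum_cons, TensorProduct.tmul_add, ih]
          simp [op, word]
      have e₃ : ∀ F : List (List (Option A) × List (List (Option A) × List (Option A))),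
          (∀ f ∈ F, ∀ ab ∈ f.2, ab.1 ≠ []) →
          ((F.filterMap (addToFirst x)).map op).sum
            = LinearMap.rTensor _ (TensorProduct.mk R _ _ (letter R x) ∘ₗ wordIncl R A)
                (F.map op).sum := by
        intro F
        induction F with
        | nil => simp
        | cons f F ih =>
          intro hF
          have ih := ih fun f hf => hF f (List.mem_cons_of_mem _ hf)
          rcases f with ⟨_ | ⟨y, b₀⟩, _ | ⟨⟨a, b⟩, l⟩⟩
          · simpa [op, addToFirst, List.filterMap_cons] using ih
          · have ha : a ≠ [] := hF _ List.mem_cons_self (a, b) List.mem_cons_self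
            rw [show (([], (a, b) :: l) :: F).filterMap (addToFirst x)
              = ([], (x :: a, b) :: l) :: F.filterMap (addToFirst x) from rfl]
            simp only [List.map_cons, List.sum_cons, map_add, ih]
            have hx : word R (x :: a) = letter R x ⊗ₜ W a := rfl
            simp [op, hincl a ha, hx]
          · simpa [op, addToFirst, List.filterMap_cons] using ih
          · simpa [op, addToFirst, List.filterMap_cons] using ih
      rw [hw, factorizations, List.map_append, List.map_append, List.sum_append, List.sum_append,
        e₂, e₃ _ hne]
      split_ifs
      · rw [e₁, zero_add]
        rfl
      · simp only [List.map_nil, List.sum_nil, zero_add]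
        rfl
    refine ⟨h₁, ?_⟩
    have c₁ : ∀ F : List (List (Option A) × List (List (Option A) × List (Option A))),
        (∀ f ∈ F, f.1 = [] ∧ f.2 ≠ []) → closePiece R A (F.map op).sum
          = (F.map fun f => word R (lowerWord f.1 f.2) ⊗ₜ[R] Q f.2).sum := by
      intro F
      induction F with
      | nil => simp
      | cons f F ih =>
        intro hF
        have ih := ih fun f hf => hF f (List.mem_cons_of_mem _ hf)
        have hf := hF _ List.mem_cons_self
        rcases f with ⟨_ | ⟨y, b₀⟩, _ | ⟨⟨a, b⟩, l⟩⟩ <;> simp at hf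
        simp only [List.map_cons, List.sum_cons, map_add, ih]
        exact congrArg (· + _) (hclose a b l)
    have c₂ : ∀ F : List (List (Option A) × List (List (Option A) × List (Option A))),
        ∀ a : A, x = some a →
        ((F.map fun f => (x :: f.1, f.2)).map fun f => word R (lowerWord f.1 f.2) ⊗ₜ[R] Q f.2).sum
          = LinearMap.rTensor _ (TensorProduct.mk R _ _ ((letter R x).1, (0 : R)))
            (F.map fun f => W (lowerWord f.1 f.2) ⊗ₜ Q f.2).sum := by
      rintro F a rfl
      induction F with
      | nil => simp
      | cons f F ih =>
        simp only [List.map_cons, List.sum_cons, map_add, ih]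
        simp [lowerWord, word, W, letter]
    have c₃ : ∀ f ∈ (factorizations w).map (fun f => (([] : List (Option A)), ([x], f.1) :: f.2)) ++
        (factorizations w).filterMap (addToFirst x), f.1 = [] ∧ f.2 ≠ [] := by
      intro f hf
      rcases List.mem_append.1 hf with hf | hf
      · obtain ⟨g, hg, rfl⟩ := List.mem_map.1 hf
        simp
      · obtain ⟨g, hg, hgf⟩ := List.mem_filterMap.1 hf
        rcases g with ⟨_ | ⟨y, b₀⟩, _ | ⟨⟨a, b⟩, l⟩⟩ <;> simp [addToFirst] at hgf
        subst hgf
        simp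
    have c₄ : decompTotal R A (letter R x) (state w)
        = LinearMap.rTensor _ (TensorProduct.mk R _ _ ((letter R x).1, (0 : R))) (state w).1
          + closePiece R A (decompOpen R A (letter R x) (state w)) := rfl
    have c₅ : ∀ F : List (List (Option A) × List (List (Option A) × List (Option A))),
        ((F.map fun f => (x :: f.1, f.2)).map op).sum = 0 := by
      intro F
      induction F with
      | nil => rfl
      | cons f F ih => simpa [op] using ih
    rw [c₄, h₁, factorizations, List.map_append, List.sum_append, map_add, c₁ _ c₃,
      List.map_append (l₁ := ite _ _ _), List.sum_append (l₁ := List.map _ (ite _ _ _)),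
      ← add_assoc]
    congr 1
    rcases x with _ | a
    · have h0 : ((letter R (none : Option A)).1, (0 : R)) = 0 := rfl
      rw [h0, map_zero, LinearMap.rTensor_zero, LinearMap.zero_apply, zero_add,
        if_neg (by simp), List.map_nil, List.map_nil, List.sum_nil, List.sum_nil, map_zero]
    · rw [if_pos (Option.isSome_some (a := a)), c₅, map_zero, add_zero, c₂ _ a rfl, hw]
  have hstate : ∀ w, state w =
      (((factorizations w).map fun f => W (lowerWord f.1 f.2) ⊗ₜ Q f.2).sum,
        ((factorizations w).map op).sum) := by
    intro w
    induction w with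
    | nil => simp [state, W, Q, factorizations, lowerWord, op]
    | cons x w ih =>
      have h : state (x :: w) = decompAct R A (letter R x) (state w) := by
        simp [state, W]
      obtain ⟨h₁, h₂⟩ := hstep w ih x
      rw [h]
      change (LinearMap.rTensor _ (wordIncl R A) (decompTotal R A (letter R x) (state w)),
        decompOpen R A (letter R x) (state w)) = _
      rw [h₁, h₂]
      refine Prod.ext ?_ rfl
      have hlow : ∀ f ∈ factorizations (x :: w), lowerWord f.1 f.2 ≠ [] := by
        intro f hf
        simp only [factorizations, List.mem_append] at hf
        rcases hf with hf | hf | hf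
        · split_ifs at hf
          · obtain ⟨g, hg, rfl⟩ := List.mem_map.1 hf
            simp [lowerWord]
          · simp at hf
        · obtain ⟨g, hg, rfl⟩ := List.mem_map.1 hf
          simp [lowerWord]
        · obtain ⟨g, hg, hgf⟩ := List.mem_filterMap.1 hf
          rcases g with ⟨_ | ⟨y, b₀⟩, _ | ⟨⟨a, b⟩, l⟩⟩ <;> simp [addToFirst] at hgf
          subst hgf
          simp [lowerWord]
      simp only [map_list_sum, List.map_map]
      refine congrArg List.sum (List.map_congr_left fun f hf => ?_)
      simp [hincl _ (hlow f hf)]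
  have := (hstep w (hstate w) x).2
  refine Eq.trans ?_ this
  simp [wordDecomp, word, state, W]

/-- The cooperad `coAs_A`: words of length at least one in `*` and `A`, the arity being the number
of letters `*`. -/
def coAs (A : Type v) [AddCommGroup A] [Module R A] : CooperadData R (Words R A) where
  arity n := Submodule.span R {c | ∃ w : List (Option A), w.countP Option.isNone = n ∧ c = word R w}
  decomp := wordDecomp R A
  counit := LinearMap.mul' R R ∘ₗ
    TensorProduct.map (LinearMap.snd R A R) (TensorAlgebra.algebraMapInv (M := A × R)).toLinearMap
  coaug := word R [none]

end Words

/-! ### Operator-valued probability spaces -/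

section Probability

/-- A `B`-valued probability space: a `B`-bimodule `A` with an associative product
`A ⊗_B A → A` of `B`-bimodules, a `B`-bimodule map `incl : B → A` respecting products, and a
`B`-bimodule map `E : A → B` with `E ∘ incl = id`.  Everything is linear over the ground ring `R`,
and neither `A` nor `B` need be unital or commutative. -/
structure OpValuedProbSpace (R : Type u) (B : Type v) (A : Type w) [CommRing R]
    [NonUnitalRing B] [Module R B] [IsScalarTower R B B] [SMulCommClass R B B]
    [NonUnitalRing A] [Module R A] [IsScalarTower R A A] [SMulCommClass R A A] where
  lact : B →ₗ[R] A →ₗ[R] A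
  ract : A →ₗ[R] B →ₗ[R] A
  lact_lact : ∀ b b' a, lact b (lact b' a) = lact (b * b') a
  ract_ract : ∀ a b b', ract (ract a b) b' = ract a (b * b')
  lact_ract : ∀ b a b', ract (lact b a) b' = lact b (ract a b')
  mul_balanced : ∀ a b a', ract a b * a' = a * lact b a'
  lact_mul : ∀ b a a', lact b (a * a') = lact b a * a'
  mul_ract : ∀ a a' b, ract (a * a') b = a * ract a' b
  incl : B →ₗ[R] A
  incl_mul : ∀ b b', incl (b * b') = incl b * incl b'
  incl_lact : ∀ b b', incl (b * b') = lact b (incl b')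
  incl_ract : ∀ b b', incl (b * b') = ract (incl b) b'
  E : A →ₗ[R] B
  E_lact : ∀ b a, E (lact b a) = b * E a
  E_ract : ∀ a b, E (ract a b) = E a * b
  E_incl : ∀ b, E (incl b) = b

/-- The product of a nonempty list, without a unit element (junk value `0` for the empty list). -/
def listProd {M : Type*} [Mul M] [Zero M] : List M → M
  | [] => 0
  | x :: l => l.foldl (· * ·) x

/-- A partition of `s` is noncrossing if there are no `w < x < y < z` with `w, y` in one block and
`x, z` in another block. -/
def IsNoncrossing {I : Type*} [LinearOrder I] {s : Finset I} (π : Finpartition s) : Prop :=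
  ∀ p ∈ π.parts, ∀ q ∈ π.parts, p ≠ q →
    ¬ ∃ w ∈ p, ∃ x ∈ q, ∃ y ∈ p, ∃ z ∈ q, w < x ∧ x < y ∧ y < z

open Classical in
/-- The noncrossing partitions of `{1, …, n}`. -/
def NC (n : ℕ) : Finset (Finpartition (Finset.univ : Finset (Fin n))) :=
  Finset.univ.filter IsNoncrossing

/-- The word obtained from a list of elements of `A` and of `B` by writing `*` for the latter. -/
def shape {A : Type w} {B : Type v} (L : List (A ⊕ B)) : List (Option A) := L.map (Sum.elim some fun _ => none)

/-- The elements of `B` in a list, in order. -/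
def inputs {A : Type w} {B : Type v} (L : List (A ⊕ B)) : List B := L.filterMap Sum.getRight?

/-- The list `a₁, (b₁), a₂, …, (b_{m-1}), a_m`, in which each `b_j` may be present or absent. -/
def gapList {A : Type w} {B : Type v} (a : A) (g : List (Option B × A)) : List (A ⊕ B) :=
  .inl a :: g.flatMap fun x => x.1.toList.map .inr ++ [.inl x.2]

namespace OpValuedProbSpace

variable {R : Type u} {B : Type v} {A : Type w} [CommRing R]
  [NonUnitalRing B] [Module R B] [IsScalarTower R B B] [SMulCommClass R B B]
  [NonUnitalRing A] [Module R A] [IsScalarTower R A A] [SMulCommClass R A A]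
  (P : OpValuedProbSpace R B A)

/-- Bookkeeping for the insertion of elements of `B` between elements of `A`: the elements of `B`
before the first element of `A`, and the list of the elements of `A`, each multiplied on the right
by the elements of `B` that follow it. -/
def contract : List (A ⊕ B) → List B × List A
  | [] => ([], [])
  | .inr b :: L => (b :: (contract L).1, (contract L).2)
  | .inl a :: L => ([], (contract L).1.foldl (fun a b => P.ract a b) a :: (contract L).2)

/-- The image in `A ⊗_B ⋯ ⊗_B A`, as a list of factors, of a list
`b_{0,1}, …, b_{0,i₀}, a₁, b_{1,1}, …, b_{1,i₁}, a₂, …, a_m, b_{m,1}, …, b_{m,i_m}` containing at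
least one element of `A`, under the action of `B` on `A`.  Thus `f (insertion L)` is
`f_{i₀, …, i_m}(a₁ ⊗ ⋯ ⊗ a_m)(b_{0,1} ⊗ ⋯ ⊗ b_{m,i_m})`. -/
def insertion (L : List (A ⊕ B)) : List A :=
  match P.contract L with
  | (_, []) => []
  | (bs, a :: as) => bs.foldr (fun b a => P.lact b a) a :: as

/-- `E(b_{0,1} ⋯ b_{0,i₀} a₁ b_{1,1} ⋯ b_{1,i₁} a₂ ⋯ a_m b_{m,1} ⋯ b_{m,i_m})`. -/
def moment (L : List (A ⊕ B)) : B :=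
  match P.contract L with
  | (bs, []) => P.E (P.incl (listProd bs))
  | (_, _ :: _) => P.E (listProd (P.insertion L))

/-- The nested evaluation of `f` (whose value at lists of length `k` is `f^{(k)}`) along a
noncrossing partition `π`, on a set `s` of indices that is a union of blocks. Let `V = {l₀ < ⋯ < l_k}` be the block of the least element of `s`.  The elements of `s` strictly
between `l_{j-1}` and `l_j` are evaluated recursively, and the product of the results multiplies
`a_{l_{j-1}}` on the right; then `f^{(k+1)}` is applied to these arguments.  The result is the list
of the values of the outermost blocks, from left to right. -/
def nestedValues {I : Type*} [LinearOrder I] {S : Finset I} (f : List A → B) (π : Finpartition S)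
    (a : I → A) (s : Finset I) : List B :=
  if h : s.Nonempty then
    f (((π.part (s.min' h)).sort (· ≤ ·)).map fun l =>
      (nestedValues f π a ((s.erase (s.min' h)).filter fun x =>
        x ∉ π.part (s.min' h) ∧ l < x ∧ (∃ v ∈ π.part (s.min' h), x < v) ∧
          ∀ v ∈ π.part (s.min' h), v < x → v ≤ l)).foldl (fun a b => P.ract a b) (a l)) ::
    nestedValues f π a ((s.erase (s.min' h)).filter fun x => ∀ v ∈ π.part (s.min' h), v < x)
  else []
termination_by s.card
decreasing_by
  all_goals
    exact lt_of_le_of_lt (Finset.card_filter_le _ _)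
      (Finset.card_erase_lt_of_mem (Finset.min'_mem s h))

/-- The multiplicative function `f̂(π, a₁ ⊗ ⋯ ⊗ aₙ)`. -/
def multiplicative (f : List A → B) {n : ℕ} (π : Finpartition (Finset.univ : Finset (Fin n)))
    (a : Fin n → A) : B :=
  listProd (P.nestedValues f π a Finset.univ)

open Classical in
/-- The operator-valued free cumulants `κₙ(a₁ ⊗ ⋯ ⊗ aₙ)`, defined recursively by
`E(a₁ ⋯ aₙ) = ∑_{π ∈ NC(n)} κ̂(π, a₁ ⊗ ⋯ ⊗ aₙ)`: the term of the partition with one block is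
`κₙ(a₁ ⊗ ⋯ ⊗ aₙ)`, and the others involve only cumulants of lower order. -/
def cumulant (l : List A) : B :=
  P.E (listProd l) - ∑ π ∈ (NC l.length).filter (fun π => π.parts ≠ {Finset.univ}),
    P.multiplicative (fun l' => if _h : l'.length < l.length then cumulant l' else 0) π l.get
termination_by l.length

/-! ### The moment morphism -/

/-- The moment morphism: the morphism from `coAs_A` to the cofree cooperad on `End B` whose linear
restriction `m` sends a word `w` with `n` letters `*` to the operation
`(b₁, …, bₙ) ↦ E(w with the letters * replaced by b₁, …, bₙ)`. (The word `*` spans the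
coaugmentation, where a morphism to a cofree cooperad is prescribed.) -/
structure IsMomentMorphism (M : Words R A →ₗ[R] DecTrees R (EndB R B)) : Prop where
  isHom : IsCooperadHom (coAs R A) (cofree R (EndB R B)) M
  restriction : ∀ L : List (A ⊕ B), L ≠ [] → shape L ≠ [none] →
    evalAt (corollaPart (M (word R (shape L)))) (inputs L) = P.moment L

end OpValuedProbSpace

end Probability

end OperadicCumulants
end

/-!
A morphism from a conilpotent cooperad to the cooperad of decorated trees is determined by its
linear restriction `f` through the recursion `F c = ε(c) | + ∑ graft f(c') (F c'')`, in which a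
tree is rebuilt from its root vertex and its branches. The recursion is solved along the
conilpotency filtration, and coassociativity makes the solution a morphism (`IsTreeModel.hom_ext`,
`IsTreeModel.exists_hom`). This gives existence and uniqueness of the moment morphism `M` and of
the canonical twist `Φ`. As the composition of a corolla is its decoration, `Φ` is the identity up
to trees with fewer vertices, hence an isomorphism (`IsTreeModel.exists_inverse`).

Let `K = Φ⁻¹ ∘ M`, with linear restriction `k`. Composing trees is, up to the trivial tree, the
linear restriction of `Φ`, so the composition of trees applied to `K` gives back the moments, and
the recursion for `K` becomes a recursion for the moments (`moment_eq_tokSum`): with the inputs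
inserted for the letters `*`, the moment `m(L)` of a list `L` of elements of `A` and `B`, other
than a single element of `B`, is the sum, over all ways to replace disjoint segments of `L`
(covering at least the elements of `B`) by their moments, of the value of `k` at the resulting
list. The segment `L` itself contributes no value of `k`, as `k` vanishes on the word `*`.

The term without replacement except of single elements of `B` is `k(L)` itself, and all other terms
are of smaller weight; so the recursion has only one solution. The solution is as follows
(`eq_signedProd_add_gapValue`): for a list of `n ≥ 2` elements of `B` it is `(-1)ⁿ` times the
product, and for other lists it is the value of `k` at the list in `A` in which each element of `B`
between two elements of `A` is multiplied onto the element before it, or zero if there is no such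
list. In the verification, the sum over the tokenizations of these two kinds of terms is a signed
sum over cuts into segments (`cutSum`) plus a sum over sublists containing the first and the last
element (`chainSum`). Both vanish if the list has an end in `B`, and both are unchanged when a
product of an element of `A` and an element of `B` is contracted, which decreases the weight.

For lists in `A`, inverting the signed sum over cuts (`moment_eq_cutSum`) turns the recursion into
the statement that the moment is the sum over the sublists containing the first element of the
value of `k` at the sublist, with the moments of the gaps inserted (`moment_eq_chainSumTail`). The
sum of the nested evaluations over the noncrossing partitions satisfies the same recursion, in
which the sublist is the block of the least element: a noncrossing partition consists of that block
and of noncrossing partitions of the gaps (`sum_ncPartitions_glue`, `prefixedValue_cons`,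
`chainSumTail_eq_sum_prefixedValue`). So `k` at lists in `A` satisfies the moment-cumulant formula,
which determines the free cumulants (`cumulant_eq`), and the statements on `K` follow.
-/

noncomputable section

namespace OperadicCumulants

universe u v w x

section

/-! ### Monomials in the tensor algebra -/

section Monomials

variable {R : Type u} [CommRing R] {X : Type w} [AddCommGroup X] [Module R X]
  {Y : Type x} [AddCommGroup Y] [Module R Y]

variable (R) in
/-- The product `x₁ ⊗ ⋯ ⊗ xₙ` of a list of elements in the tensor algebra. -/
def monomial (l : List X) : TensorAlgebra R X := (l.map (TensorAlgebra.ι R)).prod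

@[simp] theorem monomial_nil : monomial R ([] : List X) = 1 := rfl

@[simp] theorem monomial_cons (a : X) (l : List X) :
    monomial R (a :: l) = TensorAlgebra.ι R a * monomial R l := by
  simp [monomial]

theorem monomial_append (l l' : List X) :
    monomial R (l ++ l') = monomial R l * monomial R l' := by
  simp [monomial]

theorem monomial_flatten (L : List (List X)) :
    monomial R L.flatten = (L.map (monomial R)).prod := by
  induction L with
  | nil => simp
  | cons l L ih => simp [monomial_append, ih]

theorem span_monomial : Submodule.span R (Set.range (monomial R (X := X))) = ⊤ := by
  rw [eq_top_iff, ← Algebra.top_toSubmodule, ← TensorAlgebra.adjoin_range_ι,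
    Algebra.adjoin_eq_span]
  refine Submodule.span_mono fun z hz => ?_
  obtain ⟨L, hL, rfl⟩ := Submonoid.exists_list_of_mem_closure hz
  clear hz
  induction L with
  | nil => exact ⟨[], rfl⟩
  | cons a L ih =>
    obtain ⟨l, hl⟩ := ih fun y hy => hL y (List.mem_cons_of_mem _ hy)
    obtain ⟨y, rfl⟩ := hL a List.mem_cons_self
    exact ⟨y :: l, by simp [hl]⟩

theorem monomial_ext {f g : TensorAlgebra R X →ₗ[R] Y}
    (h : ∀ l, f (monomial R l) = g (monomial R l)) : f = g := by
  refine LinearMap.ext_on_range (v := monomial R (X := X)) ?_ h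
  exact span_monomial

/-- The component of degree `n` of an element of the tensor algebra. -/
def degreePart (n : ℕ) : TensorAlgebra R X →ₗ[R] ⨂[R] _ : Fin n, X :=
  DirectSum.component R ℕ (fun k => ⨂[R] _ : Fin k, X) n ∘ₗ
    (TensorAlgebra.toDirectSum (R := R) (M := X)).toLinearMap

theorem toDirectSum_ofFn {n : ℕ} (t : Fin n → X) :
    TensorAlgebra.toDirectSum (monomial R (List.ofFn t))
      = DirectSum.lof R ℕ (fun k => ⨂[R] _ : Fin k, X) n (PiTensorProduct.tprod R t) := by
  have h : monomial R (List.ofFn t) = TensorAlgebra.tprod R X n t := by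
    rw [TensorAlgebra.tprod_apply, monomial, List.map_ofFn]
    rfl
  rw [h, TensorAlgebra.toDirectSum_tensorPower_tprod, DirectSum.lof_eq_of]

theorem degreePart_ofFn {n : ℕ} (t : Fin n → X) :
    degreePart n (monomial R (List.ofFn t)) = PiTensorProduct.tprod R t := by
  simp only [degreePart, LinearMap.comp_apply, AlgHom.toLinearMap_apply, toDirectSum_ofFn]
  exact DirectSum.component.lof_self R _ _

theorem degreePart_ofFn_of_ne {m n : ℕ} (t : Fin m → X) (h : m ≠ n) :
    degreePart n (monomial R (List.ofFn t)) = 0 := by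
  simp only [degreePart, LinearMap.comp_apply, AlgHom.toLinearMap_apply, toDirectSum_ofFn]
  rw [DirectSum.component.of, dif_neg h]

/-- The algebra homomorphism of tensor algebras induced by a linear map. -/
abbrev tensorMap (f : X →ₗ[R] Y) : TensorAlgebra R X →ₐ[R] TensorAlgebra R Y :=
  TensorAlgebra.lift R (TensorAlgebra.ι R ∘ₗ f)

@[simp] theorem tensorMap_monomial (f : X →ₗ[R] Y) (l : List X) :
    tensorMap f (monomial R l) = monomial R (l.map f) := by
  induction l with
  | nil => simp
  | cons a l ih => rw [monomial_cons, map_mul, ih]; simp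

theorem monomial_ofFn_ext {f g : TensorAlgebra R X →ₗ[R] Y}
    (h : ∀ n (t : Fin n → X), f (monomial R (List.ofFn t)) = g (monomial R (List.ofFn t))) :
    f = g :=
  monomial_ext fun l => by rw [← List.ofFn_get l]; exact h _ _

theorem tensorMap_ofFn (f : X →ₗ[R] Y) {n : ℕ} (t : Fin n → X) :
    tensorMap f (monomial R (List.ofFn t)) = monomial R (List.ofFn fun i => f (t i)) := by
  rw [tensorMap_monomial, List.map_ofFn]
  rfl

theorem lift_monomial {Q : Type*} [Ring Q] [Algebra R Q] (f : X →ₗ[R] Q) (l : List X) :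
    TensorAlgebra.lift R f (monomial R l) = (l.map f).prod := by
  induction l with
  | nil => simp
  | cons a l ih => rw [monomial_cons, map_mul, ih]; simp

/-- A multilinear map takes values in a submodule if it does so on spanning sets. -/
theorem multilinear_mem_of_mem_span {ι : Type*} [Fintype ι] {X : ι → Type*}
    [∀ i, AddCommGroup (X i)] [∀ i, Module R (X i)]
    (f : MultilinearMap R X Y) (S : ∀ i, Set (X i)) (N : Submodule R Y)
    (h : ∀ s, (∀ i, s i ∈ S i) → f s ∈ N) (t : ∀ i, X i) (ht : ∀ i, t i ∈ Submodule.span R (S i)) :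
    f t ∈ N := by
  classical
  have key : ∀ J : Finset ι, ∀ t : ∀ i, X i, (∀ i ∈ J, t i ∈ Submodule.span R (S i)) →
      (∀ i ∉ J, t i ∈ S i) → f t ∈ N := by
    intro J
    induction J using Finset.induction with
    | empty => exact fun t _ ht => h t fun i => ht i (by simp)
    | insert j J hj ih =>
      intro t h₁ h₂
      have hup : ∀ y ∈ Submodule.span R (S j), f (Function.update t j y) ∈ N := by
        intro y hy
        induction hy using Submodule.span_induction with
        | mem y hy =>
          refine ih _ (fun i hi => ?_) fun i hi => ?_
          · rw [Function.update_of_ne (by rintro rfl; exact hj hi)]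
            exact h₁ i (Finset.mem_insert_of_mem hi)
          · by_cases hij : i = j
            · subst hij; simpa using hy
            · rw [Function.update_of_ne hij]
              exact h₂ i (by simp [hij, hi])
        | zero => rw [MultilinearMap.map_update_zero]; exact N.zero_mem
        | add y z _ _ hy hz => rw [MultilinearMap.map_update_add]; exact N.add_mem hy hz
        | smul r y _ hy => rw [MultilinearMap.map_update_smul]; exact N.smul_mem r hy
      simpa using hup (t j) (h₁ j (Finset.mem_insert_self _ _))
  exact key Finset.univ t (fun i _ => ht i) (by simp)

/-- Two linear maps on `T(X) ⊗ Q` agree on a product of `n` elements of degree one in the left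
factor if they agree on the tensors whose left factor is a monomial of degree `n`. -/
theorem map_prod_eq_of_length {Q : Type*} [Ring Q] [Algebra R Q] {n : ℕ}
    {f g : TensorAlgebra R X ⊗[R] Q →ₗ[R] Y}
    (h : ∀ l : List X, l.length = n → ∀ q, f (monomial R l ⊗ₜ q) = g (monomial R l ⊗ₜ q))
    (z : Fin n → X ⊗[R] Q) :
    f (List.ofFn fun i => LinearMap.rTensor Q (TensorAlgebra.ι R) (z i)).prod
      = g (List.ofFn fun i => LinearMap.rTensor Q (TensorAlgebra.ι R) (z i)).prod := by
  have key := multilinear_mem_of_mem_span (R := R) (X := fun _ : Fin n => X ⊗[R] Q)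
    (((MultilinearMap.mkPiAlgebraFin R n (TensorAlgebra R X ⊗[R] Q)).compLinearMap
      fun _ => LinearMap.rTensor Q (TensorAlgebra.ι R)))
    (fun _ => {t | ∃ c q, c ⊗ₜ[R] q = t}) (LinearMap.ker (f - g)) ?_ z
    (fun i => by rw [TensorProduct.span_tmul_eq_top]; trivial)
  · rw [LinearMap.mem_ker, LinearMap.sub_apply, sub_eq_zero] at key
    simpa using key
  · intro s hs
    choose c q hs using hs
    have hl : ∀ l : List (X × Q), (l.map fun p => TensorAlgebra.ι R p.1 ⊗ₜ[R] p.2).prod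
        = monomial R (l.map Prod.fst) ⊗ₜ[R] (l.map Prod.snd).prod := by
      intro l
      induction l with
      | nil => simp [Algebra.TensorProduct.one_def]
      | cons p l ih => simp [ih]
    have hl' := hl (List.ofFn fun i => (c i, q i))
    rw [List.map_ofFn] at hl'
    rw [LinearMap.mem_ker, LinearMap.sub_apply, sub_eq_zero]
    simp only [MultilinearMap.compLinearMap_apply, MultilinearMap.mkPiAlgebraFin_apply, ← hs,
      LinearMap.rTensor_tmul]
    simp only [Function.comp_def] at hl'
    rw [hl']
    exact h _ (by simp) _

end Monomials

/-! ### Planting forests on a root vertex -/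

section Planting

variable {R : Type u} [CommRing R] {V : ℕ → Type v} [∀ n, AddCommGroup (V n)]
  [∀ n, Module R (V n)] {X : Type w} [AddCommGroup X] [Module R X]
  {Y : Type x} [AddCommGroup Y] [Module R Y]

/-- A family of actions `g n` of `V n` on `n`-tuples, as a bilinear map on
`⨁ₙ V n` and the tensor algebra: `(x, x₁ ⊗ ⋯ ⊗ xₙ) ↦ g n x (x₁, …, xₙ)`, which only sees the
component of arity `n` of `x`. -/
def plantWith (g : ∀ n, V n →ₗ[R] MultilinearMap R (fun _ : Fin n => X) Y) :
    (⨁ n, V n) →ₗ[R] TensorAlgebra R X →ₗ[R] Y :=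
  DirectSum.toModule R ℕ _ fun n =>
    LinearMap.lcomp R Y (degreePart n) ∘ₗ PiTensorProduct.lift.toLinearMap ∘ₗ g n

theorem plantWith_lof (g : ∀ n, V n →ₗ[R] MultilinearMap R (fun _ : Fin n => X) Y) (n : ℕ)
    (y : V n) (q : TensorAlgebra R X) :
    plantWith g (DirectSum.lof R ℕ V n y) q = PiTensorProduct.lift (g n y) (degreePart n q) := by
  rw [plantWith, DirectSum.toModule_lof]
  simp only [LinearMap.comp_apply, LinearMap.lcomp_apply, LinearEquiv.coe_coe]

theorem plantWith_ofFn (g : ∀ n, V n →ₗ[R] MultilinearMap R (fun _ : Fin n => X) Y)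
    (y : ⨁ n, V n) {m : ℕ} (t : Fin m → X) :
    plantWith g y (monomial R (List.ofFn t)) = g m (y m) t := by
  induction y using DirectSum.induction_on with
  | zero => simp
  | of n y =>
    rw [← DirectSum.lof_eq_of R, plantWith_lof]
    by_cases h : m = n
    · subst h
      rw [degreePart_ofFn, DirectSum.lof_apply, PiTensorProduct.lift.tprod]
    · rw [degreePart_ofFn_of_ne t h, map_zero, DirectSum.lof_eq_of,
        DirectSum.of_eq_of_ne _ _ _ h, map_zero, zero_apply]
  | add y z hy hz => simp [hy, hz]

theorem plantWith_monomial (g : ∀ n, V n →ₗ[R] MultilinearMap R (fun _ : Fin n => X) Y)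
    (y : ⨁ n, V n) (l : List X) :
    plantWith g y (monomial R l) = g l.length (y l.length) l.get := by
  conv_lhs => rw [← List.ofFn_get l]
  exact plantWith_ofFn g y l.get

end Planting

end

section

/-! ### Models of the cofree cooperad -/

section TreeModel

variable {R : Type u} [CommRing R] {V : ℕ → Type v} [∀ n, AddCommGroup (V n)]
  [∀ n, Module R (V n)] {D : Type w} [AddCommGroup D] [Module R D]
  {X : Type x} [AddCommGroup X] [Module R X]

/-- Elements obtained from `e` by repeated grafting: `IsHomogeneous g e n k t` says that `t` is a
tree with `n` leaves and `k` vertices. -/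
inductive IsHomogeneous (g : ∀ n, V n →ₗ[R] MultilinearMap R (fun _ : Fin n => D) D) (e : D) :
    ℕ → ℕ → D → Prop
  | trivial : IsHomogeneous g e 1 0 e
  | graft (n : ℕ) (y : V n) (p q : Fin n → ℕ) (t : Fin n → D)
      (h : ∀ i, IsHomogeneous g e (p i) (q i) (t i)) :
      IsHomogeneous g e (∑ i, p i) (1 + ∑ i, q i) (g n y t)

/-- The properties of the grafting operations `g` and of the projection to corollas `π` which
characterize the cooperad `T` of decorated trees among all cooperads. -/
structure IsTreeModel (T : CooperadData R D)
    (g : ∀ n, V n →ₗ[R] MultilinearMap R (fun _ : Fin n => D) D) (π : D →ₗ[R] ⨁ n, V n) :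
    Prop where
  induction : ∀ N : Submodule R D, T.coaug ∈ N →
    (∀ n (y : V n) (t : Fin n → D), (∀ i, t i ∈ N) → g n y t ∈ N) → ∀ t, t ∈ N
  arity_eq : ∀ n, T.arity n = Submodule.span R {t | ∃ k, IsHomogeneous g T.coaug n k t}
  decomp_coaug : T.decomp T.coaug = T.coaug ⊗ₜ TensorAlgebra.ι R T.coaug
  decomp_graft : ∀ n (y : V n) (t : Fin n → D), T.decomp (g n y t)
    = T.coaug ⊗ₜ TensorAlgebra.ι R (g n y t)
      + LinearMap.rTensor _ (PiTensorProduct.lift (g n y))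
        (gather (TensorAlgebra R D) n fun i => T.decomp (t i))
  counit_coaug : T.counit T.coaug = 1
  counit_graft : ∀ n (y : V n) (t : Fin n → D), T.counit (g n y t) = 0
  proj_coaug : π T.coaug = 0
  proj_graft : ∀ n (y : V n) (t : Fin n → D),
    π (g n y t) = (∏ i, T.counit (t i)) • DirectSum.lof R ℕ V n y

/-- A linear map `f` intertwining the operations `g` with the operations `g'`, applied to a planted
forest. -/
theorem map_plantWith {g : ∀ n, V n →ₗ[R] MultilinearMap R (fun _ : Fin n => D) D}
    {g' : ∀ n, V n →ₗ[R] MultilinearMap R (fun _ : Fin n => X) X} {f : D →ₗ[R] X}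
    (hf : ∀ n y t, f (g n y t) = g' n y fun i => f (t i))
    (y : ⨁ n, V n) (q : TensorAlgebra R D) :
    f (plantWith g y q) = plantWith g' y (tensorMap f q) := by
  have h : f ∘ₗ plantWith g y = plantWith g' y ∘ₗ (tensorMap f).toLinearMap := by
    refine monomial_ofFn_ext fun n t => ?_
    simp only [LinearMap.comp_apply, AlgHom.toLinearMap_apply, tensorMap_ofFn,
      plantWith_ofFn, hf]
  simpa only [LinearMap.comp_apply, AlgHom.toLinearMap_apply] using LinearMap.congr_fun h q

/-- `gather` separates left and right factors; on a product in `T(D) ⊗ Q` the same is achieved by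
planting the component of degree `n` of the left factor. -/
theorem lift_gather {g : ∀ n, V n →ₗ[R] MultilinearMap R (fun _ : Fin n => D) D}
    {Q : Type x} [Ring Q] [Algebra R Q] (n : ℕ) (y : V n) (z : Fin n → D ⊗[R] Q) :
    LinearMap.rTensor _ (PiTensorProduct.lift (g n y)) (gather Q n z)
      = LinearMap.rTensor _ (plantWith g (DirectSum.lof R ℕ V n y))
        (List.ofFn fun i => LinearMap.rTensor _ (TensorAlgebra.ι R) (z i)).prod := by
  have h : plantWith g (DirectSum.lof R ℕ V n y)
      = PiTensorProduct.lift (g n y) ∘ₗ degreePart n :=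
    LinearMap.ext fun q => plantWith_lof _ _ _ _
  rw [h, LinearMap.rTensor_comp]
  rfl

namespace IsTreeModel

variable {T : CooperadData R D} {g : ∀ n, V n →ₗ[R] MultilinearMap R (fun _ : Fin n => D) D}
  {π : D →ₗ[R] ⨁ n, V n} (hT : IsTreeModel T g π)
include hT

/-- Linear maps out of a tree model are compared by induction: on the trivial tree, and on grafted
trees on whose branches they agree. -/
theorem linearMap_ext {f f' : D →ₗ[R] X} (h₀ : f T.coaug = f' T.coaug)
    (h : ∀ n (y : V n) (t : Fin n → D), (∀ i, f (t i) = f' (t i)) → f (g n y t) = f' (g n y t)) :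
    f = f' := by
  refine LinearMap.ext fun t => ?_
  have := hT.induction (LinearMap.eqLocus f f') h₀ h t
  exact this

theorem counit_plant (y : ⨁ n, V n) (q : TensorAlgebra R D) :
    T.counit (plantWith g y q) = 0 := by
  have h : T.counit ∘ₗ plantWith g y = 0 := by
    refine monomial_ofFn_ext fun n t => ?_
    rw [LinearMap.comp_apply, plantWith_ofFn, hT.counit_graft, LinearMap.zero_apply]
  exact LinearMap.congr_fun h q

theorem proj_plant_ofFn (y : ⨁ n, V n) {n : ℕ} (t : Fin n → D) :
    π (plantWith g y (monomial R (List.ofFn t)))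
      = TensorAlgebra.lift R T.counit (monomial R (List.ofFn t)) • DirectSum.lof R ℕ V n (y n) := by
  rw [plantWith_ofFn, hT.proj_graft, lift_monomial, List.map_ofFn, List.prod_ofFn]
  rfl

theorem decomp_plant (y : ⨁ n, V n) (q : TensorAlgebra R D) :
    T.decomp (plantWith g y q) = T.coaug ⊗ₜ TensorAlgebra.ι R (plantWith g y q)
        + LinearMap.rTensor _ (plantWith g y)
          (TensorAlgebra.lift R (LinearMap.rTensor _ (TensorAlgebra.ι R) ∘ₗ T.decomp) q) := by
  have h : T.decomp ∘ₗ plantWith g y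
      = (TensorProduct.mk R _ _ T.coaug ∘ₗ TensorAlgebra.ι R) ∘ₗ plantWith g y
        + LinearMap.rTensor _ (plantWith g y) ∘ₗ (TensorAlgebra.lift R
            (LinearMap.rTensor _ (TensorAlgebra.ι R) ∘ₗ T.decomp)).toLinearMap := by
    refine monomial_ofFn_ext fun n t => ?_
    simp only [LinearMap.comp_apply, LinearMap.add_apply, AlgHom.toLinearMap_apply,
      plantWith_ofFn, hT.decomp_graft, TensorProduct.mk_apply, lift_gather, lift_monomial,
      List.map_ofFn]
    congr 1
    refine map_prod_eq_of_length (f := LinearMap.rTensor _ (plantWith g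
      (DirectSum.lof R ℕ V n (y n)))) (g := LinearMap.rTensor _ (plantWith g y)) ?_ _
    intro l hl q
    subst hl
    rw [LinearMap.rTensor_tmul, LinearMap.rTensor_tmul, plantWith_monomial, plantWith_monomial,
      DirectSum.lof_apply]
  simpa only [LinearMap.comp_apply, LinearMap.add_apply, AlgHom.toLinearMap_apply,
    TensorProduct.mk_apply] using LinearMap.congr_fun h q

end IsTreeModel

end TreeModel

end

section

/-! ### Decorated trees are a model of the cofree cooperad -/

section Cofree

variable {R : Type u} [CommRing R] {V : ℕ → Type v} [∀ n, AddCommGroup (V n)]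
  [∀ n, Module R (V n)]

theorem graftLower_eq_gather (n) (y : V n) (z) : graftLower V n y z = 
      LinearMap.rTensor _ (PiTensorProduct.lift (graft n y))
        (gather (TensorAlgebra R (DecTrees R V)) n z) := by
   rw [graftLower, LinearMap.coe_mk, AddHom.coe_mk, LinearMap.compMultilinearMap_apply]

theorem map_mem_of_tmul_mem {M M' Y : Type*} [AddCommGroup M] [Module R M] [AddCommGroup M']
    [Module R M'] [AddCommGroup Y] [Module R Y] (L : M ⊗[R] M' →ₗ[R] Y) (N : Submodule R Y)
    (h : ∀ y w, L (y ⊗ₜ w) ∈ N) (z : M ⊗[R] M') : L z ∈ N := by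
  induction z using TensorProduct.induction_on with
  | zero => rw [map_zero]; exact N.zero_mem
  | tmul y w => exact h y w
  | add a b ha hb => rw [map_add]; exact N.add_mem ha hb

theorem ofTree_mem_span (p : PTree) (z : Decoration R V p) :
    ofTree p z ∈ Submodule.span R
      {t | ∃ k, IsHomogeneous (graft (R := R) (V := V)) trivialTree p.leaves k t} := by
  induction p with
  | leaf =>
    have h : ofTree (R := R) (V := V) .leaf z = (ULift.down z : R) • trivialTree := by
      refine Eq.trans ?_ ((ofTree (R := R) (V := V) .leaf).map_smul (ULift.down z : R)
        ((ULift.up 1 : ULift.{max u v} R) : Decoration R V .leaf))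
      exact congrArg _ (ULift.ext _ _ (mul_one (ULift.down z : R)).symm)
    rw [h]
    exact Submodule.smul_mem _ _ (Submodule.subset_span ⟨0, .trivial⟩)
  | node n c ih =>
    set N := Submodule.span R
      {t | ∃ k, IsHomogeneous (graft (R := R) (V := V)) trivialTree (PTree.node n c).leaves k t}
    have h₁ : ∀ (y : V n) (w : ⨂[R] i, Decoration R V (c i)),
        ofTree (.node n c) (assemble n c y w) ∈ N := by
      intro y w
      have hw : w ∈ Submodule.span R
          (Set.range (PiTensorProduct.tprod R (s := fun i => Decoration R V (c i)))) := by
        rw [PiTensorProduct.span_tprod_eq_top]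
        trivial
      induction hw using Submodule.span_induction with
      | mem w hw =>
        obtain ⟨w, rfl⟩ := hw
        rw [← graft_ofTree]
        refine multilinear_mem_of_mem_span (graft n y) _ N (fun s hs => ?_) _ fun i => ih i (w i)
        choose k hk using hs
        exact Submodule.subset_span ⟨_, .graft n y _ k s hk⟩
      | zero => rw [map_zero, map_zero]; exact N.zero_mem
      | add a b _ _ ha hb => rw [map_add, map_add]; exact N.add_mem ha hb
      | smul r a _ ha => rw [map_smul, map_smul]; exact N.smul_mem r ha
    exact map_mem_of_tmul_mem (ofTree (.node n c) :
      V n ⊗[R] (⨂[R] i, Decoration R V (c i)) →ₗ[R] DecTrees R V) N h₁ z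

theorem exists_tree_of_isHomogeneous {n k : ℕ} {t : DecTrees R V}
    (h : IsHomogeneous (graft (R := R) (V := V)) trivialTree n k t) :
    ∃ p : PTree, p.leaves = n ∧ t ∈ LinearMap.range (ofTree (R := R) (V := V) p) := by
  induction h with
  | trivial => exact ⟨.leaf, rfl, LinearMap.mem_range_self _ _⟩
  | graft n y p q t _ ih =>
    choose c hc hz using ih
    choose z hz using hz
    refine ⟨.node n c, ?_, ?_⟩
    · rw [PTree.leaves]
      exact Finset.sum_congr rfl fun i _ => hc i
    · have : t = fun i => ofTree (c i) (z i) := funext fun i => (hz i).symm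
      rw [this, graft_ofTree]
      exact LinearMap.mem_range_self _ _

/-- The decorated trees are a model of themselves. -/
theorem isTreeModel_cofree : IsTreeModel (cofree R V) (graft (R := R) (V := V)) corollaPart where
  -- Two maps which agree on trees agree: this is applied to the quotient map by `N` and zero.
  induction N h₀ h t := by
    replace h₀ : trivialTree ∈ N := h₀
    have hN : N.mkQ = 0 := decTrees_ext (R := R) (V := V) N.mkQ 0
      (by rw [LinearMap.zero_apply, Submodule.mkQ_apply, (Submodule.Quotient.mk_eq_zero N).2 h₀])
      (fun n y t ht => by
        have ht' : ∀ i, t i ∈ N := fun i => by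
          have := ht i
          rwa [LinearMap.zero_apply, Submodule.mkQ_apply, Submodule.Quotient.mk_eq_zero N] at this
        rw [LinearMap.zero_apply, Submodule.mkQ_apply,
          (Submodule.Quotient.mk_eq_zero N).2 (h n y t ht')])
    have := LinearMap.congr_fun hN t
    rwa [LinearMap.zero_apply, Submodule.mkQ_apply, Submodule.Quotient.mk_eq_zero N] at this
  arity_eq n := by
    refine le_antisymm ?_ ?_
    · refine iSup_le fun p => iSup_le fun hp => ?_
      subst hp
      rintro _ ⟨z, rfl⟩
      exact ofTree_mem_span p z
    · rw [Submodule.span_le]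
      rintro t ⟨k, hk⟩
      obtain ⟨p, hp, ht⟩ := exists_tree_of_isHomogeneous hk
      exact Submodule.mem_iSup_of_mem p (Submodule.mem_iSup_of_mem hp ht)
  decomp_coaug := treeDecomp_trivialTree R
  decomp_graft n y t :=
    (treeDecomp_graft R n y t).trans (congrArg _ (graftLower_eq_gather n y _))
  counit_coaug := by
    have : lowPart R V trivialTree = (1, 0) := fold_trivialTree _ _
    exact congrArg Prod.fst this
  counit_graft n y t := congrArg Prod.fst (lowPart_graft R n y t)
  proj_coaug := congrArg Prod.snd (fold_trivialTree (R := R) (V := V) _ _)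
  proj_graft n y t := congrArg Prod.snd (lowPart_graft R n y t)

end Cofree

end

section

/-! ### The universal property of the cofree cooperad -/

section Universal

variable {R : Type u} [CommRing R] {C : Type v} [AddCommGroup C] [Module R C]

/-- `c₁ ⊗ ⋯ ⊗ cₙ ↦ (c₁' ⊗ ⋯ ⊗ cₙ') ⊗ (c₁'' ⋯ cₙ'')`, where `Δ cᵢ = ∑ cᵢ' ∘ cᵢ''`. -/
def CooperadData.upper (S : CooperadData R C) :
    TensorAlgebra R C →ₐ[R] TensorAlgebra R C ⊗[R] TensorAlgebra R C :=
  TensorAlgebra.lift R (LinearMap.rTensor _ (TensorAlgebra.ι R) ∘ₗ S.decomp)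

/-- The elements `c ∘ (c₁ ⊗ ⋯ ⊗ cₖ)` of arity `n` of the composition product. -/
def CooperadData.composites (S : CooperadData R C) (n : ℕ) : Set (C ⊗[R] TensorAlgebra R C) :=
  {z | ∃ (k : ℕ) (c : C) (p : Fin k → ℕ) (d : Fin k → C), c ∈ S.arity k ∧
    (∀ i, d i ∈ S.arity (p i)) ∧ ∑ i, p i = n ∧ z = c ⊗ₜ monomial R (List.ofFn d)}

/-- The cooperad laws, and conilpotency in the form of an exhaustive increasing filtration `fil`,
starting with zero, such that all upper factors of the reduced decomposition
`Δ c - | ∘ c` of an element of `fil (n + 1)` are in `fil n`. -/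
structure IsConilpotentCooperad (S : CooperadData R C) (fil : ℕ → Submodule R C) : Prop where
  decomp_coaug : S.decomp S.coaug = S.coaug ⊗ₜ TensorAlgebra.ι R S.coaug
  counit_coaug : S.counit S.coaug = 1
  counit_left : ∀ c, TensorProduct.lid R _ (LinearMap.rTensor _ S.counit (S.decomp c))
    = TensorAlgebra.ι R c
  counit_right : ∀ c, TensorProduct.rid R _
    (LinearMap.lTensor _ (TensorAlgebra.lift R S.counit).toLinearMap (S.decomp c)) = c
  coassoc : ∀ c, TensorProduct.assoc R _ _ _ (LinearMap.rTensor _ S.decomp (S.decomp c))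
    = LinearMap.lTensor _ S.upper.toLinearMap (S.decomp c)
  iSup_arity : ⨆ n, S.arity n = ⊤
  decomp_arity : ∀ n, ∀ c ∈ S.arity n, S.decomp c ∈ Submodule.span R (S.composites n)
  counit_arity : ∀ n, n ≠ 1 → ∀ c ∈ S.arity n, S.counit c = 0
  fil_zero : fil 0 = ⊥
  fil_mono : Monotone fil
  exists_mem_fil : ∀ c, ∃ n, c ∈ fil n
  decomp_fil : ∀ n, ∀ c ∈ fil (n + 1), S.decomp c - S.coaug ⊗ₜ TensorAlgebra.ι R c ∈
    Submodule.span R {z | ∃ (c' : C) (l : List C), (∀ d ∈ l, d ∈ fil n) ∧ z = c' ⊗ₜ monomial R l}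

/-- A sequence of linear maps which is eventually constant at every point has a pointwise limit. -/
theorem exists_linearMap_of_eventually_eq {Y : Type w} [AddCommGroup Y] [Module R Y]
    (G : ℕ → C →ₗ[R] Y) (fil : ℕ → Submodule R C) (hmono : Monotone fil)
    (hex : ∀ c, ∃ n, c ∈ fil n)
    (hG : ∀ n m, n ≤ m → ∀ c ∈ fil n, G m c = G n c) :
    ∃ F : C →ₗ[R] Y, ∀ n, ∀ c ∈ fil n, F c = G n c := by
  choose N hN using hex
  have key : ∀ n, ∀ c ∈ fil n, G (N c) c = G n c := fun n c hc => by
    rcases le_total n (N c) with h | h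
    · exact hG _ _ h c hc
    · exact (hG _ _ h c (hN c)).symm
  refine ⟨{ toFun := fun c => G (N c) c, map_add' := fun a b => ?_, map_smul' := fun r a => ?_ },
    key⟩
  · have ha : a ∈ fil (max (N a) (N b)) := hmono (le_max_left _ _) (hN a)
    have hb : b ∈ fil (max (N a) (N b)) := hmono (le_max_right _ _) (hN b)
    rw [key _ _ ((fil _).add_mem ha hb), key _ _ ha, key _ _ hb, map_add]
  · rw [key _ _ ((fil _).smul_mem r (hN a)), map_smul, RingHom.id_apply]

variable {V : ℕ → Type w} [∀ n, AddCommGroup (V n)]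
  [∀ n, Module R (V n)] {D : Type x} [AddCommGroup D] [Module R D]

/-- One step of the recursion reconstructing a morphism to the cofree cooperad from its linear
restriction `f`: `G ↦ ε · | + ∑ graft f(c') (G c'')`. -/
def extendStep (S : CooperadData R C) (T : CooperadData R D)
    (g : ∀ n, V n →ₗ[R] MultilinearMap R (fun _ : Fin n => D) D) (f : C →ₗ[R] ⨁ n, V n)
    (G : C →ₗ[R] D) : C →ₗ[R] D :=
  LinearMap.toSpanSingleton R D T.coaug ∘ₗ S.counit
    + TensorProduct.lift (plantWith g) ∘ₗ
      TensorProduct.map f (tensorMap G).toLinearMap ∘ₗ S.decomp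

theorem extendStep_apply (S : CooperadData R C) (T : CooperadData R D)
    (g : ∀ n, V n →ₗ[R] MultilinearMap R (fun _ : Fin n => D) D) (f : C →ₗ[R] ⨁ n, V n)
    (G : C →ₗ[R] D) (c : C) : extendStep S T g f G c = S.counit c • T.coaug
      + TensorProduct.lift (plantWith g)
        (TensorProduct.map f (tensorMap G).toLinearMap (S.decomp c)) := rfl

theorem monomial_map_congr {Y : Type*} [AddCommGroup Y] [Module R Y] {G G' : C →ₗ[R] Y}
    {l : List C} (h : ∀ d ∈ l, G d = G' d) :
    tensorMap G (monomial R l) = tensorMap G' (monomial R l) := by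
  rw [tensorMap_monomial, tensorMap_monomial, List.map_congr_left h]

/-- `extendStep` at the level `n + 1` of the filtration depends only on the level `n`. -/
theorem extendStep_congr {S : CooperadData R C} {fil : ℕ → Submodule R C}
    (hS : IsConilpotentCooperad S fil) (T : CooperadData R D)
    (g : ∀ n, V n →ₗ[R] MultilinearMap R (fun _ : Fin n => D) D) {f : C →ₗ[R] ⨁ n, V n}
    (hf : f S.coaug = 0) {G G' : C →ₗ[R] D} {n : ℕ} (h : ∀ c ∈ fil n, G c = G' c) {c : C}
    (hc : c ∈ fil (n + 1)) : extendStep S T g f G c = extendStep S T g f G' c := by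
  have h₁ : ∀ z ∈ Submodule.span R {z | ∃ (c' : C) (l : List C), (∀ d ∈ l, d ∈ fil n) ∧
      z = c' ⊗ₜ[R] monomial R l},
      TensorProduct.map f (tensorMap G).toLinearMap z
        = TensorProduct.map f (tensorMap G').toLinearMap z := by
    intro z hz
    refine LinearMap.eqOn_span ?_ hz
    rintro _ ⟨c', l, hl, rfl⟩
    rw [TensorProduct.map_tmul, TensorProduct.map_tmul, AlgHom.toLinearMap_apply,
      AlgHom.toLinearMap_apply, monomial_map_congr fun d hd => h d (hl d hd)]
  have h₂ := h₁ _ (hS.decomp_fil n c hc)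
  rw [map_sub, map_sub, TensorProduct.map_tmul, TensorProduct.map_tmul, hf,
    TensorProduct.zero_tmul, TensorProduct.zero_tmul, sub_zero, sub_zero] at h₂
  rw [extendStep_apply, extendStep_apply, h₂]

namespace IsTreeModel

variable {S : CooperadData R C} {fil : ℕ → Submodule R C} {T : CooperadData R D}
  {g : ∀ n, V n →ₗ[R] MultilinearMap R (fun _ : Fin n => D) D} {π : D →ₗ[R] ⨁ n, V n}

/-- A decorated tree is the sum of its trivial part and of its branches planted on its root
vertex. -/
theorem eq_plant (hT : IsTreeModel T g π)
    (hl : ∀ c, TensorProduct.lid R _ (LinearMap.rTensor _ T.counit (T.decomp c))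
      = TensorAlgebra.ι R c) (t : D) :
    t = T.counit t • T.coaug
      + TensorProduct.lift (plantWith g) (LinearMap.rTensor _ π (T.decomp t)) := by
  have h : LinearMap.id = LinearMap.toSpanSingleton R D T.coaug ∘ₗ T.counit
      + TensorProduct.lift (plantWith g) ∘ₗ LinearMap.rTensor _ π ∘ₗ T.decomp := by
    refine hT.linearMap_ext ?_ fun n y t _ => ?_
    · simp [hT.counit_coaug, hT.decomp_coaug, hT.proj_coaug]
    · -- The algebra homomorphism `E` applies the counit to the left factors, so that the left
      -- counit law of the branches recovers them from their decompositions.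
      let E : TensorAlgebra R D ⊗[R] TensorAlgebra R D →ₐ[R] TensorAlgebra R D :=
        (Algebra.TensorProduct.lid R (TensorAlgebra R D)).toAlgHom.comp
          (Algebra.TensorProduct.map (TensorAlgebra.lift R T.counit) (AlgHom.id R _))
      have hE : ∀ z : D ⊗[R] TensorAlgebra R D,
          E (LinearMap.rTensor _ (TensorAlgebra.ι R) z)
            = TensorProduct.lid R _ (LinearMap.rTensor _ T.counit z) := by
        intro z
        induction z using TensorProduct.induction_on with
        | zero => simp only [map_zero]
        | tmul a b => simp [E]
        | add a b ha hb => simp only [map_add, ha, hb]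
      have h₁ := map_prod_eq_of_length (R := R) (n := n) (f := LinearMap.rTensor _ π ∘ₗ
          LinearMap.rTensor _ (plantWith g (DirectSum.lof R ℕ V n y)))
        (g := TensorProduct.mk R _ _ (DirectSum.lof R ℕ V n y) ∘ₗ E.toLinearMap) (by
          intro l hl q
          subst hl
          have := hT.proj_plant_ofFn (DirectSum.lof R ℕ V l.length y) l.get
          rw [List.ofFn_get, DirectSum.lof_apply] at this
          rw [LinearMap.comp_apply, LinearMap.comp_apply, LinearMap.rTensor_tmul,
            LinearMap.rTensor_tmul, this, TensorProduct.smul_tmul]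
          simp [E]) (fun i => T.decomp (t i))
      rw [LinearMap.comp_apply, LinearMap.comp_apply, AlgHom.toLinearMap_apply, map_list_prod E,
        List.map_ofFn] at h₁
      have h₂ : (⇑E ∘ fun i => LinearMap.rTensor _ (TensorAlgebra.ι R) (T.decomp (t i)))
          = fun i => TensorAlgebra.ι R (t i) := by
        funext i
        rw [Function.comp_apply, hE, hl]
      have h₃ : (List.ofFn fun i => TensorAlgebra.ι R (t i)).prod = monomial R (List.ofFn t) := by
        rw [monomial, List.map_ofFn]
        rfl
      rw [h₂, h₃] at h₁
      rw [LinearMap.add_apply, LinearMap.comp_apply, LinearMap.comp_apply, LinearMap.comp_apply,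
        hT.counit_graft, map_zero, zero_add, hT.decomp_graft, lift_gather, map_add,
        LinearMap.rTensor_tmul, hT.proj_coaug, TensorProduct.zero_tmul, zero_add, h₁,
        TensorProduct.mk_apply, TensorProduct.lift.tmul, plantWith_ofFn, DirectSum.lof_apply,
        LinearMap.id_apply]
  exact LinearMap.congr_fun h t

/-- A morphism satisfies the recursion given by its linear restriction: a decorated tree is
reconstructed from its root vertex and the branches above it. -/
theorem hom_apply (hT : IsTreeModel T g π)
    (hl : ∀ c, TensorProduct.lid R _ (LinearMap.rTensor _ T.counit (T.decomp c))
      = TensorAlgebra.ι R c) {F : C →ₗ[R] D} (hF : IsCooperadHom S T F) :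
    F = extendStep S T g (π ∘ₗ F) F := by
  refine LinearMap.ext fun c => ?_
  conv_lhs => rw [hT.eq_plant hl (F c), hF.map_counit, hF.map_decomp]
  rw [extendStep_apply, ← LinearMap.comp_apply (LinearMap.rTensor _ π), LinearMap.rTensor_comp_map]

/-- A morphism to the cofree cooperad is determined by its linear restriction. -/
theorem hom_ext (hT : IsTreeModel T g π)
    (hl : ∀ c, TensorProduct.lid R _ (LinearMap.rTensor _ T.counit (T.decomp c))
      = TensorAlgebra.ι R c) (hS : IsConilpotentCooperad S fil) {F F' : C →ₗ[R] D}
    (hF : IsCooperadHom S T F) (hF' : IsCooperadHom S T F') (h : π ∘ₗ F = π ∘ₗ F') : F = F' := by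
  have h₀ : (π ∘ₗ F) S.coaug = 0 := by rw [LinearMap.comp_apply, hF.map_coaug, hT.proj_coaug]
  have key : ∀ n, ∀ c ∈ fil n, F c = F' c := by
    intro n
    induction n with
    | zero =>
      intro c hc
      rw [hS.fil_zero, Submodule.mem_bot] at hc
      rw [hc, map_zero, map_zero]
    | succ n ih =>
      intro c hc
      rw [hT.hom_apply hl hF, hT.hom_apply hl hF', ← h]
      exact extendStep_congr hS T g h₀ ih hc
  refine LinearMap.ext fun c => ?_
  obtain ⟨n, hn⟩ := hS.exists_mem_fil c
  exact key n c hn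

/-- The recursion which reconstructs a morphism from its linear restriction has a solution. -/
theorem exists_eq_extendStep (hS : IsConilpotentCooperad S fil) (T : CooperadData R D)
    (g : ∀ n, V n →ₗ[R] MultilinearMap R (fun _ : Fin n => D) D) {f : C →ₗ[R] ⨁ n, V n}
    (hf : f S.coaug = 0) : ∃ F : C →ₗ[R] D, F = extendStep S T g f F ∧
      ∀ c, ∃ n, F c = (extendStep S T g f)^[n] 0 c := by
  have hG : ∀ n m, n ≤ m → ∀ c ∈ fil n,
      (extendStep S T g f)^[m] 0 c = (extendStep S T g f)^[n] 0 c := by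
    intro n
    induction n with
    | zero =>
      intro m _ c hc
      rw [hS.fil_zero, Submodule.mem_bot] at hc
      rw [hc, map_zero, map_zero]
    | succ n ih =>
      intro m hm c hc
      obtain ⟨m, rfl⟩ := Nat.exists_eq_add_of_le' hm
      rw [← add_assoc, Function.iterate_succ_apply', Function.iterate_succ_apply']
      exact extendStep_congr hS T g hf (fun c hc => ih _ (Nat.le_add_left _ _) c hc) hc
  obtain ⟨F, hF⟩ := exists_linearMap_of_eventually_eq (fun n => (extendStep S T g f)^[n] 0) fil
    hS.fil_mono hS.exists_mem_fil hG
  refine ⟨F, LinearMap.ext fun c => ?_, fun c => (hS.exists_mem_fil c).imp fun n hn => hF n c hn⟩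
  obtain ⟨n, hn⟩ := hS.exists_mem_fil c
  have hn' := hS.fil_mono (Nat.le_succ n) hn
  rw [hF _ c hn', Function.iterate_succ_apply']
  exact (extendStep_congr hS T g hf (hF n) hn').symm

theorem coaug_of_eq_extendStep (hS : IsConilpotentCooperad S fil) {f : C →ₗ[R] ⨁ n, V n}
    (hf : f S.coaug = 0) {F : C →ₗ[R] D} (hF : F = extendStep S T g f F) :
    F S.coaug = T.coaug := by
  rw [hF, extendStep_apply, hS.counit_coaug, hS.decomp_coaug, TensorProduct.map_tmul, hf,
    TensorProduct.zero_tmul, map_zero, add_zero, one_smul]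

theorem counit_of_eq_extendStep (hT : IsTreeModel T g π) {f : C →ₗ[R] ⨁ n, V n} {F : C →ₗ[R] D}
    (hF : F = extendStep S T g f F) (c : C) : T.counit (F c) = S.counit c := by
  have h : T.counit ∘ₗ TensorProduct.lift (plantWith g) = 0 :=
    TensorProduct.ext' fun y q => by
      rw [LinearMap.comp_apply, TensorProduct.lift.tmul, hT.counit_plant, LinearMap.zero_apply]
  conv_lhs => rw [hF, extendStep_apply, map_add, map_smul, hT.counit_coaug, smul_eq_mul, mul_one,
    ← LinearMap.comp_apply T.counit, h, LinearMap.zero_apply, add_zero]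

/-- The solution of the recursion has the prescribed linear restriction. -/
theorem proj_of_eq_extendStep (hT : IsTreeModel T g π) (hS : IsConilpotentCooperad S fil)
    {f : C →ₗ[R] ⨁ n, V n} (hfa : ∀ n, ∀ c ∈ S.arity n, ∃ y, f c = DirectSum.lof R ℕ V n y)
    {F : C →ₗ[R] D} (hF : F = extendStep S T g f F) (c : C) : π (F c) = f c := by
  have h₁ : ∀ n, ∀ z ∈ Submodule.span R (S.composites n),
      (π ∘ₗ TensorProduct.lift (plantWith g) ∘ₗ
        TensorProduct.map f (tensorMap F).toLinearMap) z
      = (f ∘ₗ (TensorProduct.rid R C).toLinearMap ∘ₗ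
          LinearMap.lTensor _ (TensorAlgebra.lift R S.counit).toLinearMap) z := by
    intro n z hz
    refine LinearMap.eqOn_span ?_ hz
    rintro _ ⟨k, c, p, d, hc, hd, -, rfl⟩
    obtain ⟨y, hy⟩ := hfa k c hc
    have hε : TensorAlgebra.lift R T.counit (monomial R (List.ofFn fun i => F (d i)))
        = TensorAlgebra.lift R S.counit (monomial R (List.ofFn d)) := by
      rw [lift_monomial, lift_monomial, List.map_ofFn, List.map_ofFn]
      congr 2
      funext i
      exact hT.counit_of_eq_extendStep hF (d i)
    simp only [LinearMap.comp_apply, TensorProduct.map_tmul, TensorProduct.lift.tmul,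
      AlgHom.toLinearMap_apply, tensorMap_ofFn, hy, hT.proj_plant_ofFn, hε, DirectSum.lof_apply,
      LinearMap.lTensor_tmul, LinearEquiv.coe_coe, TensorProduct.rid_tmul, map_smul]
  have h₂ : ⨆ n, S.arity n ≤ LinearMap.eqLocus (π ∘ₗ F) f := by
    refine iSup_le fun n c hc => ?_
    have h₃ := h₁ n _ (hS.decomp_arity n c hc)
    simp only [LinearMap.comp_apply, LinearEquiv.coe_coe, hS.counit_right] at h₃
    rw [LinearMap.mem_eqLocus, LinearMap.comp_apply, hF, extendStep_apply, map_add, map_smul,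
      hT.proj_coaug, smul_zero, zero_add]
    exact h₃
  rw [hS.iSup_arity] at h₂
  exact h₂ (Submodule.mem_top (x := c))

theorem graft_mem_arity (hT : IsTreeModel T g π) {k : ℕ} (y : V k) (p : Fin k → ℕ) (t : Fin k → D)
    (ht : ∀ i, t i ∈ T.arity (p i)) : g k y t ∈ T.arity (∑ i, p i) := by
  simp only [hT.arity_eq] at ht ⊢
  refine multilinear_mem_of_mem_span (g k y) _ _ (fun s hs => ?_) t ht
  choose q hq using hs
  exact Submodule.subset_span ⟨_, .graft k y p q s hq⟩

theorem coaug_mem_arity (hT : IsTreeModel T g π) : T.coaug ∈ T.arity 1 := by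
  rw [hT.arity_eq]
  exact Submodule.subset_span ⟨0, .trivial⟩

theorem iterate_extendStep_mem_arity (hT : IsTreeModel T g π) (hS : IsConilpotentCooperad S fil)
    {f : C →ₗ[R] ⨁ n, V n} (hfa : ∀ n, ∀ c ∈ S.arity n, ∃ y, f c = DirectSum.lof R ℕ V n y)
    (m n : ℕ) (c : C) (hc : c ∈ S.arity n) : (extendStep S T g f)^[m] 0 c ∈ T.arity n := by
  induction m generalizing n c with
  | zero => exact (T.arity n).zero_mem
  | succ m ih =>
    rw [Function.iterate_succ_apply', extendStep_apply]
    refine (T.arity n).add_mem ?_ ?_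
    · by_cases h : n = 1
      · subst h
        exact (T.arity 1).smul_mem _ hT.coaug_mem_arity
      · rw [hS.counit_arity n h c hc, zero_smul]
        exact (T.arity n).zero_mem
    · have h : Submodule.span R (S.composites n) ≤ (T.arity n).comap
          (TensorProduct.lift (plantWith g) ∘ₗ
            TensorProduct.map f (tensorMap ((extendStep S T g f)^[m] 0)).toLinearMap) := by
        rw [Submodule.span_le]
        rintro _ ⟨k, c, p, d, hc', hd, rfl, rfl⟩
        obtain ⟨y, hy⟩ := hfa k c hc'
        rw [SetLike.mem_coe, Submodule.mem_comap, LinearMap.comp_apply, TensorProduct.map_tmul, hy,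
          AlgHom.toLinearMap_apply, tensorMap_ofFn, TensorProduct.lift.tmul, plantWith_ofFn,
          DirectSum.lof_apply]
        exact hT.graft_mem_arity y p _ fun i => ih _ _ (hd i)
      exact h (hS.decomp_arity n c hc)

/-- A cut of a planted tree is either below the root vertex, or consists of cuts of all the
branches. -/
theorem decomp_lift_plant (hT : IsTreeModel T g π) (z : (⨁ n, V n) ⊗[R] TensorAlgebra R D) :
    T.decomp (TensorProduct.lift (plantWith g) z)
      = T.coaug ⊗ₜ TensorAlgebra.ι R (TensorProduct.lift (plantWith g) z)
        + LinearMap.rTensor _ (TensorProduct.lift (plantWith g))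
          ((TensorProduct.assoc R _ _ _).symm (LinearMap.lTensor _ T.upper.toLinearMap z)) := by
  induction z using TensorProduct.induction_on with
  | zero => simp only [map_zero, TensorProduct.tmul_zero, add_zero]
  | tmul y q =>
    have h : ∀ u : TensorAlgebra R D ⊗[R] TensorAlgebra R D, LinearMap.rTensor _ (plantWith g y) u
        = LinearMap.rTensor _ (TensorProduct.lift (plantWith g))
          ((TensorProduct.assoc R _ _ _).symm (y ⊗ₜ u)) := by
      intro u
      induction u using TensorProduct.induction_on with
      | zero => simp only [map_zero, TensorProduct.tmul_zero]
      | tmul a b => simp only [LinearMap.rTensor_tmul, TensorProduct.assoc_symm_tmul,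
          TensorProduct.lift.tmul]
      | add a b ha hb => simp only [map_add, TensorProduct.tmul_add, ha, hb]
    rw [TensorProduct.lift.tmul, hT.decomp_plant, h, LinearMap.lTensor_tmul]
    rfl
  | add a b ha hb => rw [map_add, map_add, ha, hb, map_add, map_add, map_add, map_add,
      TensorProduct.tmul_add]; abel

/-- The solution of the recursion is compatible with the decompositions, by coassociativity. -/
theorem decomp_of_eq_extendStep (hT : IsTreeModel T g π) (hS : IsConilpotentCooperad S fil)
    {f : C →ₗ[R] ⨁ n, V n} (hf : f S.coaug = 0)
    {F : C →ₗ[R] D} (hF : F = extendStep S T g f F) (c : C) :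
    T.decomp (F c) = TensorProduct.map F (tensorMap F).toLinearMap (S.decomp c) := by
  -- The recursion for `F` in the lower factor expresses the right hand side by the iterated
  -- decomposition, which coassociativity compares with the recursion on the left hand side.
  have hright : ∀ z : C ⊗[R] TensorAlgebra R C, TensorProduct.map F (tensorMap F).toLinearMap z
      = T.coaug ⊗ₜ tensorMap F (TensorProduct.lid R _ (LinearMap.rTensor _ S.counit z))
        + LinearMap.rTensor _ (TensorProduct.lift (plantWith g))
          ((TensorProduct.assoc R _ _ _).symm (TensorProduct.map f
            (TensorProduct.map (tensorMap F).toLinearMap (tensorMap F).toLinearMap)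
            (TensorProduct.assoc R _ _ _ (LinearMap.rTensor _ S.decomp z)))) := by
    intro z
    induction z using TensorProduct.induction_on with
    | zero => simp only [map_zero, TensorProduct.tmul_zero, add_zero]
    | tmul a b =>
      have h : ∀ u : C ⊗[R] TensorAlgebra R C,
          (TensorProduct.assoc R _ _ _).symm (TensorProduct.map f
            (TensorProduct.map (tensorMap F).toLinearMap (tensorMap F).toLinearMap)
            (TensorProduct.assoc R _ _ _ (u ⊗ₜ b)))
          = TensorProduct.map f (tensorMap F).toLinearMap u ⊗ₜ tensorMap F b := by
        intro u
        induction u using TensorProduct.induction_on with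
        | zero => simp only [map_zero, TensorProduct.zero_tmul]
        | tmul c d => simp only [TensorProduct.assoc_tmul, TensorProduct.map_tmul,
            TensorProduct.assoc_symm_tmul, AlgHom.toLinearMap_apply]
        | add c d hc hd => simp only [map_add, TensorProduct.add_tmul, hc, hd]
      rw [LinearMap.rTensor_tmul, LinearMap.rTensor_tmul, h, LinearMap.rTensor_tmul,
        TensorProduct.lid_tmul, map_smul, ← TensorProduct.smul_tmul, ← TensorProduct.add_tmul,
        ← extendStep_apply, ← hF, TensorProduct.map_tmul, AlgHom.toLinearMap_apply]
    | add a b ha hb =>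
      rw [map_add, ha, hb]
      simp only [map_add, TensorProduct.tmul_add]
      abel
  have hG : ∀ n, ∀ c ∈ fil n,
      T.decomp (F c) = TensorProduct.map F (tensorMap F).toLinearMap (S.decomp c) := by
    intro n
    induction n with
    | zero =>
      intro c hc
      rw [hS.fil_zero, Submodule.mem_bot] at hc
      rw [hc, map_zero, map_zero, map_zero, map_zero]
    | succ n ih =>
      intro c hc
      -- By induction `F` is compatible with the decompositions of the upper factors.
      have hup : ∀ l : List C, (∀ d ∈ l, d ∈ fil n) → T.upper (tensorMap F (monomial R l))
          = TensorProduct.map (tensorMap F).toLinearMap (tensorMap F).toLinearMap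
            (S.upper (monomial R l)) := by
        intro l hl
        change T.upper (tensorMap F (monomial R l))
          = Algebra.TensorProduct.map (tensorMap F) (tensorMap F) (S.upper (monomial R l))
        induction l with
        | nil => simp only [monomial_nil, map_one]
        | cons d l ihl =>
          have hι : ∀ z : C ⊗[R] TensorAlgebra R C, LinearMap.rTensor _ (TensorAlgebra.ι R)
              (TensorProduct.map F (tensorMap F).toLinearMap z)
              = Algebra.TensorProduct.map (tensorMap F) (tensorMap F)
                (LinearMap.rTensor _ (TensorAlgebra.ι R) z) := by
            intro z
            induction z using TensorProduct.induction_on with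
            | zero => simp only [map_zero]
            | tmul a b => simp
            | add a b ha hb => simp only [map_add, ha, hb]
          rw [monomial_cons, map_mul, map_mul, map_mul, map_mul,
            ihl fun d hd => hl d (List.mem_cons_of_mem _ hd)]
          congr 1
          rw [TensorAlgebra.lift_ι_apply, LinearMap.comp_apply, CooperadData.upper,
            CooperadData.upper, TensorAlgebra.lift_ι_apply, TensorAlgebra.lift_ι_apply,
            LinearMap.comp_apply, LinearMap.comp_apply, ih d (hl d List.mem_cons_self), hι]
      have h₁ : ∀ z ∈ Submodule.span R {z | ∃ (c' : C) (l : List C), (∀ d ∈ l, d ∈ fil n) ∧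
          z = c' ⊗ₜ[R] monomial R l},
          LinearMap.lTensor _ T.upper.toLinearMap
            (TensorProduct.map f (tensorMap F).toLinearMap z)
          = TensorProduct.map f (TensorProduct.map (tensorMap F).toLinearMap
              (tensorMap F).toLinearMap) (LinearMap.lTensor _ S.upper.toLinearMap z) := by
        intro z hz
        induction hz using Submodule.span_induction with
        | mem z hz =>
          obtain ⟨c', l, hl, rfl⟩ := hz
          rw [TensorProduct.map_tmul, LinearMap.lTensor_tmul, LinearMap.lTensor_tmul,
            TensorProduct.map_tmul, AlgHom.toLinearMap_apply, AlgHom.toLinearMap_apply,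
            AlgHom.toLinearMap_apply, hup l hl]
        | zero => simp only [map_zero]
        | add a b _ _ ha hb => simp only [map_add, ha, hb]
        | smul r a _ ha => simp only [map_smul, ha]
      have h₂ := h₁ _ (hS.decomp_fil n c hc)
      simp only [map_sub, TensorProduct.map_tmul, LinearMap.lTensor_tmul, hf,
        TensorProduct.zero_tmul, sub_zero] at h₂
      rw [hright, hS.counit_left, hS.coassoc, ← h₂, TensorAlgebra.lift_ι_apply,
        LinearMap.comp_apply]
      conv_lhs => rw [hF, extendStep_apply, map_add, map_smul, hT.decomp_coaug,
        hT.decomp_lift_plant, ← add_assoc, TensorProduct.smul_tmul', TensorProduct.smul_tmul,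
        ← map_smul, ← TensorProduct.tmul_add, ← map_add, ← extendStep_apply, ← hF]
  obtain ⟨n, hn⟩ := hS.exists_mem_fil c
  exact hG n c hn

/-- The universal property of the cofree cooperad: an arity-preserving linear map which vanishes on
the coaugmentation is the linear restriction of a morphism. -/
theorem exists_hom (hT : IsTreeModel T g π) (hS : IsConilpotentCooperad S fil)
    {f : C →ₗ[R] ⨁ n, V n} (hf : f S.coaug = 0)
    (hfa : ∀ n, ∀ c ∈ S.arity n, ∃ y, f c = DirectSum.lof R ℕ V n y) :
    ∃ F : C →ₗ[R] D, IsCooperadHom S T F ∧ ∀ c, π (F c) = f c := by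
  obtain ⟨F, hF, hF'⟩ := exists_eq_extendStep hS T g hf
  refine ⟨F, ⟨fun n c hc => ?_, hT.decomp_of_eq_extendStep hS hf hF,
    hT.counit_of_eq_extendStep hF, coaug_of_eq_extendStep hS hf hF⟩,
    hT.proj_of_eq_extendStep hS hfa hF⟩
  obtain ⟨m, hm⟩ := hF' c
  rw [hm]
  exact hT.iterate_extendStep_mem_arity hS hfa m n c hc

end IsTreeModel

end Universal

end

section

/-! ### The cofree cooperad is a conilpotent cooperad -/

section CofreeLaws

variable {R : Type u} [CommRing R]

theorem multilinear_tmul_ext {ι : Type*} [Fintype ι] {M M' Y : Type*} [AddCommGroup M]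
    [Module R M] [AddCommGroup M'] [Module R M'] [AddCommGroup Y] [Module R Y]
    {f f' : MultilinearMap R (fun _ : ι => M ⊗[R] M') Y}
    (h : ∀ (c : ι → M) (q : ι → M'), f (fun i => c i ⊗ₜ q i) = f' (fun i => c i ⊗ₜ q i)) :
    f = f' := by
  refine MultilinearMap.ext fun z => ?_
  have := multilinear_mem_of_mem_span (f - f') (fun _ => {t | ∃ c q, c ⊗ₜ[R] q = t}) ⊥
    (fun s hs => ?_) z (fun i => by rw [TensorProduct.span_tmul_eq_top]; trivial)
  · rwa [Submodule.mem_bot, sub_apply, sub_eq_zero] at this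
  · choose c q hs using hs
    obtain rfl : (fun i => c i ⊗ₜ[R] q i) = s := funext hs
    rw [Submodule.mem_bot, sub_apply, sub_eq_zero, h]

variable {V : ℕ → Type w} [∀ n, AddCommGroup (V n)]
  [∀ n, Module R (V n)] {D : Type x} [AddCommGroup D] [Module R D]

/-- The operation `g n y` on the left factors and the product on the right factors. -/
def graftGather (g : ∀ n, V n →ₗ[R] MultilinearMap R (fun _ : Fin n => D) D) (n : ℕ) (y : V n)
    (Q : Type v) [Ring Q] [Algebra R Q] : MultilinearMap R (fun _ : Fin n => D ⊗[R] Q) (D ⊗[R] Q) :=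
  (LinearMap.rTensor _ (PiTensorProduct.lift (g n y))).compMultilinearMap (gather Q n)

theorem graftGather_tmul (g : ∀ n, V n →ₗ[R] MultilinearMap R (fun _ : Fin n => D) D) (n : ℕ)
    (y : V n) (Q : Type v) [Ring Q] [Algebra R Q] (c : Fin n → D) (q : Fin n → Q) :
    graftGather g n y Q (fun i => c i ⊗ₜ q i) = g n y c ⊗ₜ (List.ofFn q).prod := by
  rw [graftGather, LinearMap.compMultilinearMap_apply, gather_tmul, LinearMap.rTensor_tmul,
    PiTensorProduct.lift.tprod]

/-- The composites of a homogeneous lower tree with at least `j` vertices with homogeneous upper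
trees, with `n` leaves and `k` vertices in total. -/
def homogeneousComposites (g : ∀ n, V n →ₗ[R] MultilinearMap R (fun _ : Fin n => D) D) (e : D)
    (j n k : ℕ) : Set (D ⊗[R] TensorAlgebra R D) :=
  {z | ∃ (c : D) (a : ℕ) (ps : List (ℕ × ℕ × D)), IsHomogeneous g e ps.length a c ∧ j ≤ a ∧
    (∀ p ∈ ps, IsHomogeneous g e p.1 p.2.1 p.2.2) ∧ (ps.map fun p => p.1).sum = n ∧
    a + (ps.map fun p => p.2.1).sum = k ∧ z = c ⊗ₜ monomial R (ps.map fun p => p.2.2)}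

theorem graftGather_mem_span {g : ∀ n, V n →ₗ[R] MultilinearMap R (fun _ : Fin n => D) D} {e : D}
    (n : ℕ) (y : V n) (p q : Fin n → ℕ) (z : Fin n → D ⊗[R] TensorAlgebra R D)
    (hz : ∀ i, z i ∈ Submodule.span R (homogeneousComposites g e 0 (p i) (q i))) :
    graftGather g n y (TensorAlgebra R D) z ∈
      Submodule.span R (homogeneousComposites g e 1 (∑ i, p i) (1 + ∑ i, q i)) := by
  refine multilinear_mem_of_mem_span (graftGather g n y _) _ _ (fun s hs => ?_) z hz
  choose c a ps hc _ hps hp hq hs using hs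
  obtain rfl : (fun i => c i ⊗ₜ[R] monomial R ((ps i).map fun p => p.2.2)) = s :=
    funext fun i => (hs i).symm
  refine Submodule.subset_span ⟨g n y c, 1 + ∑ i, a i, (List.ofFn ps).flatten, ?_, le_self_add,
    ?_, ?_, ?_, ?_⟩
  · have : (List.ofFn ps).flatten.length = ∑ i, (ps i).length := by
      rw [List.length_flatten, List.map_ofFn, List.sum_ofFn]
      rfl
    rw [this]
    exact .graft n y _ a c hc
  · intro r hr
    obtain ⟨l, hl, hr⟩ := List.mem_flatten.1 hr
    obtain ⟨i, rfl⟩ := (List.mem_ofFn' _ _).1 hl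
    exact hps i r hr
  · rw [List.map_flatten, List.sum_flatten, List.map_map, List.map_ofFn, List.sum_ofFn]
    exact Finset.sum_congr rfl fun i _ => hp i
  · rw [List.map_flatten, List.sum_flatten, List.map_map, List.map_ofFn, List.sum_ofFn,
      add_assoc, ← Finset.sum_add_distrib]
    exact congrArg _ (Finset.sum_congr rfl fun i _ => hq i)
  · rw [graftGather_tmul, List.map_flatten, monomial_flatten, List.map_map, List.map_ofFn]
    rfl

namespace IsTreeModel

variable {T : CooperadData R D}
  {g : ∀ n, V n →ₗ[R] MultilinearMap R (fun _ : Fin n => D) D} {π : D →ₗ[R] ⨁ n, V n}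

theorem decomp_graft' (hT : IsTreeModel T g π) (n : ℕ) (y : V n) (t : Fin n → D) :
    T.decomp (g n y t) = T.coaug ⊗ₜ TensorAlgebra.ι R (g n y t)
      + graftGather g n y (TensorAlgebra R D) (fun i => T.decomp (t i)) :=
  hT.decomp_graft n y t

/-- In the decomposition of a homogeneous tree the numbers of vertices add up; only the trivial
lower tree has no vertex. -/
theorem decomp_sub_mem_span (hT : IsTreeModel T g π) {n k : ℕ} {t : D}
    (h : IsHomogeneous g T.coaug n k t) : T.decomp t - T.coaug ⊗ₜ TensorAlgebra.ι R t ∈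
      Submodule.span R (homogeneousComposites g T.coaug 1 n k) := by
  induction h with
  | trivial => rw [hT.decomp_coaug, sub_self]; exact Submodule.zero_mem _
  | graft n y p q t ht ih =>
    rw [hT.decomp_graft', add_sub_cancel_left]
    refine graftGather_mem_span n y p q _ fun i => ?_
    rw [← sub_add_cancel (T.decomp (t i)) (T.coaug ⊗ₜ TensorAlgebra.ι R (t i))]
    refine Submodule.add_mem _ (Submodule.span_mono ?_ (ih i)) (Submodule.subset_span ?_)
    · rintro z ⟨c, a, ps, h₁, -, h₂⟩
      exact ⟨c, a, ps, h₁, Nat.zero_le _, h₂⟩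
    · exact ⟨T.coaug, 0, [(p i, q i, t i)], .trivial, le_rfl, by simpa using ht i, by simp,
        by simp, by simp⟩

theorem decomp_mem_span (hT : IsTreeModel T g π) {n k : ℕ} {t : D}
    (h : IsHomogeneous g T.coaug n k t) : T.decomp t ∈
      Submodule.span R (homogeneousComposites g T.coaug 0 n k) := by
  rw [← sub_add_cancel (T.decomp t) (T.coaug ⊗ₜ TensorAlgebra.ι R t)]
  refine Submodule.add_mem _ (Submodule.span_mono ?_ (hT.decomp_sub_mem_span h))
    (Submodule.subset_span ?_)
  · rintro z ⟨c, a, ps, h₁, -, h₂⟩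
    exact ⟨c, a, ps, h₁, Nat.zero_le _, h₂⟩
  · exact ⟨T.coaug, 0, [(n, k, t)], .trivial, le_rfl, by simpa using h, by simp, by simp, by simp⟩

theorem counit_left (hT : IsTreeModel T g π) (t : D) :
    TensorProduct.lid R _ (LinearMap.rTensor _ T.counit (T.decomp t)) = TensorAlgebra.ι R t := by
  have h : (TensorProduct.lid R _).toLinearMap ∘ₗ LinearMap.rTensor _ T.counit ∘ₗ T.decomp
      = TensorAlgebra.ι R := by
    refine hT.linearMap_ext ?_ fun n y t _ => ?_
    · simp [hT.decomp_coaug, hT.counit_coaug]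
    · have h₀ : (LinearMap.rTensor (TensorAlgebra R D) T.counit).compMultilinearMap
          (graftGather g n y (TensorAlgebra R D)) = 0 := multilinear_tmul_ext fun c q => by
        rw [LinearMap.compMultilinearMap_apply, graftGather_tmul, LinearMap.rTensor_tmul,
          hT.counit_graft, TensorProduct.zero_tmul, zero_apply]
      have h₁ := DFunLike.congr_fun h₀ fun i => T.decomp (t i)
      rw [LinearMap.compMultilinearMap_apply, zero_apply] at h₁
      rw [LinearMap.comp_apply, LinearMap.comp_apply, hT.decomp_graft', map_add, h₁,
        LinearMap.rTensor_tmul, hT.counit_coaug]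
      simp
  exact LinearMap.congr_fun h t

theorem counit_right (hT : IsTreeModel T g π) (t : D) : TensorProduct.rid R _
    (LinearMap.lTensor _ (TensorAlgebra.lift R T.counit).toLinearMap (T.decomp t)) = t := by
  set L : D ⊗[R] TensorAlgebra R D →ₗ[R] D := (TensorProduct.rid R D).toLinearMap ∘ₗ
    LinearMap.lTensor _ (TensorAlgebra.lift R T.counit).toLinearMap with hL
  have h : L ∘ₗ T.decomp = LinearMap.id := by
    refine hT.linearMap_ext ?_ fun n y t ht => ?_
    · simp [hL, hT.decomp_coaug, hT.counit_coaug]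
    · have h₀ : L.compMultilinearMap (graftGather g n y (TensorAlgebra R D))
          = (g n y).compLinearMap fun _ => L := multilinear_tmul_ext fun c q => by
        rw [LinearMap.compMultilinearMap_apply, graftGather_tmul,
          MultilinearMap.compLinearMap_apply]
        simp only [hL, LinearMap.comp_apply, LinearMap.lTensor_tmul, LinearEquiv.coe_coe,
          TensorProduct.rid_tmul, AlgHom.toLinearMap_apply, MultilinearMap.map_smul_univ,
          map_list_prod, List.map_ofFn, List.prod_ofFn, Function.comp_apply]
      have h₁ := DFunLike.congr_fun h₀ fun i => T.decomp (t i)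
      rw [LinearMap.compMultilinearMap_apply, MultilinearMap.compLinearMap_apply] at h₁
      simp only [LinearMap.comp_apply, LinearMap.id_apply] at ht
      rw [LinearMap.comp_apply, hT.decomp_graft', map_add, h₁, funext ht]
      simp [hL, hT.counit_graft]
  exact LinearMap.congr_fun h t

theorem coassoc (hT : IsTreeModel T g π) (t : D) :
    TensorProduct.assoc R _ _ _ (LinearMap.rTensor _ T.decomp (T.decomp t))
      = LinearMap.lTensor _ T.upper.toLinearMap (T.decomp t) := by
  obtain ⟨L, hL⟩ : ∃ L : D ⊗[R] TensorAlgebra R D →ₗ[R] D ⊗[R] (TensorAlgebra R D ⊗[R]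
      TensorAlgebra R D), L = (TensorProduct.assoc R _ _ _).toLinearMap ∘ₗ
        LinearMap.rTensor _ T.decomp := ⟨_, rfl⟩
  obtain ⟨L', hL'⟩ : ∃ L' : D ⊗[R] TensorAlgebra R D →ₗ[R] D ⊗[R] (TensorAlgebra R D ⊗[R]
      TensorAlgebra R D), L' = LinearMap.lTensor _ T.upper.toLinearMap := ⟨_, rfl⟩
  have hpure : ∀ n (y : V n) (w : Fin n → D ⊗[R] TensorAlgebra R D)
      (q : Fin n → TensorAlgebra R D),
      TensorProduct.assoc R _ _ _ (graftGather g n y _ w ⊗ₜ (List.ofFn q).prod)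
        = graftGather g n y (TensorAlgebra R D ⊗[R] TensorAlgebra R D)
          fun i => TensorProduct.assoc R _ _ _ (w i ⊗ₜ q i) := by
    intro n y w q
    have h : ((TensorProduct.assoc R _ _ _).toLinearMap ∘ₗ
        (TensorProduct.mk R _ _).flip (List.ofFn q).prod).compMultilinearMap
          (graftGather g n y (TensorAlgebra R D))
        = (graftGather g n y (TensorAlgebra R D ⊗[R] TensorAlgebra R D)).compLinearMap
          fun i => (TensorProduct.assoc R _ _ _).toLinearMap ∘ₗ
            (TensorProduct.mk R _ _).flip (q i) := multilinear_tmul_ext fun c b => by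
      have hprod : ∀ l : List (TensorAlgebra R D × TensorAlgebra R D),
          (l.map fun p => p.1 ⊗ₜ[R] p.2).prod
            = (l.map Prod.fst).prod ⊗ₜ[R] (l.map Prod.snd).prod := by
        intro l
        induction l with
        | nil => simp [Algebra.TensorProduct.one_def]
        | cons p l ih => simp [ih]
      have hprod' := hprod (List.ofFn fun i => (b i, q i))
      simp only [List.map_ofFn, Function.comp_def] at hprod'
      rw [LinearMap.compMultilinearMap_apply, MultilinearMap.compLinearMap_apply,
        graftGather_tmul]
      simp only [LinearMap.comp_apply, LinearMap.flip_apply, TensorProduct.mk_apply,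
        LinearEquiv.coe_coe, TensorProduct.assoc_tmul]
      rw [graftGather_tmul, hprod']
    have h₁ := DFunLike.congr_fun h w
    rwa [LinearMap.compMultilinearMap_apply, MultilinearMap.compLinearMap_apply] at h₁
  have h : L ∘ₗ T.decomp = L' ∘ₗ T.decomp := by
    refine hT.linearMap_ext ?_ fun n y t ht => ?_
    · rw [LinearMap.comp_apply, LinearMap.comp_apply, hT.decomp_coaug, hL, hL',
        LinearMap.comp_apply, LinearMap.rTensor_tmul, LinearMap.lTensor_tmul, hT.decomp_coaug,
        AlgHom.toLinearMap_apply, CooperadData.upper, TensorAlgebra.lift_ι_apply,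
        LinearMap.comp_apply, hT.decomp_coaug, LinearMap.rTensor_tmul, LinearEquiv.coe_coe,
        TensorProduct.assoc_tmul]
    · have h₁ : L.compMultilinearMap (graftGather g n y (TensorAlgebra R D))
          = (TensorProduct.mk R _ _ T.coaug ∘ₗ
              LinearMap.rTensor _ (TensorAlgebra.ι R)).compMultilinearMap
                (graftGather g n y (TensorAlgebra R D))
            + (graftGather g n y (TensorAlgebra R D ⊗[R] TensorAlgebra R D)).compLinearMap
              fun _ => L := multilinear_tmul_ext fun c q => by
        rw [LinearMap.compMultilinearMap_apply, graftGather_tmul, add_apply,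
          LinearMap.compMultilinearMap_apply, graftGather_tmul,
          MultilinearMap.compLinearMap_apply]
        simp only [hL, LinearMap.comp_apply, LinearMap.rTensor_tmul, LinearEquiv.coe_coe]
        rw [hT.decomp_graft', TensorProduct.add_tmul, map_add, hpure, TensorProduct.assoc_tmul,
          TensorProduct.mk_apply]
      have h₂ : L'.compMultilinearMap (graftGather g n y (TensorAlgebra R D))
          = (graftGather g n y (TensorAlgebra R D ⊗[R] TensorAlgebra R D)).compLinearMap
              fun _ => L' := multilinear_tmul_ext fun c q => by
        rw [LinearMap.compMultilinearMap_apply, graftGather_tmul,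
          MultilinearMap.compLinearMap_apply]
        simp only [hL', LinearMap.lTensor_tmul, AlgHom.toLinearMap_apply]
        rw [graftGather_tmul, map_list_prod, List.map_ofFn]
        rfl
      have h₁' := DFunLike.congr_fun h₁ fun i => T.decomp (t i)
      have h₂' := DFunLike.congr_fun h₂ fun i => T.decomp (t i)
      rw [LinearMap.compMultilinearMap_apply, MultilinearMap.compLinearMap_apply] at h₂'
      rw [LinearMap.compMultilinearMap_apply, add_apply,
        LinearMap.compMultilinearMap_apply, MultilinearMap.compLinearMap_apply,
        LinearMap.comp_apply, TensorProduct.mk_apply] at h₁'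
      simp only [LinearMap.comp_apply] at ht
      -- Cutting below the root vertex in one of the two decompositions, or in both.
      have hG : L (T.coaug ⊗ₜ TensorAlgebra.ι R (g n y t))
          + T.coaug ⊗ₜ LinearMap.rTensor _ (TensorAlgebra.ι R)
              (graftGather g n y (TensorAlgebra R D) fun i => T.decomp (t i))
          = L' (T.coaug ⊗ₜ TensorAlgebra.ι R (g n y t)) := by
        rw [hL, hL', LinearMap.comp_apply, LinearMap.rTensor_tmul, LinearMap.lTensor_tmul,
          hT.decomp_coaug, AlgHom.toLinearMap_apply, CooperadData.upper,
          TensorAlgebra.lift_ι_apply, LinearMap.comp_apply, hT.decomp_graft', map_add,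
          LinearMap.rTensor_tmul, TensorProduct.tmul_add, LinearEquiv.coe_coe,
          TensorProduct.assoc_tmul]
      rw [LinearMap.comp_apply, LinearMap.comp_apply, hT.decomp_graft', map_add, map_add, h₁',
        h₂', funext ht, ← add_assoc, hG]
  rw [hL, hL'] at h
  exact LinearMap.congr_fun h t

/-- The trees with fewer than `n` vertices. -/
def _root_.OperadicCumulants.vertexFiltration
    (g : ∀ n, V n →ₗ[R] MultilinearMap R (fun _ : Fin n => D) D) (e : D) (n : ℕ) :
    Submodule R D :=
  Submodule.span R {t | ∃ a k, k < n ∧ IsHomogeneous g e a k t}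

theorem mem_span_homogeneous (hT : IsTreeModel T g π) (t : D) :
    t ∈ Submodule.span R {t | ∃ n k, IsHomogeneous g T.coaug n k t} := by
  refine hT.induction (Submodule.span R {t | ∃ n k, IsHomogeneous g T.coaug n k t})
    (Submodule.subset_span ⟨_, _, .trivial⟩) (fun n y t ht => ?_) t
  refine multilinear_mem_of_mem_span (g n y) _ _ (fun s hs => ?_) t ht
  choose p q hs using hs
  exact Submodule.subset_span ⟨_, _, .graft n y p q s hs⟩

theorem isConilpotentCooperad (hT : IsTreeModel T g π) :
    IsConilpotentCooperad T (vertexFiltration g T.coaug) where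
  decomp_coaug := hT.decomp_coaug
  counit_coaug := hT.counit_coaug
  counit_left := hT.counit_left
  counit_right := hT.counit_right
  coassoc := hT.coassoc
  iSup_arity := by
    rw [eq_top_iff]
    intro t _
    refine Submodule.span_le.2 ?_ (hT.mem_span_homogeneous t)
    rintro t ⟨n, k, h⟩
    refine Submodule.mem_iSup_of_mem n ?_
    rw [hT.arity_eq]
    exact Submodule.subset_span ⟨k, h⟩
  decomp_arity n c hc := by
    rw [hT.arity_eq] at hc
    refine (Submodule.span_le.2 ?_ : _ ≤ (Submodule.span R (T.composites n)).comap T.decomp) hc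
    rintro t ⟨k, h⟩
    refine Submodule.span_mono ?_ (hT.decomp_mem_span h)
    rintro z ⟨c, a, ps, hc, -, hps, hn, -, rfl⟩
    refine ⟨ps.length, c, fun i => (ps.get i).1, fun i => (ps.get i).2.2, ?_, fun i => ?_, ?_, ?_⟩
    · rw [hT.arity_eq]
      exact Submodule.subset_span ⟨a, hc⟩
    · rw [hT.arity_eq]
      exact Submodule.subset_span ⟨_, hps _ (List.get_mem ps i)⟩
    · rw [← List.sum_ofFn, ← hn]
      conv_rhs => rw [← List.ofFn_get ps, List.map_ofFn]
      rfl
    · conv_lhs => rw [← List.ofFn_get ps, List.map_ofFn]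
      rfl
  counit_arity n hn c hc := by
    rw [hT.arity_eq] at hc
    refine (Submodule.span_le.2 ?_ : _ ≤ LinearMap.ker T.counit) hc
    rintro t ⟨k, h⟩
    cases h with
    | trivial => exact absurd rfl hn
    | graft n y p q t _ => exact hT.counit_graft n y t
  fil_zero := by
    rw [vertexFiltration, Submodule.span_eq_bot]
    rintro t ⟨a, k, h, -⟩
    exact absurd h (Nat.not_lt_zero k)
  fil_mono m n h := Submodule.span_mono fun t ⟨a, k, hk, ht⟩ => ⟨a, k, hk.trans_le h, ht⟩
  exists_mem_fil t := by
    have hmono : Monotone (vertexFiltration g T.coaug) :=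
      fun m n h => Submodule.span_mono fun t ⟨a, k, hk, ht⟩ => ⟨a, k, hk.trans_le h, ht⟩
    have : t ∈ ⨆ n, vertexFiltration g T.coaug n := by
      refine Submodule.span_le.2 ?_ (hT.mem_span_homogeneous t)
      rintro t ⟨n, k, h⟩
      exact Submodule.mem_iSup_of_mem (k + 1)
        (Submodule.subset_span ⟨n, k, Nat.lt_succ_self k, h⟩)
    exact (Submodule.mem_iSup_of_directed _ hmono.directed_le).1 this
  decomp_fil n c hc := by
    refine (Submodule.span_le.2 ?_ : _ ≤ (Submodule.span R _).comap
      (T.decomp - TensorProduct.mk R _ _ T.coaug ∘ₗ TensorAlgebra.ι R)) hc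
    rintro t ⟨m, k, hk, h⟩
    refine Submodule.span_mono ?_ (hT.decomp_sub_mem_span h)
    rintro z ⟨c, a, ps, -, ha, hps, -, hk', rfl⟩
    refine ⟨c, ps.map fun p => p.2.2, fun d hd => ?_, rfl⟩
    obtain ⟨p, hp, rfl⟩ := List.mem_map.1 hd
    have := List.single_le_sum (l := ps.map fun p => p.2.1) (by simp) p.2.1
      (List.mem_map.2 ⟨p, hp, rfl⟩)
    exact Submodule.subset_span ⟨p.1, p.2.1, by omega, hps p hp⟩

end IsTreeModel

end CofreeLaws

end

section

/-! ### Unitriangular endomorphisms of the cofree cooperad -/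

section Unitriangular

variable {R : Type u} [CommRing R] {C : Type v} [AddCommGroup C] [Module R C]

theorem IsCooperadHom.comp {C' C'' : Type*} [AddCommGroup C'] [Module R C'] [AddCommGroup C'']
    [Module R C''] {S : CooperadData R C} {S' : CooperadData R C'} {S'' : CooperadData R C''}
    {F' : C' →ₗ[R] C''} {F : C →ₗ[R] C'} (h' : IsCooperadHom S' S'' F')
    (h : IsCooperadHom S S' F) : IsCooperadHom S S'' (F' ∘ₗ F) where
  map_arity n c hc := h'.map_arity n _ (h.map_arity n c hc)
  map_decomp c := by
    have hmap : TensorAlgebra.lift R (TensorAlgebra.ι R ∘ₗ F' ∘ₗ F)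
        = (tensorMap F').comp (tensorMap F) := by
      ext c; simp
    rw [LinearMap.comp_apply, h'.map_decomp, h.map_decomp, hmap, AlgHom.comp_toLinearMap,
      TensorProduct.map_comp, LinearMap.comp_apply]
  map_counit c := by rw [LinearMap.comp_apply, h'.map_counit, h.map_counit]
  map_coaug := by rw [LinearMap.comp_apply, h.map_coaug, h'.map_coaug]

/-- A morphism which differs from the identity by a map lowering an exhaustive filtration is an
isomorphism. -/
theorem IsCooperadHom.exists_inverse {S : CooperadData R C} {F : C →ₗ[R] C}
    (h : IsCooperadHom S S F) (fil : ℕ → Submodule R C) (h₀ : fil 0 = ⊥)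
    (hex : ∀ c, ∃ n, c ∈ fil n) (hF : ∀ n, ∀ c ∈ fil (n + 1), F c - c ∈ fil n) :
    ∃ G : C →ₗ[R] C, IsCooperadHom S S G ∧ G ∘ₗ F = LinearMap.id ∧ F ∘ₗ G = LinearMap.id := by
  have hinj : ∀ n, ∀ c ∈ fil n, F c = 0 → c = 0 := by
    intro n
    induction n with
    | zero => intro c hc _; rwa [h₀, Submodule.mem_bot] at hc
    | succ n ih =>
      intro c hc hFc
      refine ih c ?_ hFc
      have := hF n c hc
      rwa [hFc, zero_sub, Submodule.neg_mem_iff] at this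
  have hsurj : ∀ U : Submodule R C, (∀ c ∈ U, F c ∈ U) → ∀ n, ∀ c ∈ fil n, c ∈ U →
      ∃ d ∈ U, F d = c := by
    intro U hU n
    induction n with
    | zero =>
      intro c hc _
      rw [h₀, Submodule.mem_bot] at hc
      exact ⟨0, U.zero_mem, by rw [hc, map_zero]⟩
    | succ n ih =>
      intro c hc hcU
      have h₁ := hF n c hc
      obtain ⟨d, hd, hFd⟩ := ih _ h₁ (U.sub_mem (hU c hcU) hcU)
      exact ⟨c - d, U.sub_mem hcU hd, by rw [map_sub, hFd, sub_sub_cancel]⟩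
  have hbij : Function.Bijective F := by
    refine ⟨(injective_iff_map_eq_zero F).2 fun c hc => ?_, fun c => ?_⟩
    · obtain ⟨n, hn⟩ := hex c
      exact hinj n c hn hc
    · obtain ⟨n, hn⟩ := hex c
      obtain ⟨d, -, hd⟩ := hsurj ⊤ (fun _ _ => trivial) n c hn trivial
      exact ⟨d, hd⟩
  let e := LinearEquiv.ofBijective F hbij
  have hGF : e.symm.toLinearMap ∘ₗ F = LinearMap.id :=
    LinearMap.ext fun c => e.symm_apply_apply c
  have hFG : F ∘ₗ e.symm.toLinearMap = LinearMap.id :=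
    LinearMap.ext fun c => e.apply_symm_apply c
  refine ⟨e.symm.toLinearMap, ⟨fun n c hc => ?_, fun c => ?_, fun c => ?_, ?_⟩, hGF, hFG⟩
  · obtain ⟨m, hm⟩ := hex c
    obtain ⟨d, hd, rfl⟩ := hsurj _ (h.map_arity n) m c hm hc
    have := LinearMap.congr_fun hGF d
    rw [LinearMap.comp_apply, LinearMap.id_apply] at this
    rwa [this]
  · obtain ⟨d, rfl⟩ := hbij.2 c
    have hmap : (tensorMap e.symm.toLinearMap).comp (tensorMap F) = AlgHom.id R _ := by
      ext c
      have := LinearMap.congr_fun hGF c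
      rw [LinearMap.comp_apply, LinearMap.id_apply] at this
      simp only [AlgHom.comp_toLinearMap, LinearMap.comp_apply, AlgHom.toLinearMap_apply,
        TensorAlgebra.lift_ι_apply, this, AlgHom.toLinearMap_id, LinearMap.id_apply]
    have := LinearMap.congr_fun hGF d
    rw [LinearMap.comp_apply, LinearMap.id_apply] at this
    rw [this, h.map_decomp, ← LinearMap.comp_apply, ← TensorProduct.map_comp,
      ← AlgHom.comp_toLinearMap, hmap, hGF, AlgHom.toLinearMap_id, TensorProduct.map_id,
      LinearMap.id_apply]
  · have := LinearMap.congr_fun hFG c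
    rw [LinearMap.comp_apply, LinearMap.id_apply] at this
    rw [← h.map_counit, this]
  · conv_lhs => rw [← h.map_coaug]
    exact e.symm_apply_apply _

variable {V : ℕ → Type w} [∀ n, AddCommGroup (V n)]
  [∀ n, Module R (V n)] {D : Type x} [AddCommGroup D] [Module R D]

theorem graft_mem_vertexFiltration {g : ∀ n, V n →ₗ[R] MultilinearMap R (fun _ : Fin n => D) D}
    {e : D} {m : ℕ} (y : V m) (r : Fin m → ℕ) (N : ℕ)
    (hN : ∀ k : Fin m → ℕ, (∀ i, k i < r i) → 1 + ∑ i, k i < N) (t : Fin m → D)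
    (ht : ∀ i, t i ∈ vertexFiltration g e (r i)) : g m y t ∈ vertexFiltration g e N := by
  refine multilinear_mem_of_mem_span (g m y) _ _ (fun s hs => ?_) t ht
  choose a k hk hs using hs
  exact Submodule.subset_span ⟨_, _, hN k hk, .graft m y a k s hs⟩

theorem IsHomogeneous.eq_of_zero {g : ∀ n, V n →ₗ[R] MultilinearMap R (fun _ : Fin n => D) D}
    {e : D} {n : ℕ} {t : D} (h : IsHomogeneous g e n 0 t) : t = e := by
  generalize hk : 0 = k at h
  cases h with
  | trivial => rfl
  | graft n y p q t _ => omega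

/-- Replacing the branches `d i`, with at most `q i` vertices, by `d' i` with `d' i - d i` of
fewer vertices changes a planted tree by trees with fewer vertices. -/
theorem graft_sub_mem_vertexFiltration
    {g : ∀ n, V n →ₗ[R] MultilinearMap R (fun _ : Fin n => D) D} {e : D} {m : ℕ} (y : V m)
    (q : Fin m → ℕ) (d d' : Fin m → D) (hd : ∀ i, d i ∈ vertexFiltration g e (q i + 1))
    (hd' : ∀ i, d' i ∈ vertexFiltration g e (q i + 1))
    (h : ∀ i, d' i - d i ∈ vertexFiltration g e (q i)) :
    g m y d' - g m y d ∈ vertexFiltration g e (1 + ∑ i, q i) := by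
  -- The branches are replaced one at a time.
  have key : ∀ J : Finset (Fin m),
      g m y (J.piecewise d' d) - g m y d ∈ vertexFiltration g e (1 + ∑ i, q i) := by
    intro J
    induction J using Finset.induction with
    | empty => rw [Finset.piecewise_empty, sub_self]; exact Submodule.zero_mem _
    | insert j J hj ih =>
      rw [Finset.piecewise_insert]
      have h₁ : d' j = d j + (d' j - d j) := by abel
      have h₂ : Function.update (J.piecewise d' d) j (d j) = J.piecewise d' d := by
        conv_rhs => rw [← Function.update_eq_self j (J.piecewise d' d)]
        rw [Finset.piecewise_eq_of_notMem _ _ _ hj]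
      rw [h₁, MultilinearMap.map_update_add, h₂, add_sub_right_comm]
      refine Submodule.add_mem _ ih ?_
      refine graft_mem_vertexFiltration y (Function.update (fun i => q i + 1) j (q j)) _
        (fun k hk => ?_) _ fun i => ?_
      · rw [Nat.add_lt_add_iff_left]
        refine Finset.sum_lt_sum (fun i _ => ?_) ⟨j, Finset.mem_univ j, ?_⟩
        · have := hk i
          by_cases hij : i = j
          · subst hij; rw [Function.update_self] at this; exact this.le
          · rw [Function.update_of_ne hij] at this; omega
        · simpa using hk j
      · by_cases hij : i = j
        · subst hij; simpa using h i
        · rw [Function.update_of_ne hij, Function.update_of_ne hij]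
          by_cases hi : i ∈ J
          · rw [Finset.piecewise_eq_of_mem _ _ _ hi]; exact hd' i
          · rw [Finset.piecewise_eq_of_notMem _ _ _ hi]; exact hd i
  simpa using key Finset.univ

namespace IsTreeModel

variable {T : CooperadData R D}
  {g : ∀ n, V n →ₗ[R] MultilinearMap R (fun _ : Fin n => D) D} {π : D →ₗ[R] ⨁ n, V n}

theorem vertexFiltration_mono : Monotone (vertexFiltration g T.coaug) :=
  fun _ _ h => Submodule.span_mono fun _ ⟨a, k, hk, ht⟩ => ⟨a, k, hk.trans_le h, ht⟩

/-- An endomorphism whose linear restriction is the identity on corollas is unitriangular with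
respect to the number of vertices. -/
theorem hom_sub_mem_vertexFiltration (hT : IsTreeModel T g π) {F : D →ₗ[R] D}
    (hF : IsCooperadHom T T F)
    (hcor : ∀ n (y : V n), π (F (g n y fun _ => T.coaug)) = DirectSum.lof R ℕ V n y) (k : ℕ) :
    ∀ n t, IsHomogeneous g T.coaug n k t → F t - t ∈ vertexFiltration g T.coaug k := by
  induction k using Nat.strong_induction_on with
  | _ k ih =>
    intro n t ht
    have h₁ : F t - t = TensorProduct.lift (plantWith g)
        (TensorProduct.map (π ∘ₗ F) (tensorMap F).toLinearMap (T.decomp t))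
          - TensorProduct.lift (plantWith g) (LinearMap.rTensor _ π (T.decomp t)) := by
      conv_lhs => rw [hT.hom_apply hT.counit_left hF, extendStep_apply]
      nth_rw 3 [hT.eq_plant hT.counit_left t]
      abel
    rw [h₁]
    refine (Submodule.span_le.2 ?_ : _ ≤ (vertexFiltration g T.coaug k).comap
      (TensorProduct.lift (plantWith g) ∘ₗ TensorProduct.map (π ∘ₗ F) (tensorMap F).toLinearMap
        - TensorProduct.lift (plantWith g) ∘ₗ LinearMap.rTensor _ π)) (hT.decomp_mem_span ht)
    rintro _ ⟨c, a, ps, hc, -, hps, -, hk, rfl⟩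
    rw [SetLike.mem_coe, Submodule.mem_comap, LinearMap.sub_apply, LinearMap.comp_apply,
      LinearMap.comp_apply, TensorProduct.map_tmul, LinearMap.rTensor_tmul,
      TensorProduct.lift.tmul, TensorProduct.lift.tmul, AlgHom.toLinearMap_apply]
    obtain ⟨m, p, q, d, hps', hd, hm, hq⟩ : ∃ (m : ℕ) (p q : Fin m → ℕ) (d : Fin m → D),
        (ps.map fun p => p.2.2) = List.ofFn d ∧ (∀ i, IsHomogeneous g T.coaug (p i) (q i) (d i))
        ∧ m = ps.length ∧ (ps.map fun p => p.2.1).sum = ∑ i, q i := by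
      refine ⟨ps.length, fun i => (ps.get i).1, fun i => (ps.get i).2.1,
        fun i => (ps.get i).2.2, ?_, fun i => hps _ (List.get_mem ps i), rfl, ?_⟩
      · conv_lhs => rw [← List.ofFn_get ps, List.map_ofFn]
        rfl
      · conv_lhs => rw [← List.ofFn_get ps, List.map_ofFn, List.sum_ofFn]
        rfl
    rw [hps', tensorMap_ofFn, plantWith_ofFn, plantWith_ofFn]
    rw [← hm] at hc
    have hle : ∀ i, q i ≤ ∑ i, q i := fun i =>
      Finset.single_le_sum (fun _ _ => Nat.zero_le _) (Finset.mem_univ i)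
    have hd₁ : ∀ i, d i ∈ vertexFiltration g T.coaug (q i + 1) := fun i =>
      Submodule.subset_span ⟨_, _, Nat.lt_succ_self _, hd i⟩
    have hd₂ : 1 ≤ a → ∀ i, F (d i) - d i ∈ vertexFiltration g T.coaug (q i) := fun ha i =>
      ih (q i) (by have := hle i; omega) _ _ (hd i)
    have hd₃ : 1 ≤ a → ∀ i, F (d i) ∈ vertexFiltration g T.coaug (q i + 1) := fun ha i => by
      rw [← sub_add_cancel (F (d i)) (d i)]
      exact Submodule.add_mem _ (vertexFiltration_mono (Nat.le_succ _) (hd₂ ha i)) (hd₁ i)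
    have hsum : ∀ k : Fin m → ℕ, (∀ i, k i < q i + 1) → ∑ i, k i ≤ ∑ i, q i := fun k hk =>
      Finset.sum_le_sum fun i _ => Nat.lt_succ_iff.1 (hk i)
    -- The lower tree is trivial and contributes nothing, or a corolla, where `hcor` applies and
    -- only the branches change, or it has a second vertex, so that both terms have fewer vertices.
    rcases a with _ | _ | a
    · obtain rfl := hc.eq_of_zero
      rw [LinearMap.comp_apply, hF.map_coaug, hT.proj_coaug]
      simp only [DirectSum.zero_apply, map_zero, zero_apply, sub_self]
      exact Submodule.zero_mem _
    · have hπ : (π ∘ₗ F) c = π c := by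
        generalize hone : 0 + 1 = one at hc
        cases hc with
        | trivial => omega
        | graft n y p' q' t h =>
          have ht : t = fun _ => T.coaug := funext fun i => by
            have h₀ : q' i = 0 := by
              have := Finset.single_le_sum (f := q') (fun _ _ => Nat.zero_le _)
                (Finset.mem_univ i)
              omega
            have := h i
            rw [h₀] at this
            exact this.eq_of_zero
          rw [ht, LinearMap.comp_apply, hcor, hT.proj_graft, hT.counit_coaug,
            Finset.prod_const_one, one_smul]
      rw [hπ]
      have := graft_sub_mem_vertexFiltration (π c m) q d (fun i => F (d i)) hd₁
        (hd₃ (Nat.le_refl 1)) (hd₂ (Nat.le_refl 1))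
      rwa [← hq, show 1 + (ps.map fun p => p.2.1).sum = k by omega] at this
    · refine Submodule.sub_mem _ ?_ ?_
      · refine graft_mem_vertexFiltration _ (fun i => q i + 1) k (fun k' hk' => ?_) _
          (hd₃ (by omega))
        have := hsum k' hk'
        omega
      · refine graft_mem_vertexFiltration _ (fun i => q i + 1) k (fun k' hk' => ?_) _ hd₁
        have := hsum k' hk'
        omega

/-- A morphism of the cofree cooperad to itself whose linear restriction is the identity on corollas
is an isomorphism, as it is unitriangular for the filtration by the number of vertices. -/
theorem exists_inverse (hT : IsTreeModel T g π) {F : D →ₗ[R] D} (hF : IsCooperadHom T T F)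
    (hcor : ∀ n (y : V n), π (F (g n y fun _ => T.coaug)) = DirectSum.lof R ℕ V n y) :
    ∃ G : D →ₗ[R] D, IsCooperadHom T T G ∧ G ∘ₗ F = LinearMap.id ∧ F ∘ₗ G = LinearMap.id := by
  have hS := hT.isConilpotentCooperad
  refine hF.exists_inverse _ hS.fil_zero hS.exists_mem_fil fun n c hc => ?_
  refine (Submodule.span_le.2 ?_ : _ ≤ (vertexFiltration g T.coaug n).comap
    (F - LinearMap.id)) hc
  rintro t ⟨a, k, hk, ht⟩
  exact vertexFiltration_mono (Nat.lt_succ_iff.1 hk)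
    (hT.hom_sub_mem_vertexFiltration hF hcor k a t ht)

end IsTreeModel

end Unitriangular

end

section

/-! ### The canonical twist -/

section Twist

variable {R : Type u} [CommRing R] {V : ℕ → Type w} [∀ n, AddCommGroup (V n)]
  [∀ n, Module R (V n)] {D : Type x} [AddCommGroup D] [Module R D]
  {T : CooperadData R D} {g : ∀ n, V n →ₗ[R] MultilinearMap R (fun _ : Fin n => D) D}
  {π : D →ₗ[R] ⨁ n, V n} {γ : D →ₗ[R] ⨁ n, V n} {e : V 1}
  {op : ∀ n, V n →ₗ[R] MultilinearMap R (fun _ : Fin n => ⨁ k, V k) (⨁ k, V k)}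

/-! In this section `γ` is a map such as the composition of trees: it sends the trivial tree to the
unit `e` and grafting to the operadic composition `op`. -/

namespace IsTreeModel

/-- The linear restriction of a morphism prescribed on the kernel of the counit is known
everywhere, as the coaugmentation is sent to the trivial tree. -/
theorem proj_hom_of_counit_eq_zero (hT : IsTreeModel T g π) {Φ : D →ₗ[R] D}
    (hΦ : IsCooperadHom T T Φ) (hγ₀ : γ T.coaug = DirectSum.lof R ℕ V 1 e)
    (h : ∀ t, T.counit t = 0 → π (Φ t) = γ t) (t : D) :
    π (Φ t) = γ t - T.counit t • DirectSum.lof R ℕ V 1 e := by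
  have h₁ := h (t - T.counit t • T.coaug) (by
    rw [map_sub, map_smul, hT.counit_coaug, smul_eq_mul, mul_one, sub_self])
  rwa [map_sub, map_sub, map_smul, map_smul, hΦ.map_coaug, hT.proj_coaug, smul_zero, sub_zero,
    map_sub, map_smul, hγ₀] at h₁

/-- The composition of a tree with `n` leaves has arity `n`. -/
theorem mem_range_of_isHomogeneous (hγ₀ : γ T.coaug = DirectSum.lof R ℕ V 1 e)
    (hγ : ∀ n y t, γ (g n y t) = op n y fun i => γ (t i))
    (hop : ∀ n (y : V n) (p : Fin n → ℕ) (z : ∀ i, V (p i)),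
      ∃ z', op n y (fun i => DirectSum.lof R ℕ V (p i) (z i)) = DirectSum.lof R ℕ V (∑ i, p i) z')
    {n k : ℕ} {t : D} (ht : IsHomogeneous g T.coaug n k t) :
    γ t ∈ LinearMap.range (DirectSum.lof R ℕ V n) := by
  induction ht with
  | trivial => exact ⟨e, hγ₀.symm⟩
  | graft n y p q t _ ih =>
    choose z hz using ih
    obtain ⟨z', hz'⟩ := hop n y p z
    refine ⟨z', ?_⟩
    rw [hγ, ← hz']
    exact congrArg (op n y) (funext hz)

/-- The linear restriction of the twist is `γ` corrected on the trivial tree, where a linear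
restriction has to vanish. -/
theorem exists_twist (hT : IsTreeModel T g π) (hγ₀ : γ T.coaug = DirectSum.lof R ℕ V 1 e)
    (hγ : ∀ n y t, γ (g n y t) = op n y fun i => γ (t i))
    (hop : ∀ n (y : V n) (p : Fin n → ℕ) (z : ∀ i, V (p i)),
      ∃ z', op n y (fun i => DirectSum.lof R ℕ V (p i) (z i))
        = DirectSum.lof R ℕ V (∑ i, p i) z') :
    ∃ Φ : D →ₗ[R] D, IsCooperadHom T T Φ ∧ ∀ t, T.counit t = 0 → π (Φ t) = γ t := by
  have hS := hT.isConilpotentCooperad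
  have hf : ∀ n, ∀ c ∈ T.arity n, ∃ y, (γ - LinearMap.toSpanSingleton R _
      (DirectSum.lof R ℕ V 1 e) ∘ₗ T.counit) c = DirectSum.lof R ℕ V n y := by
    intro n c hc
    have h₁ : γ c ∈ LinearMap.range (DirectSum.lof R ℕ V n) := by
      rw [hT.arity_eq] at hc
      refine (Submodule.span_le.2 ?_ : _ ≤ (LinearMap.range (DirectSum.lof R ℕ V n)).comap γ) hc
      rintro t ⟨k, ht⟩
      exact mem_range_of_isHomogeneous hγ₀ hγ hop ht
    have h₂ : T.counit c • DirectSum.lof R ℕ V 1 e ∈ LinearMap.range (DirectSum.lof R ℕ V n) := by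
      by_cases hn : n = 1
      · subst hn
        exact Submodule.smul_mem _ _ ⟨e, rfl⟩
      · rw [hS.counit_arity n hn c hc, zero_smul]
        exact Submodule.zero_mem _
    obtain ⟨y, hy⟩ := Submodule.sub_mem _ h₁ h₂
    exact ⟨y, hy.symm⟩
  obtain ⟨Φ, hΦ, h⟩ := hT.exists_hom hS (by
    rw [LinearMap.sub_apply, LinearMap.comp_apply, hT.counit_coaug, hγ₀,
      LinearMap.toSpanSingleton_apply, one_smul, sub_self]) hf
  refine ⟨Φ, hΦ, fun t ht => ?_⟩
  rw [h, LinearMap.sub_apply, LinearMap.comp_apply, ht, map_zero, sub_zero]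

theorem twist_unique (hT : IsTreeModel T g π) (hγ₀ : γ T.coaug = DirectSum.lof R ℕ V 1 e)
    {Φ Φ' : D →ₗ[R] D} (hΦ : IsCooperadHom T T Φ) (h : ∀ t, T.counit t = 0 → π (Φ t) = γ t)
    (hΦ' : IsCooperadHom T T Φ') (h' : ∀ t, T.counit t = 0 → π (Φ' t) = γ t) : Φ = Φ' := by
  refine hT.hom_ext hT.counit_left hT.isConilpotentCooperad hΦ hΦ' (LinearMap.ext fun t => ?_)
  rw [LinearMap.comp_apply, LinearMap.comp_apply, hT.proj_hom_of_counit_eq_zero hΦ hγ₀ h,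
    hT.proj_hom_of_counit_eq_zero hΦ' hγ₀ h']

/-- The twist is an isomorphism, as the composition of a corolla is its decoration. -/
theorem twist_exists_inverse (hT : IsTreeModel T g π)
    (hγ₀ : γ T.coaug = DirectSum.lof R ℕ V 1 e)
    (hγ : ∀ n y t, γ (g n y t) = op n y fun i => γ (t i))
    (hop : ∀ n (y : V n), op n y (fun _ => DirectSum.lof R ℕ V 1 e) = DirectSum.lof R ℕ V n y)
    {Φ : D →ₗ[R] D} (hΦ : IsCooperadHom T T Φ) (h : ∀ t, T.counit t = 0 → π (Φ t) = γ t) :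
    ∃ G : D →ₗ[R] D, IsCooperadHom T T G ∧ G ∘ₗ Φ = LinearMap.id ∧ Φ ∘ₗ G = LinearMap.id := by
  refine hT.exists_inverse hΦ fun n y => ?_
  rw [h _ (hT.counit_graft n y _), hγ, hγ₀, hop]

end IsTreeModel

end Twist

section EndOperad

variable {R : Type u} [CommRing R] {B : Type v} [AddCommGroup B] [Module R B]

theorem endGraft_lof (n : ℕ) (y : EndB R B n) (p : Fin n → ℕ) (z : ∀ i, EndB R B (p i)) :
    endGraft R B n y (fun i => DirectSum.lof R ℕ (EndB R B) (p i) (z i))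
      = DirectSum.lof R ℕ (EndB R B) (∑ i, p i) (endComp n y p z) := by
  change MultilinearMap.fromDirectSumEquiv _ _ = _
  rw [MultilinearMap.fromDirectSumEquiv_lof]
  rfl

theorem lof_congr {m n : ℕ} (h : m = n) (y : EndB R B m) (z : EndB R B n)
    (hyz : ∀ b : Fin n → B, y (fun i => b (Fin.cast h i)) = z b) :
    DirectSum.lof R ℕ (EndB R B) m y = DirectSum.lof R ℕ (EndB R B) n z := by
  subst h
  exact congrArg _ (MultilinearMap.ext hyz)

theorem endGraft_id (n : ℕ) (y : EndB R B n) :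
    endGraft R B n y (fun _ => DirectSum.lof R ℕ (EndB R B) 1
      (MultilinearMap.ofSubsingleton R B B 0 LinearMap.id)) = DirectSum.lof R ℕ (EndB R B) n y := by
  refine (endGraft_lof n y (fun _ => 1) fun _ => _).trans ?_
  have h : ∑ _ : Fin n, 1 = n := by simp
  refine lof_congr h _ _ fun b => congrArg y (funext fun i => congrArg b (Fin.ext ?_))
  simp [finSigmaFinEquiv_apply]

theorem exists_unique_isCanonicalTwist :
    ∃! Φ : DecTrees R (EndB R B) →ₗ[R] DecTrees R (EndB R B), IsCanonicalTwist R B Φ := by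
  have hT := isTreeModel_cofree (R := R) (V := EndB R B)
  have hγ₀ : treeComposition R B (cofree R (EndB R B)).coaug = _ := fold_trivialTree _ _
  obtain ⟨Φ, hΦ, h⟩ := hT.exists_twist hγ₀ (fun n y t => fold_graft _ _ n y t)
    fun n y p z => ⟨_, endGraft_lof n y p z⟩
  exact ⟨Φ, ⟨hΦ, h⟩, fun Φ' h' => hT.twist_unique hγ₀ h'.isHom h'.restriction hΦ h⟩

theorem IsCanonicalTwist.exists_inverse
    {Φ : DecTrees R (EndB R B) →ₗ[R] DecTrees R (EndB R B)} (h : IsCanonicalTwist R B Φ) :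
    ∃ Φinv : DecTrees R (EndB R B) →ₗ[R] DecTrees R (EndB R B),
      IsCooperadHom (cofree R (EndB R B)) (cofree R (EndB R B)) Φinv ∧
      Φinv ∘ₗ Φ = LinearMap.id ∧ Φ ∘ₗ Φinv = LinearMap.id :=
  (isTreeModel_cofree (R := R) (V := EndB R B)).twist_exists_inverse (fold_trivialTree _ _)
    (fun n y t => fold_graft _ _ n y t) endGraft_id h.isHom h.restriction

end EndOperad

end

section

/-! ### Tokenizations of words -/

section Tokens

variable {α : Type*} {β : Type*} (p : α → Bool) (q : β → Bool)

mutual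
/-- The ways to cut a word into tokens, which are either single letters `x` with `p x` or nonempty
subwords (pieces): these encode the factorizations `b₀ a₁ b₁ ⋯ aₙ bₙ` with the letters of the
`bᵢ` satisfying `p`. -/
def tokens : List α → List (List (α ⊕ List α))
  | [] => [[]]
  | x :: w => (if p x then (tokens w).map (.inl x :: ·) else []) ++
      ((tokens w).map (.inr [x] :: ·) ++ (openTokens w).map fun z => .inr (x :: z.1) :: z.2)

/-- The tokenizations whose first token is a piece, separated from the other tokens. -/
def openTokens : List α → List (List α × List (α ⊕ List α))
  | [] => []
  | x :: w => (tokens w).map (Prod.mk [x]) ++ (openTokens w).map fun z => (x :: z.1, z.2)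
end

variable {X : Type*} [AddCommMonoid X] {Y : Type*} [AddCommMonoid Y]

/-- Sums over all tokenizations. -/
def tokSum (w : List α) (φ : List (α ⊕ List α) → X) : X := ((tokens p w).map φ).sum

/-- Sums over the tokenizations whose first token is a piece. -/
def openSum (w : List α) (φ : List α → List (α ⊕ List α) → X) : X :=
  ((openTokens p w).map fun z => φ z.1 z.2).sum

@[simp] theorem tokSum_nil (φ : List (α ⊕ List α) → X) : tokSum p [] φ = φ [] := by
  simp [tokSum, tokens]

@[simp] theorem openSum_nil (φ : List α → List (α ⊕ List α) → X) : openSum p [] φ = 0 := by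
  simp [openSum, openTokens]

theorem openSum_cons (x : α) (w : List α) (φ : List α → List (α ⊕ List α) → X) :
    openSum p (x :: w) φ = tokSum p w (φ [x]) + openSum p w fun a t => φ (x :: a) t := by
  simp [openSum, openTokens, tokSum, Function.comp_def]

theorem tokSum_cons (x : α) (w : List α) (φ : List (α ⊕ List α) → X) :
    tokSum p (x :: w) φ = (if p x then tokSum p w fun t => φ (.inl x :: t) else 0)
      + openSum p (x :: w) fun a t => φ (.inr a :: t) := by
  rw [openSum_cons]
  cases h : p x <;> simp [tokSum, tokens, openSum, h, Function.comp_def]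

theorem tokSum_add (w : List α) (φ ψ : List (α ⊕ List α) → X) :
    tokSum p w (fun t => φ t + ψ t) = tokSum p w φ + tokSum p w ψ := List.sum_map_add

theorem openSum_add (w : List α) (φ ψ : List α → List (α ⊕ List α) → X) :
    openSum p w (fun a t => φ a t + ψ a t) = openSum p w φ + openSum p w ψ := List.sum_map_add

theorem tokSum_zero (w : List α) : tokSum p w (fun _ => (0 : X)) = 0 := by simp [tokSum]

theorem openSum_zero (w : List α) : openSum p w (fun _ _ => (0 : X)) = 0 := by simp [openSum]

theorem tokSum_congr (w : List α) {φ ψ : List (α ⊕ List α) → X}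
    (h : ∀ t ∈ tokens p w, φ t = ψ t) : tokSum p w φ = tokSum p w ψ :=
  congrArg List.sum (List.map_congr_left h)

theorem openSum_congr (w : List α) {φ ψ : List α → List (α ⊕ List α) → X}
    (h : ∀ z ∈ openTokens p w, φ z.1 z.2 = ψ z.1 z.2) : openSum p w φ = openSum p w ψ :=
  congrArg List.sum (List.map_congr_left h)

theorem tokSum_ite (c : Prop) [Decidable c] (w : List α) (φ ψ : List (α ⊕ List α) → X) :
    tokSum p w (fun t => if c then φ t else ψ t) = if c then tokSum p w φ else tokSum p w ψ := by
  split_ifs <;> rfl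

theorem openSum_ite (c : Prop) [Decidable c] (w : List α) (φ ψ : List α → List (α ⊕ List α) → X) :
    openSum p w (fun a t => if c then φ a t else ψ a t)
      = if c then openSum p w φ else openSum p w ψ := by
  split_ifs <;> rfl

theorem map_tokSum {F : Type*} [FunLike F X Y] [AddMonoidHomClass F X Y] (f : F) (w : List α)
    (φ : List (α ⊕ List α) → X) : f (tokSum p w φ) = tokSum p w fun t => f (φ t) := by
  simp [tokSum, map_list_sum, Function.comp_def]

/-- The letters in a list of tokens. -/
def tokenLetters : List (α ⊕ List α) → List α
  | [] => []
  | .inl x :: t => x :: tokenLetters t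
  | .inr a :: t => a ++ tokenLetters t

/-- The pieces in a list of tokens. -/
def pieces : List (α ⊕ List α) → List (List α)
  | [] => []
  | .inl _ :: t => pieces t
  | .inr a :: t => a :: pieces t

/-- A list of tokens whose single letters satisfy `p` and whose pieces are not empty. -/
def IsTokenList (t : List (α ⊕ List α)) : Prop :=
  ∀ y ∈ t, Sum.elim (fun x => p x = true) (fun a => a ≠ []) y

@[simp] theorem isTokenList_nil : IsTokenList p ([] : List (α ⊕ List α)) := by simp [IsTokenList]

@[simp] theorem isTokenList_cons (y : α ⊕ List α) (t : List (α ⊕ List α)) :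
    IsTokenList p (y :: t) ↔
      Sum.elim (fun x => p x = true) (fun a => a ≠ []) y ∧ IsTokenList p t := by
  simp [IsTokenList]

/-- The tokens of `w` are valid and spell `w`; the second statement is the same for a first piece
which is separated from the other tokens. -/
theorem mem_tokens_aux (w : List α) :
    (∀ t ∈ tokens p w, IsTokenList p t ∧ tokenLetters t = w) ∧
    ∀ z ∈ openTokens p w, z.1 ≠ [] ∧ IsTokenList p z.2 ∧ z.1 ++ tokenLetters z.2 = w := by
  induction w with
  | nil => simp [tokens, openTokens, tokenLetters]
  | cons x w ih =>
    constructor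
    · intro t ht
      simp only [tokens, List.mem_append, List.mem_map] at ht
      rcases ht with ht | ⟨s, hs, rfl⟩ | ⟨z, hz, rfl⟩
      · split_ifs at ht with hx
        · obtain ⟨s, hs, rfl⟩ := List.mem_map.1 ht
          simp [tokenLetters, hx, ih.1 s hs]
        · simp at ht
      · simp [tokenLetters, ih.1 s hs]
      · simp [tokenLetters, ih.2 z hz]
    · intro z hz
      simp only [openTokens, List.mem_append, List.mem_map] at hz
      rcases hz with ⟨s, hs, rfl⟩ | ⟨z, hz, rfl⟩
      · simp [ih.1 s hs]
      · simp [ih.2 z hz]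

variable {p} in
theorem isTokenList_of_mem {w : List α} {t : List (α ⊕ List α)} (h : t ∈ tokens p w) :
    IsTokenList p t := ((mem_tokens_aux p w).1 t h).1

variable {p} in
theorem tokenLetters_of_mem {w : List α} {t : List (α ⊕ List α)} (h : t ∈ tokens p w) :
    tokenLetters t = w := ((mem_tokens_aux p w).1 t h).2

variable {p} in
theorem ne_nil_of_mem_openTokens {w : List α} {z : List α × List (α ⊕ List α)}
    (h : z ∈ openTokens p w) : z.1 ≠ [] := ((mem_tokens_aux p w).2 z h).1

theorem tokens_map_aux (g : α → β) (w : List α) (hw : ∀ x ∈ w, q (g x) = p x) :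
    tokens q (w.map g) = (tokens p w).map (List.map (Sum.map g (List.map g))) ∧
    openTokens q (w.map g) = (openTokens p w).map
      (Prod.map (List.map g) (List.map (Sum.map g (List.map g)))) := by
  induction w with
  | nil => simp [tokens, openTokens]
  | cons x w ih =>
    have ih := ih fun y hy => hw y (List.mem_cons_of_mem _ hy)
    have hx := hw x List.mem_cons_self
    constructor
    · cases h : p x <;> simp [tokens, ih.1, ih.2, hx, h, Function.comp_def, Sum.map]
    · simp [openTokens, ih.1, ih.2, Function.comp_def]

theorem tokSum_map (g : α → β) (w : List α) (hw : ∀ x ∈ w, q (g x) = p x)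
    (φ : List (β ⊕ List β) → X) :
    tokSum q (w.map g) φ = tokSum p w fun t => φ (t.map (Sum.map g (List.map g))) := by
  simp [tokSum, (tokens_map_aux p q g w hw).1, Function.comp_def]

/-- The sum over all ways to tokenize all the pieces in a list of tokens. -/
def refineSum : List (α ⊕ List α) →
    (List ((α ⊕ List α) ⊕ List (α ⊕ List α)) → X) → X
  | [], φ => φ []
  | .inl x :: t, φ => refineSum t fun s => φ (.inl (.inl x) :: s)
  | .inr a :: t, φ => tokSum p a fun v => refineSum t fun s => φ (.inr v :: s)

/-- Grouping the tokens of a word into larger tokens amounts to cutting the larger tokens into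
tokens.  The second and third statements are the versions in which the first large token, or the
first small token in it as well, is a piece which is still open on the left. -/
theorem tokSum_tokSum_aux (w : List α) :
    (∀ φ : List ((α ⊕ List α) ⊕ List (α ⊕ List α)) → X,
      tokSum p w (fun t => tokSum Sum.isLeft t φ) = tokSum p w fun t => refineSum p t φ) ∧
    (∀ φ : List (α ⊕ List α) → List ((α ⊕ List α) ⊕ List (α ⊕ List α)) → X,
      tokSum p w (fun t => openSum Sum.isLeft t φ)
        = openSum p w fun a t => tokSum p a fun v => refineSum p t (φ v)) ∧
    ∀ ξ : List α → List (α ⊕ List α) → List ((α ⊕ List α) ⊕ List (α ⊕ List α)) → X,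
      openSum p w (fun a t => tokSum Sum.isLeft t (ξ a []) + openSum Sum.isLeft t (ξ a))
        = openSum p w fun a t => openSum p a fun b v => refineSum p t (ξ b v) := by
  induction w with
  | nil => simp [refineSum]
  | cons x w ih =>
    obtain ⟨ihT, ihU, ihM⟩ := ih
    have hM : ∀ ξ : List α → List (α ⊕ List α) → List ((α ⊕ List α) ⊕ List (α ⊕ List α)) → X,
        openSum p (x :: w) (fun a t => tokSum Sum.isLeft t (ξ a []) + openSum Sum.isLeft t (ξ a))
          = openSum p (x :: w) fun a t => openSum p a fun b v => refineSum p t (ξ b v) := by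
      intro ξ
      rw [openSum_cons p x w, ihM fun a => ξ (x :: a)]
      simp only [openSum_cons, tokSum_add, ihT, ihU, tokSum_nil, openSum_nil, add_zero,
        openSum_add]
      abel
    have hU : ∀ φ : List (α ⊕ List α) → List ((α ⊕ List α) ⊕ List (α ⊕ List α)) → X,
        tokSum p (x :: w) (fun t => openSum Sum.isLeft t φ)
          = openSum p (x :: w) fun a t => tokSum p a fun v => refineSum p t (φ v) := by
      intro φ
      have h₁ : tokSum p (x :: w) (fun t => openSum Sum.isLeft t φ)
          = (if p x then tokSum p w (fun t => tokSum Sum.isLeft t (φ [.inl x])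
              + openSum Sum.isLeft t fun v => φ (.inl x :: v)) else 0)
            + openSum p (x :: w) fun a t => tokSum Sum.isLeft t (φ [.inr a])
              + openSum Sum.isLeft t fun v => φ (.inr a :: v) := by
        simp only [tokSum_cons p x w, openSum_cons Sum.isLeft]
      rw [h₁, hM fun a v => φ (.inr a :: v), tokSum_add, ihT, ihU]
      simp only [openSum_cons, tokSum_cons, openSum_nil, tokSum_nil, add_zero, tokSum_add,
        openSum_add, tokSum_ite, openSum_ite, openSum_zero, tokSum_zero]
      split_ifs
      · abel
      · simp only [zero_add]
    refine ⟨fun φ => ?_, hU, hM⟩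
    have h₁ : tokSum p (x :: w) (fun t => tokSum Sum.isLeft t φ)
        = (if p x then tokSum p w (fun t => tokSum Sum.isLeft t fun s => φ (.inl (.inl x) :: s))
            else 0)
          + tokSum p (x :: w) fun t => openSum Sum.isLeft t fun a s => φ (.inr a :: s) := by
      have h₂ : ∀ a (t : List (α ⊕ List α)), tokSum Sum.isLeft (.inr a :: t) φ
          = openSum Sum.isLeft (.inr a :: t) fun a s => φ (.inr a :: s) := fun a t => by
        rw [tokSum_cons]; simp
      have h₃ : ∀ x (t : List (α ⊕ List α)), tokSum Sum.isLeft (.inl x :: t) φ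
          = (tokSum Sum.isLeft t fun s => φ (.inl (.inl x) :: s))
            + openSum Sum.isLeft (.inl x :: t) fun a s => φ (.inr a :: s) := fun a t => by
        rw [tokSum_cons]; simp
      rw [tokSum_cons, tokSum_cons p x w (fun t => openSum Sum.isLeft t fun a s => φ (.inr a :: s))]
      simp only [h₂, h₃, tokSum_add]
      split_ifs
      · rw [add_assoc]
      · simp only [zero_add]
    rw [h₁, ihT, hU, tokSum_cons]
    rfl

theorem tokSum_tokSum (w : List α) (φ : List ((α ⊕ List α) ⊕ List (α ⊕ List α)) → X) :
    tokSum p w (fun t => tokSum Sum.isLeft t φ) = tokSum p w fun t => refineSum p t φ :=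
  (tokSum_tokSum_aux p w).1 φ

open Classical in
/-- A sum over tokenizations with only one token, which is a piece. -/
theorem tokSum_single (w : List α) (hw : w ≠ []) (f : List α → X) :
    tokSum p w (fun t => if t = [.inr w] then f w else 0) = f w := by
  have h₀ : ∀ w : List α, w ≠ [] → (tokSum p w fun t => if t = [] then f w else 0) = 0 := by
    intro w hw
    refine (tokSum_congr p w fun t ht => if_neg ?_).trans (tokSum_zero p w)
    rintro rfl
    exact hw (tokenLetters_of_mem ht).symm
  have h₁ : ∀ w : List α, w ≠ [] → ∀ f : List α → X,
      openSum p w (fun a t => if a = w ∧ t = [] then f w else 0) = f w := by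
    intro w
    induction w with
    | nil => intro h; exact absurd rfl h
    | cons x w ih =>
      intro _ f
      rw [openSum_cons]
      by_cases hw : w = []
      · subst hw; simp
      · have h₂ := ih hw fun w => f (x :: w)
        have h₃ : tokSum p w (fun t => if [x] = x :: w ∧ t = [] then f (x :: w) else 0) = 0 := by
          refine (tokSum_congr p w fun t _ => if_neg ?_).trans (tokSum_zero p w)
          simp [Ne.symm hw]
        rw [h₃, zero_add]
        simpa using h₂
  obtain ⟨x, w, rfl⟩ := List.exists_cons_of_ne_nil hw
  rw [tokSum_cons]
  have := h₁ _ hw f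
  simp only [List.cons.injEq, reduceCtorEq, false_and, if_false, Sum.inr.injEq] at this ⊢
  rw [this, tokSum_zero, ite_self, zero_add]

end Tokens

end

section

/-! ### The cooperad laws for words -/

section WordLaws

variable {R : Type u} [CommRing R] {A : Type v} [AddCommGroup A] [Module R A]

/-- The word `b₀ * b₁ * ⋯ * bₙ` of a factorization encoded by a list of tokens. -/
def lower (t : List (Option A ⊕ List (Option A))) : List (Option A) :=
  t.map (Sum.elim id fun _ => none)

/-- The list of tokens `b₀, a₁, b₁, …, aₙ, bₙ` of a factorization. -/
def tokensOfFactorization (f : List (Option A) × List (List (Option A) × List (Option A))) :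
    List (Option A ⊕ List (Option A)) :=
  f.1.map .inl ++ f.2.flatMap fun ab => .inr ab.1 :: ab.2.map .inl

omit [AddCommGroup A] in
/-- Factorizations are encoded by tokenizations; those with empty `b₀` and at least one piece by the
tokenizations whose first token is a piece. -/
theorem factorizations_tokens_aux (w : List (Option A)) :
    (factorizations w).map tokensOfFactorization = tokens Option.isSome w ∧
    (factorizations w).filterMap (fun f => match f with
      | ([], (a, b) :: l) => some (a, tokensOfFactorization (b, l))
      | _ => none) = openTokens Option.isSome w := by
  induction w with
  | nil => simp [factorizations, tokens, openTokens, tokensOfFactorization]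
  | cons x w ih =>
    obtain ⟨ih₁, ih₂⟩ := ih
    constructor
    · rw [factorizations, tokens, List.map_append, List.map_append, ← ih₁, ← ih₂]
      congr 1
      · split_ifs <;> simp [tokensOfFactorization, Function.comp_def]
      · congr 1
        · simp [tokensOfFactorization, Function.comp_def]
        · rw [List.map_filterMap, List.map_filterMap]
          refine List.filterMap_congr fun f _ => ?_
          rcases f with ⟨_ | ⟨y, b₀⟩, _ | ⟨⟨a, b⟩, l⟩⟩ <;>
            simp [addToFirst, tokensOfFactorization]
    · rw [factorizations, openTokens, List.filterMap_append, List.filterMap_append, ← ih₁, ← ih₂]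
      have h₀ : ((if x.isSome = true then (factorizations w).map fun f => (x :: f.1, f.2)
          else []).filterMap fun f => match f with
            | ([], (a, b) :: l) => some (a, tokensOfFactorization (b, l))
            | _ => none) = [] := by
        split_ifs <;> simp
      rw [h₀, List.nil_append]
      congr 1
      · simp [Function.comp_def, List.filterMap_map]
      · rw [List.filterMap_filterMap, List.map_filterMap]
        refine List.filterMap_congr fun f _ => ?_
        rcases f with ⟨_ | ⟨y, b₀⟩, _ | ⟨⟨a, b⟩, l⟩⟩ <;> simp [addToFirst]

theorem wordDecomp_eq_tokSum (w : List (Option A)) (hw : w ≠ []) :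
    wordDecomp R A (word R w) = tokSum Option.isSome w fun t =>
      word R (lower t) ⊗ₜ[R] monomial R ((pieces t).map (word R)) := by
  obtain ⟨x, w, rfl⟩ := List.exists_cons_of_ne_nil hw
  rw [wordDecomp_word, tokSum, ← (factorizations_tokens_aux (x :: w)).1, List.map_map]
  refine congrArg List.sum (List.map_congr_left fun f _ => ?_)
  have h₁ : ∀ b : List (Option A), pieces (b.map .inl) = [] := by
    intro b; induction b with
    | nil => rfl
    | cons x b ih => simpa [pieces] using ih
  have h₂ : ∀ (b : List (Option A)) t, pieces (b.map .inl ++ t) = pieces t := by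
    intro b t; induction b with
    | nil => rfl
    | cons x b ih => simpa [pieces] using ih
  have h₃ : lower (tokensOfFactorization f) = lowerWord f.1 f.2 := by
    simp [lower, tokensOfFactorization, lowerWord, List.map_flatMap, Function.comp_def]
  have h₄ : pieces (tokensOfFactorization f) = f.2.map Prod.fst := by
    rw [tokensOfFactorization, h₂]
    induction f.2 with
    | nil => rfl
    | cons ab l ih => simp [pieces, h₂, ih]
  rw [Function.comp_apply, h₃, h₄, monomial, List.map_map, List.map_map]
  rfl

theorem span_letters : Submodule.span R (Set.range (letter R (A := A))) = ⊤ := by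
  refine eq_top_iff.2 fun x _ => ?_
  have : x = letter R (some x.1) + x.2 • letter R (none : Option A) := by
    ext <;> simp [letter]
  rw [this]
  exact Submodule.add_mem _ (Submodule.subset_span ⟨_, rfl⟩)
    (Submodule.smul_mem _ _ (Submodule.subset_span ⟨_, rfl⟩))

theorem word_cons (x : Option A) (w : List (Option A)) :
    word R (x :: w) = letter R x ⊗ₜ monomial R (w.map (letter R)) := by
  rw [word, monomial, List.map_map]
  rfl

theorem span_monomial_letters :
    Submodule.span R (Set.range fun w : List (Option A) => monomial R (w.map (letter R)))
      = (⊤ : Submodule R (TensorAlgebra R (A × R))) := by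
  set U := Submodule.span R
    (Set.range fun w : List (Option A) => monomial R (w.map (letter R))) with hU
  have h : Submodule.map₂ (LinearMap.mul R (TensorAlgebra R (A × R)) ∘ₗ TensorAlgebra.ι R) ⊤ U
      ≤ U := by
    rw [← span_letters, hU, Submodule.map₂_span_span, Submodule.span_le]
    rintro _ ⟨_, ⟨x, rfl⟩, _, ⟨w, rfl⟩, rfl⟩
    exact Submodule.subset_span ⟨x :: w, by simp⟩
  rw [← span_monomial, eq_comm]
  refine le_antisymm (Submodule.span_le.2 ?_) (Submodule.span_mono ?_)
  · rintro _ ⟨l, rfl⟩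
    induction l with
    | nil => exact Submodule.subset_span ⟨[], by simp⟩
    | cons y l ih =>
      rw [monomial_cons]
      exact h (Submodule.apply_mem_map₂ (LinearMap.mul R (TensorAlgebra R (A × R)) ∘ₗ
        TensorAlgebra.ι R) (m := y) trivial ih)
  · rintro _ ⟨w, rfl⟩
    exact ⟨_, rfl⟩

theorem span_words :
    Submodule.span R {c : Words R A | ∃ w : List (Option A), w ≠ [] ∧ c = word R w} = ⊤ := by
  rw [eq_top_iff, ← TensorProduct.map₂_mk_top_top_eq_top, ← span_letters,
    ← span_monomial_letters, Submodule.map₂_span_span, Submodule.span_le]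
  rintro _ ⟨_, ⟨x, rfl⟩, _, ⟨w, rfl⟩, rfl⟩
  exact Submodule.subset_span ⟨x :: w, List.cons_ne_nil _ _, (word_cons x w).symm⟩

open Classical in
theorem counit_word (w : List (Option A)) :
    (coAs R A).counit (word R w) = if w = [none] then 1 else 0 := by
  rcases w with _ | ⟨x, _ | ⟨y, w⟩⟩
  · simp [word]
  · rcases x with _ | a <;> simp [coAs, word, letter]
  · simp [coAs, word, TensorAlgebra.algebraMapInv]

end WordLaws

section WordModel

variable {R : Type u} [CommRing R] {A : Type v} {C : Type w} [AddCommGroup C] [Module R C]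

open Classical in
/-- The properties of the words `wd w` in `*` and `A` which determine the structure of the cooperad
`S` which they span. -/
structure IsWordModel (S : CooperadData R C) (wd : List (Option A) → C) : Prop where
  word_nil : wd [] = 0
  span_words : Submodule.span R {c | ∃ w, w ≠ [] ∧ c = wd w} = ⊤
  arity_eq : ∀ n, S.arity n = Submodule.span R {c | ∃ w, w.countP Option.isNone = n ∧ c = wd w}
  decomp_word : ∀ w, w ≠ [] → S.decomp (wd w) = tokSum Option.isSome w fun t =>
    wd (lower t) ⊗ₜ[R] monomial R ((pieces t).map wd)
  counit_word : ∀ w, S.counit (wd w) = if w = [none] then 1 else 0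
  coaug_eq : S.coaug = wd [none]

theorem isWordModel_coAs {A : Type v} [AddCommGroup A] [Module R A] :
    IsWordModel (coAs R A) (word R) where
  word_nil := rfl
  span_words := span_words
  arity_eq _ := rfl
  decomp_word := wordDecomp_eq_tokSum
  counit_word := counit_word
  coaug_eq := rfl

namespace IsWordModel

variable {S : CooperadData R C} {wd : List (Option A) → C}

theorem linearMap_ext (hS : IsWordModel S wd) {Y : Type*} [AddCommMonoid Y] [Module R Y]
    {f g : C →ₗ[R] Y} (h : ∀ w, w ≠ [] → f (wd w) = g (wd w)) : f = g := by
  refine LinearMap.ext_on hS.span_words ?_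
  rintro _ ⟨w, hw, rfl⟩
  exact h w hw

theorem counit_left (hS : IsWordModel S wd) (c : C) : TensorProduct.lid R _
    (LinearMap.rTensor _ S.counit (S.decomp c)) = TensorAlgebra.ι R c := by
  have h : (TensorProduct.lid R _).toLinearMap ∘ₗ LinearMap.rTensor _ S.counit ∘ₗ
      S.decomp = TensorAlgebra.ι R := by
    refine hS.linearMap_ext fun w hw => ?_
    rw [LinearMap.comp_apply, LinearMap.comp_apply, hS.decomp_word w hw, map_tokSum,
      LinearEquiv.coe_coe, map_tokSum, ← tokSum_single Option.isSome w hw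
        fun w => TensorAlgebra.ι R (wd w)]
    refine tokSum_congr _ _ fun t ht => ?_
    rw [LinearMap.rTensor_tmul, TensorProduct.lid_tmul, hS.counit_word]
    have h₁ := isTokenList_of_mem ht
    have h₂ := tokenLetters_of_mem ht
    have h₃ : lower t = [none] ↔ t = [.inr w] := by
      constructor
      · intro h
        rcases t with _ | ⟨y, _ | ⟨z, t⟩⟩
        · simp [lower] at h
        · rcases y with x | a
          · simp [lower] at h
            subst h
            simp at h₁
          · simp [tokenLetters] at h₂
            rw [h₂]
        · simp [lower] at h
      · rintro rfl
        rfl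
    by_cases h : t = [.inr w]
    · rw [if_pos (h₃.2 h), if_pos h, one_smul, h]
      simp [pieces]
    · rw [if_neg (mt h₃.1 h), if_neg h, zero_smul]
  simpa only [LinearMap.comp_apply, LinearEquiv.coe_coe] using LinearMap.congr_fun h c

theorem counit_right (hS : IsWordModel S wd) (c : C) : TensorProduct.rid R _
    (LinearMap.lTensor _ (TensorAlgebra.lift R S.counit).toLinearMap
      (S.decomp c)) = c := by
  classical
  have h₀ : ∀ (w : List (Option A)) (φ : List (Option A) → C),
      (tokSum Option.isSome w fun t =>
        ((pieces t).map fun a => S.counit (wd a)).prod • φ (lower t)) = φ w := by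
    intro w
    induction w with
    | nil => intro φ; simp [pieces, lower]
    | cons x w ih =>
      intro φ
      have h₁ : (openSum Option.isSome w fun a t =>
          ((pieces (.inr (x :: a) :: t)).map fun a => S.counit (wd a)).prod
            • φ (lower (.inr (x :: a) :: t))) = 0 := by
        refine (openSum_congr _ w fun z hz => ?_).trans (openSum_zero _ w)
        have hz := ne_nil_of_mem_openTokens hz
        simp [pieces, hS.counit_word, hz]
      rw [tokSum_cons, openSum_cons, h₁, add_zero]
      rcases x with _ | a
      · simpa [pieces, hS.counit_word, lower] using ih fun w => φ (none :: w)
      · simpa [pieces, hS.counit_word, lower, tokSum_zero] using ih fun w => φ (some a :: w)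
  have h : (TensorProduct.rid R _).toLinearMap ∘ₗ LinearMap.lTensor _
      (TensorAlgebra.lift R S.counit).toLinearMap ∘ₗ S.decomp = LinearMap.id := by
    refine hS.linearMap_ext fun w hw => ?_
    rw [LinearMap.comp_apply, LinearMap.comp_apply, hS.decomp_word w hw, map_tokSum,
      LinearEquiv.coe_coe, map_tokSum, LinearMap.id_apply, ← h₀ w wd]
    refine tokSum_congr _ _ fun t ht => ?_
    rw [LinearMap.lTensor_tmul, TensorProduct.rid_tmul, AlgHom.toLinearMap_apply, lift_monomial,
      List.map_map]
    rfl
  simpa only [LinearMap.comp_apply, LinearEquiv.coe_coe, LinearMap.id_apply]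
    using LinearMap.congr_fun h c

end IsWordModel

end WordModel

end

/-! ### Words form a conilpotent cooperad -/

section

section WordModel

variable {R : Type u} [CommRing R] {A : Type v} {C : Type w} [AddCommGroup C] [Module R C]
  {S : CooperadData R C} {wd : List (Option A) → C}

theorem pieces_append {α : Type*} (s t : List (α ⊕ List α)) :
    pieces (s ++ t) = pieces s ++ pieces t := by
  induction s with
  | nil => rfl
  | cons y s ih => rcases y with x | a <;> simp [pieces, ih]

theorem ne_nil_of_mem_pieces {α : Type*} {p : α → Bool} {t : List (α ⊕ List α)}
    (ht : IsTokenList p t) {a : List α} (ha : a ∈ pieces t) : a ≠ [] := by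
  induction t with
  | nil => simp [pieces] at ha
  | cons y t ih =>
    rw [isTokenList_cons] at ht
    rcases y with x | b
    · exact ih ht.2 ha
    · rcases List.mem_cons.1 ha with rfl | ha
      · exact ht.1
      · exact ih ht.2 ha

theorem lower_ne_nil {w : List (Option A)} {t : List (Option A ⊕ List (Option A))}
    (hw : w ≠ []) (ht : t ∈ tokens Option.isSome w) : lower t ≠ [] := by
  rintro h
  rw [lower, List.map_eq_nil_iff] at h
  subst h
  exact hw (tokenLetters_of_mem ht).symm

theorem isSome_lower {w : List (Option A)} {t : List (Option A ⊕ List (Option A))}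
    (ht : t ∈ tokens Option.isSome w) :
    ∀ y ∈ t, (Sum.elim id (fun _ => none) y : Option A).isSome = y.isLeft := by
  intro y hy
  have := isTokenList_of_mem ht y hy
  rcases y with x | a
  · exact this
  · rfl

/-- If the summand is a function of the outer word, multiplied with one factor `G₀ v` for each
refined piece `v`, the sum over all refinements factors over the pieces. -/
theorem refineSum_mul {Q Y : Type*} [Ring Q] [AddCommMonoid Y]
    (G : List ((Option A ⊕ List (Option A)) ⊕ List (Option A ⊕ List (Option A))) → Q)
    (G₀ : List (Option A ⊕ List (Option A)) → Q) (h₁ : G [] = 1)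
    (h₂ : ∀ x s, G (.inl (.inl x) :: s) = G s) (h₃ : ∀ v s, G (.inr v :: s) = G₀ v * G s)
    (t : List (Option A ⊕ List (Option A))) (F : List (Option A) → Q →+ Y) :
    (refineSum Option.isSome t fun s =>
      F (s.map (Sum.elim (Sum.elim id fun _ => none) fun _ => none)) (G s))
      = F (lower t) ((pieces t).map fun a => tokSum Option.isSome a G₀).prod := by
  induction t generalizing F with
  | nil => simp [refineSum, pieces, lower, h₁]
  | cons y t ih =>
    rcases y with x | a
    · have := ih fun l => F (x :: l)
      simpa [refineSum, pieces, lower, h₂] using this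
    · have h₄ : ∀ v, (refineSum Option.isSome t fun s =>
          F ((Sum.inr v :: s).map (Sum.elim (Sum.elim id fun _ => none) fun _ => none))
            (G (.inr v :: s))) = (F (none :: lower t)).comp (AddMonoidHom.mulRight
              ((pieces t).map fun a => tokSum Option.isSome a G₀).prod) (G₀ v) :=
        fun v => by
          simp only [h₃]
          exact ih fun l => (F (none :: l)).comp (AddMonoidHom.mulLeft (G₀ v))
      rw [refineSum]
      simp only [h₄]
      rw [← map_tokSum]
      simp [pieces, lower]

/-- Two levels of pieces, as in the twofold decomposition of a word. -/
def twoLevels (R : Type u) [CommRing R] {C : Type w} [AddCommGroup C] [Module R C]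
    (wd : List (Option A) → C)
    (s : List ((Option A ⊕ List (Option A)) ⊕ List (Option A ⊕ List (Option A)))) :
    TensorAlgebra R C ⊗[R] TensorAlgebra R C :=
  monomial R ((pieces s).map fun v => wd (lower v))
    ⊗ₜ monomial R ((pieces (tokenLetters s)).map wd)

theorem list_sum_map_sub {ι M : Type*} [AddCommGroup M] (l : List ι) (f g : ι → M) :
    (l.map f).sum - (l.map g).sum = (l.map fun i => f i - g i).sum := by
  induction l with
  | nil => simp
  | cons i l ih => simp [← ih, add_sub_add_comm]

/-- Both iterated decompositions are sums over the factorizations into two levels of pieces. -/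
theorem IsWordModel.coassoc (hS : IsWordModel S wd) (c : C) :
    TensorProduct.assoc R _ _ _ (LinearMap.rTensor _ S.decomp (S.decomp c))
      = LinearMap.lTensor _ S.upper.toLinearMap (S.decomp c) := by
  have h : (TensorProduct.assoc R C (TensorAlgebra R C)
      (TensorAlgebra R C)).toLinearMap ∘ₗ LinearMap.rTensor _ S.decomp ∘ₗ
      S.decomp = LinearMap.lTensor _ S.upper.toLinearMap ∘ₗ S.decomp := by
    refine hS.linearMap_ext fun w hw => ?_
    simp only [LinearMap.comp_apply, LinearEquiv.coe_coe]
    rw [hS.decomp_word w hw, map_tokSum, map_tokSum, map_tokSum]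
    have h₁ : ∀ t ∈ tokens Option.isSome w, TensorProduct.assoc R _ _ _
        (LinearMap.rTensor _ S.decomp
          (wd (lower t) ⊗ₜ[R] monomial R ((pieces t).map wd)))
        = tokSum Sum.isLeft t fun s =>
          wd (s.map (Sum.elim (Sum.elim id fun _ => none) fun _ => none)) ⊗ₜ[R]
            twoLevels R wd s := by
      intro t ht
      have h₃ : ∀ X : C ⊗[R] TensorAlgebra R C, X ⊗ₜ[R]
          monomial R ((pieces t).map wd) = (TensorProduct.mk R _ _).flip
            (monomial R ((pieces t).map wd)) X := fun _ => rfl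
      rw [LinearMap.rTensor_tmul, hS.decomp_word _ (lower_ne_nil hw ht), lower,
        tokSum_map _ _ _ _ (isSome_lower ht), h₃, map_tokSum, map_tokSum]
      refine tokSum_congr _ _ fun s hs => ?_
      have h₄ : ∀ s : List ((Option A ⊕ List (Option A)) ⊕ List (Option A ⊕ List (Option A))),
          pieces (s.map (Sum.map (Sum.elim id fun _ => none)
            (List.map (Sum.elim id fun _ => none)))) = (pieces s).map lower := by
        intro s
        induction s with
        | nil => rfl
        | cons y s ih => rcases y with x | a <;> simpa [pieces, lower] using ih
      have h₅ : lower (s.map (Sum.map (Sum.elim id fun _ => none)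
          (List.map (Sum.elim id fun _ => none))))
          = s.map (Sum.elim (Sum.elim id fun _ => none) fun _ => none) := by
        rw [lower, List.map_map]
        refine List.map_congr_left fun y _ => ?_
        rcases y with x | a <;> rfl
      rw [LinearMap.flip_apply, TensorProduct.mk_apply, TensorProduct.assoc_tmul, h₄, h₅, twoLevels,
        tokenLetters_of_mem hs, List.map_map]
      rfl
    rw [tokSum_congr _ _ h₁, tokSum_tokSum]
    refine tokSum_congr _ _ fun t ht => ?_
    refine (refineSum_mul (twoLevels R wd) (fun v => TensorAlgebra.ι R (wd (lower v)) ⊗ₜ[R]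
      monomial R ((pieces v).map wd)) ?_ ?_ ?_ t fun l => (TensorProduct.mk R C
        (TensorAlgebra R C ⊗[R] TensorAlgebra R C)
        (wd l)).toAddMonoidHom).trans ?_
    · simp [twoLevels, pieces, tokenLetters, Algebra.TensorProduct.one_def]
    · intro x s
      simp [twoLevels, pieces, tokenLetters]
    · intro v s
      simp [twoLevels, pieces, tokenLetters, pieces_append, monomial_append]
    · rw [LinearMap.lTensor_tmul, AlgHom.toLinearMap_apply, CooperadData.upper, lift_monomial,
        List.map_map, LinearMap.toAddMonoidHom_coe, TensorProduct.mk_apply]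
      refine congrArg (fun l : List _ => wd (lower t) ⊗ₜ[R] l.prod)
        (List.map_congr_left fun a ha => ?_)
      have ha₀ : a ≠ [] := ne_nil_of_mem_pieces (isTokenList_of_mem ht) ha
      rw [Function.comp_apply, LinearMap.comp_apply, hS.decomp_word a ha₀, map_tokSum]
      rfl
  simpa only [LinearMap.comp_apply, LinearEquiv.coe_coe] using LinearMap.congr_fun h c

variable (R) in
/-- The filtration of the cooperad of words by length. -/
def lengthFiltration (wd : List (Option A) → C) (n : ℕ) : Submodule R C :=
  Submodule.span R {c | ∃ w : List (Option A), w.length ≤ n ∧ c = wd w}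

theorem lengthFiltration_mono : Monotone (lengthFiltration R wd) :=
  fun _ _ h => Submodule.span_mono fun _ ⟨w, hw, e⟩ => ⟨w, hw.trans h, e⟩

/-- The arity of the lower word is the number of pieces, and the arities of the pieces sum up to the
arity of the word. -/
theorem countP_lower (t : List (Option A ⊕ List (Option A)))
    (ht : IsTokenList Option.isSome t) :
    (lower t).countP Option.isNone = (pieces t).length ∧
    ((pieces t).map (List.countP Option.isNone)).sum
      = (tokenLetters t).countP Option.isNone := by
  induction t with
  | nil => simp [lower, pieces, tokenLetters]
  | cons y t ih =>
    rw [isTokenList_cons] at ht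
    obtain ⟨ih₁, ih₂⟩ := ih ht.2
    rw [lower] at ih₁ ⊢
    rcases y with x | a
    · obtain ⟨x, rfl⟩ := Option.isSome_iff_exists.1 ht.1
      simp [pieces, tokenLetters, ih₁, ih₂]
    · simp [pieces, tokenLetters, ih₁, ih₂]

theorem IsWordModel.decomp_arity (hS : IsWordModel S wd) (n : ℕ) (c : C) (hc : c ∈ S.arity n) :
    S.decomp c ∈ Submodule.span R (S.composites n) := by
  refine (Submodule.span_le.2 ?_ : _ ≤ (Submodule.span R (S.composites n)).comap
    S.decomp) (hS.arity_eq n ▸ hc)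
  rintro _ ⟨w, hw, rfl⟩
  rw [SetLike.mem_coe, Submodule.mem_comap]
  by_cases hw₀ : w = []
  · subst hw₀
    rw [hS.word_nil, map_zero]
    exact Submodule.zero_mem _
  rw [hS.decomp_word w hw₀, tokSum]
  refine list_sum_mem fun z hz => ?_
  obtain ⟨t, ht, rfl⟩ := List.mem_map.1 hz
  obtain ⟨h₁, h₂⟩ := countP_lower t (isTokenList_of_mem ht)
  have hmem : ∀ n w, w.countP Option.isNone = n → wd w ∈ S.arity n := fun n w h => by
    rw [hS.arity_eq]
    exact Submodule.subset_span ⟨w, h, rfl⟩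
  refine Submodule.subset_span ⟨(pieces t).length, _,
    fun i => ((pieces t).get i).countP Option.isNone, fun i => wd ((pieces t).get i),
    hmem _ _ h₁, fun i => hmem _ _ rfl, ?_, ?_⟩
  · rw [← hw, ← tokenLetters_of_mem ht, ← h₂]
    conv_rhs => rw [← List.ofFn_get (pieces t), List.map_ofFn, List.sum_ofFn]
    rfl
  · congr 2
    conv_lhs => rw [← List.ofFn_get (pieces t), List.map_ofFn]
    rfl

theorem IsWordModel.decomp_lengthFiltration (hS : IsWordModel S wd) (n : ℕ) (c : C)
    (hc : c ∈ lengthFiltration R wd (n + 1)) :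
    S.decomp c - wd [none] ⊗ₜ TensorAlgebra.ι R c ∈ Submodule.span R
      {z | ∃ (c' : C) (l : List C), (∀ d ∈ l, d ∈ lengthFiltration R wd n) ∧
        z = c' ⊗ₜ monomial R l} := by
  classical
  set N := Submodule.span R
      {z : C ⊗[R] TensorAlgebra R C | ∃ (c' : C) (l : List C),
        (∀ d ∈ l, d ∈ lengthFiltration R wd n) ∧
        z = c' ⊗ₜ monomial R l} with hN
  induction hc using Submodule.span_induction with
  | zero => simp
  | add c c' _ _ h h' =>
    rw [map_add, map_add, TensorProduct.tmul_add, add_sub_add_comm]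
    exact Submodule.add_mem _ h h'
  | smul r c _ h =>
    rw [map_smul, map_smul, TensorProduct.tmul_smul, ← smul_sub]
    exact Submodule.smul_mem _ _ h
  | mem c hc => ?_
  obtain ⟨w, hw, rfl⟩ := hc
  by_cases hw₀ : w = []
  · subst hw₀
    rw [hS.word_nil, map_zero, map_zero, TensorProduct.tmul_zero, sub_zero]
    exact Submodule.zero_mem _
  rw [hS.decomp_word w hw₀, ← tokSum_single Option.isSome w hw₀
    fun w => wd [none] ⊗ₜ[R] TensorAlgebra.ι R (wd w), tokSum, tokSum,
    list_sum_map_sub]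
  refine list_sum_mem fun z hz => ?_
  obtain ⟨t, ht, rfl⟩ := List.mem_map.1 hz
  split_ifs with h
  · subst h
    simp only [pieces, lower, List.map_cons, List.map_nil, monomial_cons, monomial_nil, mul_one,
      Sum.elim_inr, sub_self]
    exact Submodule.zero_mem _
  · rw [sub_zero]
    refine Submodule.subset_span ⟨_, _, fun d hd => ?_, rfl⟩
    obtain ⟨a, ha, rfl⟩ := List.mem_map.1 hd
    refine Submodule.subset_span ⟨a, ?_, rfl⟩
    -- A piece which is not the only token is shorter than the word.
    have hlt : ∀ t : List (Option A ⊕ List (Option A)), IsTokenList Option.isSome t →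
        t.length ≤ (tokenLetters t).length ∧
        ∀ a ∈ pieces t, a.length + t.length ≤ (tokenLetters t).length + 1 := by
      intro t
      induction t with
      | nil => simp [tokenLetters, pieces]
      | cons y t ih =>
        intro h
        rw [isTokenList_cons] at h
        obtain ⟨ih₁, ih₂⟩ := ih h.2
        rcases y with x | b
        · simp only [tokenLetters, pieces, List.length_cons]
          exact ⟨by omega, fun a ha => by have := ih₂ a ha; omega⟩
        · have hb : 0 < b.length := List.length_pos_of_ne_nil h.1
          simp only [tokenLetters, pieces, List.length_cons, List.length_append, List.mem_cons]
          refine ⟨by omega, ?_⟩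
          rintro a (rfl | ha)
          · omega
          · have := ih₂ a ha; omega
    have h₁ := (hlt t (isTokenList_of_mem ht)).2 a ha
    rw [tokenLetters_of_mem ht] at h₁
    have h₂ : 2 ≤ t.length := by
      rcases t with _ | ⟨y, _ | ⟨z, t⟩⟩
      · simp [pieces] at ha
      · rcases y with x | b
        · simp [pieces] at ha
        · have := tokenLetters_of_mem ht
          simp only [tokenLetters, List.append_nil] at this
          subst this
          exact absurd rfl h
      · simp
    omega

theorem IsWordModel.isConilpotentCooperad (hS : IsWordModel S wd) :
    IsConilpotentCooperad S (lengthFiltration R wd) where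
  decomp_coaug := by
    rw [hS.coaug_eq, hS.decomp_word [none] (List.cons_ne_nil _ _)]
    simp [tokSum, tokens, openTokens, lower, pieces]
  counit_coaug := by
    rw [hS.coaug_eq]
    exact (hS.counit_word _).trans (if_pos rfl)
  counit_left := hS.counit_left
  counit_right := hS.counit_right
  coassoc := hS.coassoc
  iSup_arity := by
    rw [eq_top_iff, ← hS.span_words, Submodule.span_le]
    rintro _ ⟨w, _, rfl⟩
    refine Submodule.mem_iSup_of_mem (w.countP Option.isNone) ?_
    rw [hS.arity_eq]
    exact Submodule.subset_span ⟨w, rfl, rfl⟩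
  decomp_arity := hS.decomp_arity
  counit_arity n hn c hc := by
    rw [hS.arity_eq] at hc
    refine (Submodule.span_le.2 ?_ : _ ≤ LinearMap.ker S.counit) hc
    rintro _ ⟨w, hw, rfl⟩
    rw [SetLike.mem_coe, LinearMap.mem_ker, hS.counit_word, if_neg]
    rintro rfl
    exact hn hw.symm
  fil_zero := by
    rw [eq_bot_iff, lengthFiltration, Submodule.span_le]
    rintro _ ⟨w, hw, rfl⟩
    rw [List.eq_nil_of_length_eq_zero (Nat.le_zero.1 hw)]
    exact hS.word_nil
  fil_mono := lengthFiltration_mono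
  exists_mem_fil c := by
    have hc : c ∈ Submodule.span R {c | ∃ w, w ≠ [] ∧ c = wd w} := by
      rw [hS.span_words]; trivial
    rw [← Submodule.mem_iSup_of_directed _ lengthFiltration_mono.directed_le]
    refine (Submodule.span_le.2 ?_ : _ ≤ ⨆ n, lengthFiltration R wd n) hc
    rintro _ ⟨w, _, rfl⟩
    exact Submodule.mem_iSup_of_mem w.length (Submodule.subset_span ⟨w, le_rfl, rfl⟩)
  decomp_fil n c hc := by
    rw [hS.coaug_eq]
    exact hS.decomp_lengthFiltration n c hc

end WordModel

end

section

/-! ### Linear maps out of the module of words -/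

section WordAction

variable {R : Type u} [CommRing R] {A : Type v} [AddCommGroup A] [Module R A]
  {Z : Type w} [AddCommGroup Z] [Module R Z]

/-- The linear map on words sending `x₁ ⋯ xₙ` to `x₁ (⋯ (xₙ z))`, for an action of the letters. -/
def wordAction (act : A × R →ₗ[R] Module.End R Z) (z : Z) : Words R A →ₗ[R] Z :=
  TensorProduct.lift (LinearMap.lcomp R Z
    (LinearMap.applyₗ z ∘ₗ (TensorAlgebra.lift R act).toLinearMap) ∘ₗ act)

theorem wordAction_word (act : A × R →ₗ[R] Module.End R Z) (z : Z) (w : List (Option A))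
    (hw : w ≠ []) : wordAction act z (word R w) = w.foldr (fun x z => act (letter R x) z) z := by
  obtain ⟨x, w, rfl⟩ := List.exists_cons_of_ne_nil hw
  have h : TensorAlgebra.lift R act (monomial R (w.map (letter R))) z
      = w.foldr (fun x z => act (letter R x) z) z := by
    induction w with
    | nil => simp
    | cons y w ih => simp [ih]
  rw [word_cons, wordAction, TensorProduct.lift.tmul, List.foldr_cons, ← h]
  rfl

end WordAction

section Operations

variable {R : Type u} [CommRing R] {B : Type v} [AddCommGroup B] [Module R B]
  {X : Type w} [AddCommGroup X] [Module R X] {Y : Type x} [AddCommGroup Y] [Module R Y]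

variable (R B X) in
/-- Multilinear operations on `B`, of all arities, with values in `X`. -/
abbrev Operations : Type max v w := ⨁ n, MultilinearMap R (fun _ : Fin n => B) X

/-- Postcomposition of operations with a linear map. -/
def postcomp (f : X →ₗ[R] Y) : Operations R B X →ₗ[R] Operations R B Y :=
  DirectSum.lmap fun _ => f.compMultilinearMapₗ R

/-- A new first argument of an operation of arity `n`, which acts on the result. -/
def addArgumentAt (l : B →ₗ[R] Module.End R X) (n : ℕ) :
    MultilinearMap R (fun _ : Fin n => B) X →ₗ[R] MultilinearMap R (fun _ : Fin (n + 1) => B) X :=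
  (multilinearCurryLeftEquiv R (fun _ : Fin (n + 1) => B) X).symm.toLinearMap ∘ₗ
    LinearMap.mk₂ R (fun f b => (l b).compMultilinearMap f)
      (fun _ _ _ => by ext; simp) (fun _ _ _ => by ext; simp) (fun _ _ _ => by ext; simp)
      (fun _ _ _ => by ext; simp)

/-- A new first argument, which acts on the result. -/
def addArgument (l : B →ₗ[R] Module.End R X) : Operations R B X →ₗ[R] Operations R B X :=
  DirectSum.toModule R ℕ _ fun n =>
    DirectSum.lof R ℕ (fun n => MultilinearMap R (fun _ : Fin n => B) X) (n + 1) ∘ₗ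
      addArgumentAt l n

/-- The value of an operation at a list of arguments. -/
def evalList (z : Operations R B X) (b : List B) : X := z b.length b.get

theorem postcomp_lof (f : X →ₗ[R] Y) (n : ℕ) (y : MultilinearMap R (fun _ : Fin n => B) X) :
    postcomp f (DirectSum.lof R ℕ (fun n => MultilinearMap R (fun _ : Fin n => B) X) n y)
      = DirectSum.lof R ℕ (fun n => MultilinearMap R (fun _ : Fin n => B) Y) n
        (f.compMultilinearMapₗ R y) := by
  rw [postcomp, DirectSum.lmap_lof]

theorem evalList_add (z z' : Operations R B X) (b : List B) :
    evalList (z + z') b = evalList z b + evalList z' b := by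
  rw [evalList, DirectSum.add_apply, add_apply]
  rfl

theorem evalList_postcomp (f : X →ₗ[R] Y) (z : Operations R B X) (b : List B) :
    evalList (postcomp f z) b = f (evalList z b) := rfl

theorem addArgument_lof (l : B →ₗ[R] Module.End R X) (n : ℕ)
    (y : MultilinearMap R (fun _ : Fin n => B) X) :
    addArgument l (DirectSum.lof R ℕ (fun n => MultilinearMap R (fun _ : Fin n => B) X) n y)
      = DirectSum.lof R ℕ (fun n => MultilinearMap R (fun _ : Fin n => B) X) (n + 1)
        (addArgumentAt l n y) := by
  rw [addArgument, DirectSum.toModule_lof, LinearMap.comp_apply]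

theorem evalList_lof_of_ne {n : ℕ} (y : MultilinearMap R (fun _ : Fin n => B) X) {b : List B}
    (h : n ≠ b.length) : evalList (DirectSum.lof R ℕ _ n y) b = 0 := by
  rw [evalList, DirectSum.lof_eq_of, DirectSum.of_eq_of_ne _ _ _ h.symm, zero_apply]

theorem evalList_lof (b : List B) (y : MultilinearMap R (fun _ : Fin b.length => B) X) :
    evalList (DirectSum.lof R ℕ _ b.length y) b = y b.get := by
  rw [evalList, DirectSum.lof_eq_of, DirectSum.of_eq_same]

theorem evalList_lof_of_eq {n : ℕ} (y : MultilinearMap R (fun _ : Fin n => B) X) {b : List B}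
    (h : b.length = n) :
    evalList (DirectSum.lof R ℕ _ n y) b = y fun i => b.get (Fin.cast h.symm i) := by
  subst h
  exact evalList_lof b y

theorem evalList_addArgument (l : B →ₗ[R] Module.End R X) (z : Operations R B X) (b : B)
    (bs : List B) : evalList (addArgument l z) (b :: bs) = l b (evalList z bs) := by
  induction z using DirectSum.induction_on with
  | zero => rw [map_zero]; exact (map_zero (l b)).symm
  | add z z' h h' => rw [map_add, evalList_add, evalList_add, h, h', map_add]
  | of n y =>
    rw [← DirectSum.lof_eq_of R, addArgument_lof]
    by_cases hn : n = bs.length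
    · subst hn
      rw [evalList_lof bs y]
      exact evalList_lof (b :: bs) (addArgumentAt l bs.length y)
    · rw [evalList_lof_of_ne y hn, map_zero,
        evalList_lof_of_ne _ (by rw [List.length_cons]; omega)]

/-- Homogeneous operations with the same values are equal. -/
theorem ext_evalList {n : ℕ} {z z' : Operations R B X}
    (hz : z ∈ LinearMap.range
      (DirectSum.lof R ℕ (fun n => MultilinearMap R (fun _ : Fin n => B) X) n))
    (hz' : z' ∈ LinearMap.range
      (DirectSum.lof R ℕ (fun n => MultilinearMap R (fun _ : Fin n => B) X) n))
    (h : ∀ b : List B, b.length = n → evalList z b = evalList z' b) : z = z' := by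
  obtain ⟨y, rfl⟩ := hz
  obtain ⟨y', rfl⟩ := hz'
  congr 1
  ext b
  have := h (List.ofFn b) (List.length_ofFn)
  rw [evalList_lof_of_eq _ (List.length_ofFn), evalList_lof_of_eq _ (List.length_ofFn)] at this
  simpa using this

theorem ext_evalAt {n : ℕ} {z z' : ⨁ n, EndB R B n}
    (hz : z ∈ LinearMap.range (DirectSum.lof R ℕ (EndB R B) n))
    (hz' : z' ∈ LinearMap.range (DirectSum.lof R ℕ (EndB R B) n))
    (h : ∀ b : List B, b.length = n → evalAt z b = evalAt z' b) : z = z' :=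
  ext_evalList hz hz' h

variable {A : Type*} [AddCommGroup A] [Module R A]

/-- Operations obtained from actions of `A` and `B` on `X`: a word is sent to the operation which
replaces the letters `*` by its arguments and lets the result act on `x₀`. -/
def wordOperation (lA : A →ₗ[R] Module.End R X) (lB : B →ₗ[R] Module.End R X) (x₀ : X) :
    Words R A →ₗ[R] Operations R B X :=
  wordAction (LinearMap.coprod
    { toFun := fun a => postcomp (lA a)
      map_add' := fun a a' => by
        refine LinearMap.ext fun z => DFinsupp.ext fun n => MultilinearMap.ext fun b => ?_
        rw [map_add]
        rfl
      map_smul' := fun r a => by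
        refine LinearMap.ext fun z => DFinsupp.ext fun n => MultilinearMap.ext fun b => ?_
        rw [map_smul]
        rfl }
    (LinearMap.toSpanSingleton R _ (addArgument lB)))
    (DirectSum.lof R ℕ _ 0 (MultilinearMap.constOfIsEmpty R _ x₀))

/-- The action of a list of elements of `A` and `B` on `x₀`. -/
def listAction (lA : A →ₗ[R] Module.End R X) (lB : B →ₗ[R] Module.End R X) (x₀ : X) :
    List (A ⊕ B) → X
  | [] => x₀
  | .inl a :: L => lA a (listAction lA lB x₀ L)
  | .inr b :: L => lB b (listAction lA lB x₀ L)

theorem evalList_wordOperation (lA : A →ₗ[R] Module.End R X) (lB : B →ₗ[R] Module.End R X) (x₀ : X)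
    (L : List (A ⊕ B)) (hL : L ≠ []) :
    evalList (wordOperation lA lB x₀ (word R (shape L))) (inputs L) = listAction lA lB x₀ L := by
  rw [wordOperation, wordAction_word _ _ _ (by simpa [shape] using hL)]
  clear hL
  induction L with
  | nil => exact evalList_lof [] _
  | cons y L ih =>
    rcases y with a | b
    · rw [listAction, ← ih, ← evalList_postcomp]
      have h : ∀ z : Operations R B X, (LinearMap.toSpanSingleton R (Module.End R
          (Operations R B X)) (addArgument lB) (0 : R)) z = 0 := fun z => by
        rw [map_zero, LinearMap.zero_apply]
      simp only [shape, List.map_cons, Sum.elim_inl, List.foldr_cons, letter,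
        LinearMap.coprod_apply, LinearMap.add_apply, h, add_zero]
      rfl
    · rw [listAction, ← ih]
      simp only [shape, List.map_cons, Sum.elim_inr, List.foldr_cons, letter,
        LinearMap.coprod_apply, map_zero, zero_add, LinearMap.toSpanSingleton_apply, one_smul]
      exact evalList_addArgument lB _ b _

theorem wordOperation_mem_range (lA : A →ₗ[R] Module.End R X) (lB : B →ₗ[R] Module.End R X)
    (x₀ : X) (w : List (Option A)) : wordOperation lA lB x₀ (word R w) ∈ LinearMap.range
      (DirectSum.lof R ℕ (fun n => MultilinearMap R (fun _ : Fin n => B) X)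
        (w.countP Option.isNone)) := by
  by_cases hw : w = []
  · rw [hw, word, map_zero]
    exact Submodule.zero_mem _
  rw [wordOperation, wordAction_word _ _ _ hw]
  clear hw
  induction w with
  | nil => exact ⟨_, rfl⟩
  | cons x w ih =>
    obtain ⟨y, hy⟩ := ih
    rw [List.foldr_cons, ← hy]
    rcases x with _ | a
    · rw [List.countP_cons_of_pos (by rfl)]
      refine ⟨addArgumentAt lB _ y, ?_⟩
      simp only [letter, LinearMap.coprod_apply, map_zero, zero_add,
        LinearMap.toSpanSingleton_apply, one_smul]
      exact (addArgument_lof lB _ y).symm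
    · rw [List.countP_cons_of_neg (by simp)]
      refine ⟨(lA a).compMultilinearMapₗ R y, ?_⟩
      have h : (LinearMap.toSpanSingleton R (Module.End R
          (Operations R B X)) (addArgument lB) (0 : R)) = 0 := map_zero _
      simp only [letter, LinearMap.coprod_apply, h, add_zero]
      exact (postcomp_lof (lA a) _ y).symm

end Operations

end

section

/-! ### The moment morphism -/

section ListProd

variable {M : Type*} [NonUnitalRing M]

@[simp] theorem listProd_singleton (x : M) : listProd [x] = x := rfl

theorem listProd_cons (x : M) (l : List M) (hl : l ≠ []) :
    listProd (x :: l) = x * listProd l := by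
  obtain ⟨y, l, rfl⟩ := List.exists_cons_of_ne_nil hl
  change l.foldl (· * ·) (x * y) = x * l.foldl (· * ·) y
  induction l generalizing y with
  | nil => rfl
  | cons z l ih => rw [List.foldl_cons, List.foldl_cons, mul_assoc, ih _ (List.cons_ne_nil _ _)]

end ListProd

namespace OpValuedProbSpace

variable {R : Type u} {B : Type v} {A : Type w} [CommRing R]
  [NonUnitalRing B] [Module R B] [IsScalarTower R B B] [SMulCommClass R B B]
  [NonUnitalRing A] [Module R A] [IsScalarTower R A A] [SMulCommClass R A A]
  (P : OpValuedProbSpace R B A)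

/-- Left multiplication by elements of `A` on `R ⊕ B ⊕ A`. -/
def mulLeftA : A →ₗ[R] Module.End R (R × B × A) :=
  LinearMap.mk₂ R (fun a x => (0, 0, x.1 • a + P.ract a x.2.1 + a * x.2.2))
    (fun a a' x => by
      simp only [Prod.mk_add_mk, add_zero, smul_add, map_add, LinearMap.add_apply, add_mul]
      congr 2; abel)
    (fun r a x => by
      simp only [Prod.smul_mk, smul_zero, smul_add, map_smul, LinearMap.smul_apply,
        smul_mul_assoc, smul_comm r])
    (fun a x y => by
      simp only [Prod.fst_add, Prod.snd_add, Prod.mk_add_mk, add_zero, add_smul, map_add, mul_add]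
      congr 2; abel)
    (fun r a x => by
      simp only [Prod.smul_fst, Prod.smul_snd, Prod.smul_mk, smul_zero, smul_add, map_smul,
        mul_smul_comm, smul_assoc])

/-- Left multiplication by elements of `B` on `R ⊕ B ⊕ A`. -/
def mulLeftB : B →ₗ[R] Module.End R (R × B × A) :=
  LinearMap.mk₂ R (fun b x => (0, x.1 • b + b * x.2.1, P.lact b x.2.2))
    (fun b b' x => by
      simp only [Prod.mk_add_mk, add_zero, smul_add, map_add, LinearMap.add_apply, add_mul]
      congr 2; abel)
    (fun r b x => by
      simp only [Prod.smul_mk, smul_zero, smul_add, map_smul, LinearMap.smul_apply,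
        smul_mul_assoc, smul_comm r])
    (fun b x y => by
      simp only [Prod.fst_add, Prod.snd_add, Prod.mk_add_mk, add_zero, add_smul, map_add, mul_add]
      congr 2; abel)
    (fun r b x => by
      simp only [Prod.smul_fst, Prod.smul_snd, Prod.smul_mk, smul_zero, smul_add, map_smul,
        mul_smul_comm, smul_assoc])

/-- The expectation, extended to `R ⊕ B ⊕ A`. -/
def expectation : R × B × A →ₗ[R] B :=
  LinearMap.coprod 0 (LinearMap.coprod LinearMap.id P.E)

/-- The product of a list of elements of `A` and `B`, in `R ⊕ B ⊕ A`. -/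
def mixedProd (L : List (A ⊕ B)) : R × B × A :=
  listAction P.mulLeftA P.mulLeftB (1, 0, 0) L

@[simp] theorem mixedProd_nil : P.mixedProd [] = (1, 0, 0) := rfl

theorem mixedProd_inl (a : A) (L : List (A ⊕ B)) : P.mixedProd (.inl a :: L)
    = (0, 0, (P.mixedProd L).1 • a + P.ract a (P.mixedProd L).2.1 + a * (P.mixedProd L).2.2) := rfl

theorem mixedProd_inr (b : B) (L : List (A ⊕ B)) : P.mixedProd (.inr b :: L)
    = (0, (P.mixedProd L).1 • b + b * (P.mixedProd L).2.1, P.lact b (P.mixedProd L).2.2) := rfl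

theorem foldl_ract (a : A) (bs : List B) (h : bs ≠ []) :
    bs.foldl (fun a b => P.ract a b) a = P.ract a (listProd bs) := by
  obtain ⟨b, bs, rfl⟩ := List.exists_cons_of_ne_nil h
  clear h
  induction bs generalizing a b with
  | nil => rfl
  | cons c bs ih =>
    rw [List.foldl_cons, ih, P.ract_ract, listProd_cons b _ (List.cons_ne_nil _ _)]

theorem foldl_ract_mul (a a' : A) (bs : List B) :
    bs.foldl (fun a b => P.ract a b) a * a' = a * bs.foldr (fun b a => P.lact b a) a' := by
  induction bs generalizing a with
  | nil => rfl
  | cons b bs ih => rw [List.foldl_cons, ih, P.mul_balanced, List.foldr_cons]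

theorem listProd_foldr_lact (bs : List B) (a : A) (as : List A) :
    listProd (bs.foldr (fun b a => P.lact b a) a :: as)
      = bs.foldr (fun b a => P.lact b a) (listProd (a :: as)) := by
  by_cases h : as = []
  · subst h; rfl
  rw [listProd_cons _ _ h, listProd_cons _ _ h]
  induction bs with
  | nil => rfl
  | cons b bs ih => rw [List.foldr_cons, List.foldr_cons, ← ih, P.lact_mul]

theorem mixedProd_eq (L : List (A ⊕ B)) : P.mixedProd L = match P.contract L with
    | ([], []) => (1, 0, 0)
    | (b :: bs, []) => (0, listProd (b :: bs), 0)
    | (bs, a :: as) => (0, 0, bs.foldr (fun b a => P.lact b a) (listProd (a :: as))) := by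
  induction L with
  | nil => rfl
  | cons y L ih =>
    rcases h : P.contract L with ⟨_ | ⟨b', bs⟩, _ | ⟨a', as⟩⟩ <;> rw [h] at ih <;>
      rcases y with a | b
    · rw [mixedProd_inl, ih]; simp [contract, h]
    · rw [mixedProd_inr, ih]; simp [contract, h]
    · rw [mixedProd_inl, ih]; simp [contract, h, listProd_cons a]
    · rw [mixedProd_inr, ih]; simp [contract, h]
    · rw [mixedProd_inl, ih]; simp [contract, h, ← foldl_ract, List.foldl_cons]
    · rw [mixedProd_inr, ih]; simp [contract, h, listProd_cons b]
    · rw [mixedProd_inl, ih]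
      simp only [contract, h, zero_smul, zero_add, map_zero]
      rw [← P.foldl_ract_mul, ← listProd_cons _ _ (List.cons_ne_nil _ _)]
      rfl
    · rw [mixedProd_inr, ih]; simp [contract, h]

theorem moment_eq (L : List (A ⊕ B)) : P.moment L = P.expectation (P.mixedProd L) := by
  rw [mixedProd_eq, moment]
  rcases h : P.contract L with ⟨_ | ⟨b', bs⟩, _ | ⟨a', as⟩⟩
  · simp [expectation, listProd]
  · simp [expectation, insertion, h]
  · simp [expectation, P.E_incl]
  · simp only [expectation, insertion, h, P.listProd_foldr_lact]
    simp

/-- The linear map on words given by the moments, which sends `*` to the identity of `B`. -/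
def momentMap : Words R A →ₗ[R] ⨁ n, EndB R B n :=
  postcomp P.expectation ∘ₗ wordOperation P.mulLeftA P.mulLeftB (1, 0, 0)

theorem evalAt_momentMap (L : List (A ⊕ B)) (hL : L ≠ []) :
    evalAt (P.momentMap (word R (shape L))) (inputs L) = P.moment L := by
  rw [P.moment_eq, mixedProd, ← evalList_wordOperation _ _ _ _ hL, ← evalList_postcomp]
  rfl

theorem momentMap_mem_range (w : List (Option A)) : P.momentMap (word R w) ∈
    LinearMap.range (DirectSum.lof R ℕ (EndB R B) (w.countP Option.isNone)) := by
  obtain ⟨y, hy⟩ := wordOperation_mem_range P.mulLeftA P.mulLeftB ((1 : R), (0 : B), (0 : A)) w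
  refine ⟨P.expectation.compMultilinearMapₗ R y, ?_⟩
  rw [momentMap, LinearMap.comp_apply, ← hy, postcomp_lof]

theorem momentMap_coaug : P.momentMap (word R [none])
    = DirectSum.lof R ℕ (EndB R B) 1 (MultilinearMap.ofSubsingleton R B B 0 LinearMap.id) := by
  refine ext_evalAt (P.momentMap_mem_range [none]) ⟨_, rfl⟩ fun bs hb => ?_
  obtain ⟨b, rfl⟩ := List.length_eq_one_iff.1 hb
  have h := P.evalAt_momentMap [.inr b] (List.cons_ne_nil _ _)
  have h' : P.moment [.inr b] = b := by simp [moment_eq, mixedProd_inr, expectation]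
  rw [h'] at h
  refine h.trans (Eq.symm ?_)
  exact evalList_lof [b] _

/-- A list of elements of `A` and `B` with a given shape and given inputs. -/
theorem _root_.OperadicCumulants.exists_shape_inputs {A : Type*} {B : Type*}
    (w : List (Option A)) (b : List B)
    (h : b.length = w.countP Option.isNone) : ∃ L : List (A ⊕ B), shape L = w ∧ inputs L = b := by
  induction w generalizing b with
  | nil =>
    exact ⟨[], rfl, (List.eq_nil_of_length_eq_zero h).symm⟩
  | cons x w ih =>
    rcases x with _ | a
    · rw [List.countP_cons_of_pos (by rfl)] at h
      obtain ⟨b, bs, rfl⟩ := List.exists_cons_of_length_eq_add_one h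
      obtain ⟨L, hL, hL'⟩ := ih bs (by simpa using h)
      exact ⟨.inr b :: L, by simp [shape, ← hL], by simp [inputs, ← hL']⟩
    · rw [List.countP_cons_of_neg (by simp)] at h
      obtain ⟨L, hL, hL'⟩ := ih b h
      exact ⟨.inl a :: L, by simp [shape, ← hL], hL'⟩

end OpValuedProbSpace

end

/-! ### Existence and uniqueness of the moment morphism -/

section

section TreeModel

variable {R : Type u} [CommRing R] {V : ℕ → Type w} [∀ n, AddCommGroup (V n)]
  [∀ n, Module R (V n)] {D : Type x} [AddCommGroup D] [Module R D]
  {T : CooperadData R D} {g : ∀ n, V n →ₗ[R] MultilinearMap R (fun _ : Fin n => D) D}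
  {π : D →ₗ[R] ⨁ n, V n}

theorem IsTreeModel.proj_mem_range (hT : IsTreeModel T g π) {n : ℕ} {t : D} (ht : t ∈ T.arity n) :
    π t ∈ LinearMap.range (DirectSum.lof R ℕ V n) := by
  have hS := hT.isConilpotentCooperad
  rw [hT.arity_eq] at ht
  refine (Submodule.span_le.2 ?_ : _ ≤ (LinearMap.range (DirectSum.lof R ℕ V n)).comap π) ht
  rintro t ⟨k, ht⟩
  rw [SetLike.mem_coe, Submodule.mem_comap]
  cases ht with
  | trivial => rw [hT.proj_coaug]; exact Submodule.zero_mem _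
  | graft m y p q t h =>
    rw [hT.proj_graft]
    by_cases hp : ∀ i, p i = 1
    · have hm : ∑ i, p i = m := by simp [hp]
      rw [hm]
      exact Submodule.smul_mem _ _ ⟨y, rfl⟩
    · push Not at hp
      obtain ⟨i, hi⟩ := hp
      have h₀ : T.counit (t i) = 0 := by
        refine hS.counit_arity _ hi _ ?_
        rw [hT.arity_eq]
        exact Submodule.subset_span ⟨_, h i⟩
      rw [Finset.prod_eq_zero (Finset.mem_univ i) h₀, zero_smul]
      exact Submodule.zero_mem _

end TreeModel

theorem length_inputs {A : Type*} {B : Type*} (L : List (A ⊕ B)) :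
    (inputs L).length = (shape L).countP Option.isNone := by
  induction L with
  | nil => rfl
  | cons y L ih =>
    rcases y with a | b
    · exact ih
    · change (inputs L).length + 1 = _
      rw [ih]
      exact (List.countP_cons_of_pos (p := Option.isNone) (a := (none : Option A)) rfl).symm

namespace OpValuedProbSpace

variable {R : Type u} {B : Type v} {A : Type w} [CommRing R]
  [NonUnitalRing B] [Module R B] [IsScalarTower R B B] [SMulCommClass R B B]
  [NonUnitalRing A] [Module R A] [IsScalarTower R A A] [SMulCommClass R A A]
  (P : OpValuedProbSpace R B A)

omit [IsScalarTower R B B] [SMulCommClass R B B] [IsScalarTower R A A] [SMulCommClass R A A] in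
theorem proj_hom_mem_range {M : Words R A →ₗ[R] DecTrees R (EndB R B)}
    (hM : IsCooperadHom (coAs R A) (cofree R (EndB R B)) M) (w : List (Option A)) :
    corollaPart (M (word R w)) ∈
      LinearMap.range (DirectSum.lof R ℕ (EndB R B) (w.countP Option.isNone)) :=
  (isTreeModel_cofree (R := R) (V := EndB R B)).proj_mem_range
    (hM.map_arity _ _ (Submodule.subset_span ⟨w, rfl, rfl⟩))

omit [IsScalarTower R B B] [SMulCommClass R B B] [IsScalarTower R A A] [SMulCommClass R A A] in
theorem proj_hom_coaug {M : Words R A →ₗ[R] DecTrees R (EndB R B)}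
    (hM : IsCooperadHom (coAs R A) (cofree R (EndB R B)) M) :
    corollaPart (M (word R [none])) = 0 := by
  have h : M (word R [none]) = (cofree R (EndB R B)).coaug := hM.map_coaug
  rw [h]
  exact (isTreeModel_cofree (R := R) (V := EndB R B)).proj_coaug

theorem IsMomentMorphism.proj_eq {M : Words R A →ₗ[R] DecTrees R (EndB R B)}
    {P : OpValuedProbSpace R B A} (hM : P.IsMomentMorphism M) {w : List (Option A)}
    (hw : w ≠ [none]) : corollaPart (M (word R w)) = P.momentMap (word R w) := by
  by_cases hw₀ : w = []
  · rw [hw₀, word, map_zero, map_zero, map_zero]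
  refine ext_evalAt (proj_hom_mem_range hM.isHom w) (P.momentMap_mem_range w) fun b hb => ?_
  obtain ⟨L, rfl, rfl⟩ := exists_shape_inputs w b hb
  have hL : L ≠ [] := by rintro rfl; exact hw₀ rfl
  rw [hM.restriction L hL hw, P.evalAt_momentMap L hL]

theorem exists_unique_isMomentMorphism :
    ∃! M : Words R A →ₗ[R] DecTrees R (EndB R B), P.IsMomentMorphism M := by
  have hT := isTreeModel_cofree (R := R) (V := EndB R B)
  have hS := (isWordModel_coAs (R := R) (A := A)).isConilpotentCooperad
  set e := DirectSum.lof R ℕ (EndB R B) 1 (MultilinearMap.ofSubsingleton R B B 0 LinearMap.id)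
    with he
  obtain ⟨M, hM, h⟩ := hT.exists_hom hS
    (f := P.momentMap - LinearMap.toSpanSingleton R _ e ∘ₗ (coAs R A).counit) (by
      rw [LinearMap.sub_apply, LinearMap.comp_apply, hS.counit_coaug,
        LinearMap.toSpanSingleton_apply, one_smul]
      exact sub_eq_zero_of_eq P.momentMap_coaug) (fun n c hc => by
      have h₁ : P.momentMap c ∈ LinearMap.range (DirectSum.lof R ℕ (EndB R B) n) := by
        refine (Submodule.span_le.2 ?_ : _ ≤
          (LinearMap.range (DirectSum.lof R ℕ (EndB R B) n)).comap P.momentMap) hc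
        rintro _ ⟨w, rfl, rfl⟩
        exact P.momentMap_mem_range w
      have h₂ : (coAs R A).counit c • e ∈ LinearMap.range (DirectSum.lof R ℕ (EndB R B) n) := by
        by_cases hn : n = 1
        · subst hn
          exact Submodule.smul_mem _ _ ⟨_, rfl⟩
        · rw [hS.counit_arity n hn c hc, zero_smul]
          exact Submodule.zero_mem _
      obtain ⟨y, hy⟩ := Submodule.sub_mem _ h₁ h₂
      exact ⟨y, hy.symm⟩)
  have hMM : P.IsMomentMorphism M := by
    refine ⟨hM, fun L hL hL' => ?_⟩
    have h₀ : (coAs R A).counit (word R (shape L)) = 0 := by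
      classical
      rw [counit_word, if_neg hL']
    rw [h, LinearMap.sub_apply, LinearMap.comp_apply, h₀, map_zero, sub_zero,
      P.evalAt_momentMap L hL]
  refine ⟨M, hMM, fun M' hM' => ?_⟩
  refine hT.hom_ext hT.counit_left hS hM'.isHom hM (isWordModel_coAs.linearMap_ext fun w hw => ?_)
  rw [LinearMap.comp_apply, LinearMap.comp_apply]
  by_cases hw' : w = [none]
  · rw [hw', proj_hom_coaug hM, proj_hom_coaug hM'.isHom]
  · rw [hM'.proj_eq hw', hMM.proj_eq hw']

end OpValuedProbSpace

end

section

/-! ### The cumulant morphism and the moments -/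

section Evaluation

theorem getElem?_flatten {α : Type*} (L : List (List α)) (i : ℕ) (hi : i < L.length) (j : ℕ)
    (hj : j < L[i].length) : L.flatten[((L.take i).map List.length).sum + j]? = L[i][j]? := by
  induction L generalizing i with
  | nil => simp at hi
  | cons l L ih =>
    rcases i with _ | i
    · simp only [List.getElem_cons_zero] at hj
      simp [List.getElem?_append_left, hj]
    · simp only [List.getElem_cons_succ] at hj
      rw [List.take_succ_cons, List.map_cons, List.sum_cons, List.flatten_cons, add_assoc,
        List.getElem?_append_right (Nat.le_add_right _ _), Nat.add_sub_cancel_left,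
        ih i (by simpa using hi) hj, List.getElem_cons_succ]

theorem flatten_get_finSigmaFinEquiv {α : Type*} {n : ℕ} (c : Fin n → List α)
    (h : (List.ofFn c).flatten.length = ∑ i, (c i).length) (i : Fin n) (j : Fin (c i).length) :
    (List.ofFn c).flatten.get (Fin.cast h.symm (finSigmaFinEquiv ⟨i, j⟩)) = (c i).get j := by
  have h₁ := getElem?_flatten (List.ofFn c) i (by simp) j (by simp)
  have h₂ : (((List.ofFn c).take i).map List.length).sum
      = ∑ k : Fin i, (c (Fin.castLE i.2.le k)).length := by
    rw [← List.sum_ofFn]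
    congr 1
    refine List.ext_getElem (by simp) fun k hk hk' => ?_
    simp
  rw [h₂] at h₁
  rw [List.get_eq_getElem, List.get_eq_getElem, ← Option.some_inj, ← List.getElem?_eq_getElem,
    ← List.getElem?_eq_getElem, Fin.val_cast, finSigmaFinEquiv_apply]
  simpa using h₁

variable {R : Type u} [CommRing R] {B : Type v} [AddCommGroup B] [Module R B]

theorem evalAt_of_eq (x : ⨁ n, EndB R B n) {n : ℕ} {b : List B} (h : b.length = n) :
    evalAt x b = x n fun i => b.get (Fin.cast h.symm i) := by
  subst h; rfl

/-- Composition of operations, evaluated at a concatenation of lists of arguments. -/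
theorem evalAt_plantWith_ofFn (x : ⨁ n, EndB R B n) {n : ℕ} (z : Fin n → ⨁ n, EndB R B n)
    (c : Fin n → List B)
    (h : ∀ i, z i ∈ LinearMap.range (DirectSum.lof R ℕ (EndB R B) (c i).length)) :
    evalAt (plantWith (endGraft R B) x (monomial R (List.ofFn z))) (List.ofFn c).flatten
      = evalAt x (List.ofFn fun i => evalAt (z i) (c i)) := by
  choose y hy using h
  obtain rfl : (fun i => DirectSum.lof R ℕ (EndB R B) (c i).length (y i)) = z := funext hy
  have hlen : (List.ofFn c).flatten.length = ∑ i, (c i).length := by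
    rw [List.length_flatten, List.map_ofFn, List.sum_ofFn]; rfl
  rw [plantWith_ofFn, endGraft_lof, evalAt_of_eq x (List.length_ofFn)]
  refine (evalList_lof_of_eq _ hlen).trans (congrArg (x n) (funext fun i => ?_))
  have h₁ : (List.ofFn fun i => evalAt (DirectSum.lof R ℕ (EndB R B) (c i).length (y i)) (c i)).get
      (Fin.cast (List.length_ofFn).symm i)
      = evalAt (DirectSum.lof R ℕ (EndB R B) (c i).length (y i)) (c i) := by simp
  rw [h₁]
  refine Eq.trans ?_ (evalList_lof (c i) (y i)).symm
  exact congrArg (y i) (funext fun j => flatten_get_finSigmaFinEquiv c hlen i j)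

theorem evalAt_plantWith_map (x : ⨁ n, EndB R B n) {ι : Type*} (l : List ι)
    (z : ι → ⨁ n, EndB R B n) (c : ι → List B)
    (h : ∀ i ∈ l, z i ∈ LinearMap.range (DirectSum.lof R ℕ (EndB R B) (c i).length)) :
    evalAt (plantWith (endGraft R B) x (monomial R (l.map z))) (l.map c).flatten
      = evalAt x (l.map fun i => evalAt (z i) (c i)) := by
  have h₁ : ∀ {β : Type _} (f : ι → β), l.map f = List.ofFn fun i => f (l.get i) := fun f => by
    conv_lhs => rw [← List.ofFn_get l, List.map_ofFn]
    rfl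
  rw [h₁ z, h₁ c, h₁ fun i => evalAt (z i) (c i)]
  exact evalAt_plantWith_ofFn x _ _ fun i => h _ (List.get_mem l i)

end Evaluation

section Cumulants

variable {R : Type u} [CommRing R] {C : Type v} [AddCommGroup C] [Module R C]
  {V : ℕ → Type w} [∀ n, AddCommGroup (V n)]
  [∀ n, Module R (V n)] {D : Type x} [AddCommGroup D] [Module R D]
  {S : CooperadData R C} {T : CooperadData R D}
  {g : ∀ n, V n →ₗ[R] MultilinearMap R (fun _ : Fin n => D) D}
  {π : D →ₗ[R] ⨁ n, V n} {γ : D →ₗ[R] ⨁ n, V n} {e : V 1}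
  {op : ∀ n, V n →ₗ[R] MultilinearMap R (fun _ : Fin n => ⨁ k, V k) (⨁ k, V k)}

/-- The composition of trees turns the expression of a morphism through its linear restriction
into a recursion for the composite. -/
theorem IsTreeModel.comp_hom (hT : IsTreeModel T g π) (hγ₀ : γ T.coaug = DirectSum.lof R ℕ V 1 e)
    (hγ : ∀ n y t, γ (g n y t) = op n y fun i => γ (t i)) {K : C →ₗ[R] D}
    (hK : IsCooperadHom S T K) (c : C) :
    γ (K c) = S.counit c • DirectSum.lof R ℕ V 1 e
      + TensorProduct.lift (plantWith op)
        (TensorProduct.map (π ∘ₗ K) (tensorMap (γ ∘ₗ K)).toLinearMap (S.decomp c)) := by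
  have h : γ ∘ₗ TensorProduct.lift (plantWith g) ∘ₗ
      TensorProduct.map (π ∘ₗ K) (tensorMap K).toLinearMap
      = TensorProduct.lift (plantWith op) ∘ₗ
        TensorProduct.map (π ∘ₗ K) (tensorMap (γ ∘ₗ K)).toLinearMap := by
    refine TensorProduct.ext' fun c q => ?_
    have hq : tensorMap γ (tensorMap K q) = tensorMap (γ ∘ₗ K) q := by
      have : (tensorMap γ).comp (tensorMap K) = tensorMap (γ ∘ₗ K) := by
        ext c; simp
      rw [← this]; rfl
    simp only [LinearMap.comp_apply, TensorProduct.map_tmul, TensorProduct.lift.tmul,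
      AlgHom.toLinearMap_apply]
    rw [map_plantWith hγ, hq]
  conv_lhs => rw [hT.hom_apply hT.counit_left hK, extendStep_apply, map_add, map_smul, hγ₀]
  rw [← LinearMap.comp_apply, ← LinearMap.comp_apply, LinearMap.comp_assoc, h]
  rfl

end Cumulants

namespace OpValuedProbSpace

variable {R : Type u} {B : Type v} {A : Type w} [CommRing R]
  [NonUnitalRing B] [Module R B] [IsScalarTower R B B] [SMulCommClass R B B]
  [NonUnitalRing A] [Module R A] [IsScalarTower R A A] [SMulCommClass R A A]
  (P : OpValuedProbSpace R B A)

/-- As `Φ` has the composition of trees as its linear restriction, composing the trees in the values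
of the free cumulant morphism gives the moments. -/
theorem treeComposition_comp {M K : Words R A →ₗ[R] DecTrees R (EndB R B)}
    {Φ : DecTrees R (EndB R B) →ₗ[R] DecTrees R (EndB R B)} (hM : P.IsMomentMorphism M)
    (hΦ : IsCanonicalTwist R B Φ) (hK : IsCooperadHom (coAs R A) (cofree R (EndB R B)) K)
    (h : Φ ∘ₗ K = M) : treeComposition R B ∘ₗ K = P.momentMap := by
  classical
  have hT := isTreeModel_cofree (R := R) (V := EndB R B)
  refine isWordModel_coAs.linearMap_ext fun w hw => ?_
  rw [LinearMap.comp_apply]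
  by_cases hw' : w = [none]
  · have hc : K (word R [none]) = (cofree R (EndB R B)).coaug := hK.map_coaug
    rw [hw', hc, P.momentMap_coaug]
    exact fold_trivialTree _ _
  · have hc : (cofree R (EndB R B)).counit (K (word R w)) = 0 := by
      rw [hK.map_counit, counit_word, if_neg hw']
    rw [← hΦ.restriction _ hc, ← hM.proj_eq hw', ← h, LinearMap.comp_apply]

/-- The list obtained from a list of tokens by replacing the pieces by their moments. -/
def lowerMoments (t : List ((A ⊕ B) ⊕ List (A ⊕ B))) : List (A ⊕ B) :=
  t.map (Sum.elim id fun a => .inr (P.moment a))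

/-- The lower word and the pieces of a factorization, with their inputs, for a list of elements of
`A` and `B` in place of a word. -/
theorem tokens_inputs (t : List ((A ⊕ B) ⊕ List (A ⊕ B))) (ht : IsTokenList Sum.isLeft t) :
    lower (t.map (Sum.map (Sum.elim some fun _ => none)
        (List.map (Sum.elim some fun _ => none)))) = shape (P.lowerMoments t) ∧
    pieces (t.map (Sum.map (Sum.elim some fun _ => none)
        (List.map (Sum.elim some fun _ => none)))) = (pieces t).map shape ∧
    inputs (P.lowerMoments t) = (pieces t).map P.moment ∧
    ((pieces t).map inputs).flatten = inputs (tokenLetters t) := by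
  induction t with
  | nil => simp [lower, shape, pieces, inputs, lowerMoments, tokenLetters]
  | cons y t ih =>
    rw [isTokenList_cons] at ht
    obtain ⟨h₁, h₂, h₃, h₄⟩ := ih ht.2
    simp only [lower, shape, inputs, lowerMoments] at h₁ h₂ h₃ h₄ ⊢
    rcases y with (a | b) | a
    · simp only [List.map_cons, pieces, tokenLetters, Sum.map_inl, Sum.elim_inl, id, h₁, h₂]
      exact ⟨trivial, trivial, h₃, h₄⟩
    · simp at ht
    · simp only [List.map_cons, pieces, tokenLetters, Sum.map_inr, Sum.elim_inr, h₁, h₂,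
        List.flatten_cons, h₄, List.filterMap_append]
      exact ⟨trivial, rfl, congrArg _ h₃, rfl⟩

/-- The moments expressed through the values of the linear restriction of the free cumulant
morphism. -/
theorem moment_eq_tokSum {K : Words R A →ₗ[R] DecTrees R (EndB R B)}
    (hK : IsCooperadHom (coAs R A) (cofree R (EndB R B)) K)
    (h : treeComposition R B ∘ₗ K = P.momentMap) (L : List (A ⊕ B)) (hL : L ≠ [])
    (hL' : shape L ≠ [none]) :
    P.moment L = tokSum Sum.isLeft L fun t =>
      evalAt (corollaPart (K (word R (shape (P.lowerMoments t))))) (inputs (P.lowerMoments t)) := by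
  classical
  have hne : shape L ≠ [] := by simpa [shape] using hL
  have h₀ := (isTreeModel_cofree (R := R) (V := EndB R B)).comp_hom
    (γ := treeComposition R B) (op := endGraft R B) (fold_trivialTree _ _)
    (fun n y t => fold_graft _ _ n y t) hK (word R (shape L))
  rw [counit_word, if_neg hL', zero_smul, zero_add, h, ← LinearMap.comp_apply, h] at h₀
  rw [← P.evalAt_momentMap L hL, h₀]
  have h₁ : (coAs R A).decomp (word R (shape L)) = tokSum Sum.isLeft L fun t =>
      word R (shape (P.lowerMoments t)) ⊗ₜ[R]
        monomial R ((pieces t).map fun a => word R (shape a)) := by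
    rw [isWordModel_coAs.decomp_word _ hne, shape, tokSum_map Sum.isLeft]
    · refine tokSum_congr _ _ fun t ht => ?_
      obtain ⟨e₁, e₂, -, -⟩ := P.tokens_inputs t (isTokenList_of_mem ht)
      rw [e₁, e₂, List.map_map]
      rfl
    · rintro (a | b) _ <;> rfl
  rw [h₁, map_tokSum, map_tokSum]
  have h₂ : ∀ z z' : ⨁ n, EndB R B n, evalAt (z + z') (inputs L)
      = evalAt z (inputs L) + evalAt z' (inputs L) := fun z z' => evalList_add z z' _
  refine (map_tokSum Sum.isLeft (AddMonoidHom.mk' (fun z => evalAt z (inputs L)) h₂) L _).trans ?_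
  refine tokSum_congr _ _ fun t ht => ?_
  obtain ⟨-, -, e₃, e₄⟩ := P.tokens_inputs t (isTokenList_of_mem ht)
  rw [AddMonoidHom.mk'_apply, TensorProduct.map_tmul, TensorProduct.lift.tmul,
    AlgHom.toLinearMap_apply, tensorMap_monomial, List.map_map, ← tokenLetters_of_mem ht, ← e₄, e₃,
    LinearMap.comp_apply]
  refine (evalAt_plantWith_map _ (pieces t) _ inputs fun a _ => ?_).trans ?_
  · rw [length_inputs]
    exact P.momentMap_mem_range _
  · refine congrArg _ (List.map_congr_left fun a ha => ?_)
    exact P.evalAt_momentMap a (ne_nil_of_mem_pieces (isTokenList_of_mem ht) ha)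

end OpValuedProbSpace

end

section

/-! ### Moments of mixed lists -/

/-- `(-1)ⁿ b₁ ⋯ bₙ` for a nonempty list `b₁, …, bₙ` of elements of `B`, and zero for other lists. -/
def signedProd {A B : Type*} [NonUnitalRing B] : List (A ⊕ B) → B
  | [] => 0
  | [.inr b] => -b
  | .inl _ :: _ => 0
  | .inr b :: x :: L => -(b * signedProd (x :: L))

theorem signedProd_inr_cons {A B : Type*} [NonUnitalRing B] (b : B) (L : List (A ⊕ B))
    (hL : L ≠ []) : signedProd (.inr b :: L) = -(b * signedProd L) := by
  obtain ⟨x, L, rfl⟩ := List.exists_cons_of_ne_nil hL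
  rw [signedProd]

namespace OpValuedProbSpace

variable {R : Type u} {B : Type v} {A : Type w} [CommRing R]
  [NonUnitalRing B] [Module R B] [IsScalarTower R B B] [SMulCommClass R B B]
  [NonUnitalRing A] [Module R A] [IsScalarTower R A A] [SMulCommClass R A A]
  (P : OpValuedProbSpace R B A)

theorem mixedProd_fst (L : List (A ⊕ B)) (hL : L ≠ []) : (P.mixedProd L).1 = 0 := by
  obtain ⟨y, L, rfl⟩ := List.exists_cons_of_ne_nil hL
  rcases y with a | b <;> rfl

@[simp] theorem moment_inr_singleton (b : B) : P.moment [.inr b] = b := by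
  simp [moment_eq, mixedProd_inr, expectation]

theorem moment_inr_cons (b : B) (L : List (A ⊕ B)) (hL : L ≠ []) :
    P.moment (.inr b :: L) = b * P.moment L := by
  simp [moment_eq, mixedProd_inr, expectation, P.mixedProd_fst L hL, P.E_lact, mul_add]

theorem mixedProd_append_inr (L : List (A ⊕ B)) (b : B) : P.mixedProd (L ++ [.inr b])
    = (0, (P.mixedProd L).1 • b + (P.mixedProd L).2.1 * b, P.ract (P.mixedProd L).2.2 b) := by
  induction L with
  | nil => simp [mixedProd_inr]
  | cons y L ih =>
    rcases y with a | c
    · simp [mixedProd_inl, ih, P.ract_ract, P.mul_ract]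
    · simp [mixedProd_inr, ih, P.lact_ract, add_mul, mul_add, mul_assoc, mul_smul_comm,
        smul_mul_assoc]

theorem moment_append_inr (L : List (A ⊕ B)) (b : B) (hL : L ≠ []) :
    P.moment (L ++ [.inr b]) = P.moment L * b := by
  simp [moment_eq, mixedProd_append_inr, expectation, P.mixedProd_fst L hL, P.E_ract, add_mul]

theorem mixedProd_contract (L₁ L₂ : List (A ⊕ B)) (a : A) (b : B) :
    P.mixedProd (L₁ ++ .inl a :: .inr b :: L₂) = P.mixedProd (L₁ ++ .inl (P.ract a b) :: L₂) := by
  induction L₁ with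
  | nil => simp [mixedProd_inl, mixedProd_inr, P.ract_ract, P.mul_balanced]
  | cons y L₁ ih =>
    rw [List.cons_append, List.cons_append]
    rcases y with c | c
    · rw [mixedProd_inl, ih, mixedProd_inl]
    · rw [mixedProd_inr, ih, mixedProd_inr]

theorem moment_contract (L₁ L₂ : List (A ⊕ B)) (a : A) (b : B) :
    P.moment (L₁ ++ .inl a :: .inr b :: L₂) = P.moment (L₁ ++ .inl (P.ract a b) :: L₂) := by
  rw [moment_eq, mixedProd_contract, ← moment_eq]

/-! ### The signed sum over cuts into pieces -/

/-- The sum of `(-1)ⁿ m(p₁) ⋯ m(pₙ)` over the ways to cut `p ++ L` into nonempty lists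
`p₁, …, pₙ`, the first of which begins with `p`. -/
def cutSum : List (A ⊕ B) → List (A ⊕ B) → B
  | p, [] => -P.moment p
  | p, x :: L => cutSum (p ++ [x]) L - P.moment p * cutSum [x] L

theorem cutSum_congr (L p p' : List (A ⊕ B)) (h : ∀ q, P.moment (p ++ q) = P.moment (p' ++ q)) :
    P.cutSum p L = P.cutSum p' L := by
  induction L generalizing p p' with
  | nil => simpa [cutSum] using h []
  | cons x L ih =>
    have h₀ : P.moment p = P.moment p' := by simpa using h []
    rw [cutSum, cutSum, h₀, ih (p ++ [x]) (p' ++ [x]) fun q => by simpa using h (x :: q)]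

theorem cutSum_inr_cons (b : B) (p L : List (A ⊕ B)) (hp : p ≠ []) :
    P.cutSum (.inr b :: p) L = b * P.cutSum p L := by
  induction L generalizing p with
  | nil => rw [cutSum, cutSum, P.moment_inr_cons b p hp, mul_neg]
  | cons x L ih =>
    rw [cutSum, cutSum, List.cons_append, ih _ (by simp), P.moment_inr_cons b p hp, mul_sub,
      mul_assoc]

/-- The cuts with `b` as a piece of its own cancel the cuts in which `b` is a factor of the first
piece. -/
theorem cutSum_inr (b : B) (L : List (A ⊕ B)) (hL : L ≠ []) : P.cutSum [.inr b] L = 0 := by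
  obtain ⟨x, L, rfl⟩ := List.exists_cons_of_ne_nil hL
  rw [cutSum, List.cons_append, List.nil_append, P.cutSum_inr_cons b _ _ (List.cons_ne_nil _ _),
    moment_inr_singleton, sub_self]

/-- The cuts with `b` as the last piece cancel the cuts in which `b` is a factor of the last
piece. -/
theorem cutSum_append_inr (b : B) (p L : List (A ⊕ B)) (hp : p ≠ []) :
    P.cutSum p (L ++ [.inr b]) = 0 := by
  induction L generalizing p with
  | nil =>
    rw [List.nil_append, cutSum, cutSum, cutSum, P.moment_append_inr p b hp, moment_inr_singleton]
    simp
  | cons x L ih => rw [List.cons_append, cutSum, ih _ (by simp), ih _ (by simp), mul_zero, sub_zero]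

theorem cutSum_contract_head (p L : List (A ⊕ B)) (a : A) (b : B) (hL : L ≠ []) :
    P.cutSum (p ++ [.inl a]) (.inr b :: L) = P.cutSum (p ++ [.inl (P.ract a b)]) L := by
  rw [cutSum, P.cutSum_inr b L hL, mul_zero, sub_zero]
  exact P.cutSum_congr _ _ _ fun q => by simpa using P.moment_contract p q a b

/-- A product `a b` in the middle can be contracted: the cuts between `a` and `b` cancel by
`cutSum_inr`. -/
theorem cutSum_contract (p L₁ L₂ : List (A ⊕ B)) (a : A) (b : B) (hL : L₂ ≠ []) :
    P.cutSum p (L₁ ++ .inl a :: .inr b :: L₂) = P.cutSum p (L₁ ++ .inl (P.ract a b) :: L₂) := by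
  induction L₁ generalizing p with
  | nil =>
    have h := P.cutSum_contract_head [] L₂ a b hL
    rw [List.nil_append, List.nil_append] at h
    rw [List.nil_append, List.nil_append, cutSum, cutSum.eq_2 P p (.inl (P.ract a b)),
      P.cutSum_contract_head p L₂ a b hL, h]
  | cons x L₁ ih => rw [List.cons_append, List.cons_append, cutSum, cutSum, ih, ih]

/-! ### The sum over the sublists containing the first element -/

/-- `a` multiplied on the right by the moment of a possibly empty list. -/
def ractMoment (a : A) : List (A ⊕ B) → A
  | [] => a
  | x :: p => P.ract a (P.moment (x :: p))

theorem ractMoment_of_ne_nil (a : A) {p : List (A ⊕ B)} (hp : p ≠ []) :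
    P.ractMoment a p = P.ract a (P.moment p) := by
  obtain ⟨x, p, rfl⟩ := List.exists_cons_of_ne_nil hp
  rfl

/-- The sum over the choices of elements of `A` from `L`, to be the arguments of `f` after the list
`acc` and `a`, with each argument multiplied by the moment of the elements skipped after it.  The
last element of `L` has to be chosen; `gap` is the list of elements skipped since `a`. -/
def chainSum (f : List A → B) : List A → A → List (A ⊕ B) → List (A ⊕ B) → B
  | acc, a, [], [] => f (acc ++ [a])
  | _, _, _ :: _, [] => 0
  | acc, a, gap, .inl a' :: L =>
    chainSum f (acc ++ [P.ractMoment a gap]) a' [] L + chainSum f acc a (gap ++ [.inl a']) L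
  | acc, a, gap, .inr b :: L => chainSum f acc a (gap ++ [.inr b]) L

variable {f : List A → B}

theorem chainSum_nil (acc : List A) (a : A) {gap : List (A ⊕ B)} (h : gap ≠ []) :
    P.chainSum f acc a gap [] = 0 := by
  obtain ⟨x, p, rfl⟩ := List.exists_cons_of_ne_nil h
  rw [chainSum]

theorem chainSum_inl (acc : List A) (a : A) (gap : List (A ⊕ B)) (a' : A) (L : List (A ⊕ B)) :
    P.chainSum f acc a gap (.inl a' :: L) = P.chainSum f (acc ++ [P.ractMoment a gap]) a' [] L
      + P.chainSum f acc a (gap ++ [.inl a']) L := by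
  cases gap <;> rw [chainSum]

theorem chainSum_inr (acc : List A) (a : A) (gap : List (A ⊕ B)) (b : B) (L : List (A ⊕ B)) :
    P.chainSum f acc a gap (.inr b :: L) = P.chainSum f acc a (gap ++ [.inr b]) L := by
  cases gap <;> rw [chainSum]

theorem chainSum_congr (L : List (A ⊕ B)) (acc : List A) (a : A) (p p' : List (A ⊕ B))
    (hp : p ≠ []) (hp' : p' ≠ []) (h : ∀ q, P.moment (p ++ q) = P.moment (p' ++ q)) :
    P.chainSum f acc a p L = P.chainSum f acc a p' L := by
  induction L generalizing acc a p p' with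
  | nil => rw [P.chainSum_nil _ _ hp, P.chainSum_nil _ _ hp']
  | cons x L ih =>
    have h₁ := ih acc a (p ++ [x]) (p' ++ [x]) (by simp) (by simp) fun q => by
      simpa using h (x :: q)
    rcases x with c | c
    · have h₂ : P.moment p = P.moment p' := by simpa using h []
      rw [chainSum_inl, chainSum_inl, h₁, P.ractMoment_of_ne_nil a hp,
        P.ractMoment_of_ne_nil a hp', h₂]
    · rw [chainSum_inr, chainSum_inr, h₁]

theorem ractMoment_inr_cons (a : A) (b : B) (p : List (A ⊕ B)) :
    P.ractMoment a (.inr b :: p) = P.ractMoment (P.ract a b) p := by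
  by_cases hp : p = []
  · subst hp
    simp [ractMoment]
  · rw [P.ractMoment_of_ne_nil _ hp, P.ractMoment_of_ne_nil _ (List.cons_ne_nil _ _),
      P.moment_inr_cons b p hp, P.ract_ract]

theorem chainSum_inr_cons (L : List (A ⊕ B)) (acc : List A) (a : A) (b : B) (p : List (A ⊕ B))
    (h : p ≠ [] ∨ L ≠ []) :
    P.chainSum f acc a (.inr b :: p) L = P.chainSum f acc (P.ract a b) p L := by
  induction L generalizing p with
  | nil =>
    rw [P.chainSum_nil _ _ (List.cons_ne_nil _ _), P.chainSum_nil _ _ (by simpa using h)]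
  | cons x L ih =>
    have h₁ := ih (p ++ [x]) (.inl (by simp))
    rcases x with c | c
    · rw [chainSum_inl, chainSum_inl, List.cons_append, h₁, ractMoment_inr_cons]
    · rw [chainSum_inr, chainSum_inr, List.cons_append, h₁]

theorem chainSum_contract_head (L : List (A ⊕ B)) (acc : List A) (a : A) (b : B) (hL : L ≠ []) :
    P.chainSum f acc a [] (.inr b :: L) = P.chainSum f acc (P.ract a b) [] L := by
  rw [chainSum_inr]
  exact P.chainSum_inr_cons L acc a b [] (.inr hL)

/-- A product `a b` in the middle can be contracted: if `a` is an argument, `b` is a factor of the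
moment after it, and otherwise `a` and `b` are in the same gap. -/
theorem chainSum_contract (L₁ L₂ : List (A ⊕ B)) (acc : List A) (c : A) (gap : List (A ⊕ B))
    (a : A) (b : B) (hL : L₂ ≠ []) : P.chainSum f acc c gap (L₁ ++ .inl a :: .inr b :: L₂)
      = P.chainSum f acc c gap (L₁ ++ .inl (P.ract a b) :: L₂) := by
  induction L₁ generalizing acc c gap with
  | nil =>
    rw [List.nil_append, List.nil_append, chainSum_inl, chainSum_inl,
      P.chainSum_contract_head _ _ _ _ hL, chainSum_inr]
    congr 1
    exact P.chainSum_congr _ _ _ _ _ (by simp) (by simp) fun q => by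
      simpa using P.moment_contract gap q a b
  | cons x L₁ ih =>
    rw [List.cons_append, List.cons_append]
    rcases x with d | d
    · rw [chainSum_inl, chainSum_inl, ih, ih]
    · rw [chainSum_inr, chainSum_inr, ih]

theorem chainSum_append_inr (L : List (A ⊕ B)) (acc : List A) (a : A) (gap : List (A ⊕ B))
    (b : B) : P.chainSum f acc a gap (L ++ [.inr b]) = 0 := by
  induction L generalizing acc a gap with
  | nil => rw [List.nil_append, chainSum_inr, P.chainSum_nil _ _ (by simp)]
  | cons x L ih =>
    rw [List.cons_append]
    rcases x with d | d
    · rw [chainSum_inl, ih, ih, add_zero]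
    · rw [chainSum_inr, ih]

/-! ### The formula for the free cumulants of mixed lists -/

variable (f) in
/-- `f` applied to `acc`, `a` and the elements of `A` in `L`, each multiplied on the right by the
element of `B` after it, if any.  It is zero if `L` ends with an element of `B` or has two
consecutive elements of `B`. -/
def gapValueFrom : List A → A → List (A ⊕ B) → B
  | acc, a, [] => f (acc ++ [a])
  | acc, a, .inl a' :: L => gapValueFrom (acc ++ [a]) a' L
  | acc, a, .inr b :: .inl a' :: L => gapValueFrom (acc ++ [P.ract a b]) a' L
  | _, _, [.inr _] => 0
  | _, _, .inr _ :: .inr _ :: _ => 0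

variable (f) in
/-- `gapValueFrom` for lists starting with an element of `A`, and zero for other lists. -/
def gapValue : List (A ⊕ B) → B
  | .inl a :: L => P.gapValueFrom f [] a L
  | _ => 0

theorem lowerMoments_ne_nil {L : List (A ⊕ B)} (hL : L ≠ []) {t : List ((A ⊕ B) ⊕ List (A ⊕ B))}
    (ht : t ∈ tokens Sum.isLeft L) : P.lowerMoments t ≠ [] := by
  rintro h
  rw [lowerMoments, List.map_eq_nil_iff] at h
  subst h
  exact hL (tokenLetters_of_mem ht).symm

theorem lowerMoments_inr (p : List (A ⊕ B)) (t : List ((A ⊕ B) ⊕ List (A ⊕ B))) :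
    P.lowerMoments (.inr p :: t) = .inr (P.moment p) :: P.lowerMoments t := rfl

theorem lowerMoments_inl (x : A ⊕ B) (t : List ((A ⊕ B) ⊕ List (A ⊕ B))) :
    P.lowerMoments (.inl x :: t) = x :: P.lowerMoments t := rfl

theorem tokSum_signedProd_cons (x : A ⊕ B) (L : List (A ⊕ B)) :
    (tokSum Sum.isLeft (x :: L) fun t => signedProd (P.lowerMoments t))
      = openSum Sum.isLeft (x :: L) fun q t =>
        signedProd (.inr (P.moment q) :: P.lowerMoments t) := by
  rw [tokSum_cons]
  have : (if Sum.isLeft x = true then tokSum Sum.isLeft L fun t =>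
      signedProd (P.lowerMoments (.inl x :: t)) else 0) = 0 := by
    rcases x with a | b
    · rw [if_pos Sum.isLeft_inl]
      refine (tokSum_congr _ _ fun t _ => ?_).trans (tokSum_zero _ L)
      rw [lowerMoments_inl, signedProd]
    · rfl
  rw [this, zero_add]
  rfl

/-- A tokenization contributes to the sum of `signedProd` only if all its tokens are pieces; `p` is
the part of the first piece already read. -/
theorem tokSum_signedProd_aux (L : List (A ⊕ B)) (p : List (A ⊕ B)) :
    tokSum Sum.isLeft L (fun t => signedProd (.inr (P.moment p) :: P.lowerMoments t))
      + openSum Sum.isLeft L (fun q t =>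
        signedProd (.inr (P.moment (p ++ q)) :: P.lowerMoments t)) = P.cutSum p L := by
  induction L generalizing p with
  | nil => simp [lowerMoments, signedProd, cutSum]
  | cons x L ih =>
    have h₁ := ih (p ++ [x])
    simp only [List.append_assoc, List.singleton_append] at h₁
    have h₂ := ih [x]
    simp only [List.singleton_append] at h₂
    have h₃ : tokSum Sum.isLeft (x :: L)
        (fun t => signedProd (.inr (P.moment p) :: P.lowerMoments t))
        = AddMonoidHom.mulLeft (-P.moment p)
          (tokSum Sum.isLeft (x :: L) fun t => signedProd (P.lowerMoments t)) := by
      rw [map_tokSum]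
      refine tokSum_congr _ _ fun t ht => ?_
      rw [signedProd_inr_cons _ _ (P.lowerMoments_ne_nil (List.cons_ne_nil _ _) ht)]
      simp
    have h₄ : (tokSum Sum.isLeft (x :: L) fun t => signedProd (P.lowerMoments t))
        = P.cutSum [x] L := by
      rw [tokSum_signedProd_cons, openSum_cons, ← h₂]
    rw [h₃, h₄, openSum_cons, h₁, cutSum]
    rw [AddMonoidHom.coe_mulLeft, neg_mul]
    abel

/-- The contribution of the tokenizations without single letters. -/
theorem tokSum_signedProd (x : A ⊕ B) (L : List (A ⊕ B)) :
    (tokSum Sum.isLeft (x :: L) fun t => signedProd (P.lowerMoments t)) = P.cutSum [x] L := by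
  rw [tokSum_signedProd_cons, openSum_cons, ← P.tokSum_signedProd_aux L [x]]
  rfl

/-- A tokenization contributes to the sum of `gapValue` only if its single elements are the
arguments and its pieces the gaps between them; in the second statement `p` is the part of the gap
already read. -/
theorem tokSum_gapValue_aux (L : List (A ⊕ B)) :
    (∀ acc a, tokSum Sum.isLeft L (fun t => P.gapValueFrom f acc a (P.lowerMoments t))
      = P.chainSum f acc a [] L) ∧
    ∀ acc a p, p ≠ [] → tokSum Sum.isLeft L (fun t =>
        P.gapValueFrom f acc a (.inr (P.moment p) :: P.lowerMoments t))
      + openSum Sum.isLeft L (fun q t =>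
        P.gapValueFrom f acc a (.inr (P.moment (p ++ q)) :: P.lowerMoments t))
      = P.chainSum f acc a p L := by
  induction L with
  | nil =>
    refine ⟨fun acc a => ?_, fun acc a p hp => ?_⟩
    · simp [lowerMoments, gapValueFrom, chainSum]
    · rw [P.chainSum_nil _ _ hp]
      simp [lowerMoments, gapValueFrom]
  | cons x L ih =>
    obtain ⟨ih₁, ih₂⟩ := ih
    have hopen : ∀ acc a p, openSum Sum.isLeft (x :: L) (fun q t =>
        P.gapValueFrom f acc a (.inr (P.moment (p ++ q)) :: P.lowerMoments t))
        = P.chainSum f acc a (p ++ [x]) L := by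
      intro acc a p
      rw [openSum_cons, ← ih₂ acc a (p ++ [x]) (by simp)]
      simp only [List.append_assoc, List.singleton_append]
    constructor
    · intro acc a
      rw [tokSum_cons]
      have h := hopen acc a []
      simp only [List.nil_append] at h
      simp only [lowerMoments_inr, lowerMoments_inl]
      rw [h]
      rcases x with c | c
      · rw [chainSum_inl, if_pos Sum.isLeft_inl]
        simp only [gapValueFrom, ih₁]
        rfl
      · rw [chainSum_inr, if_neg (by simp), zero_add]
        rfl
    · intro acc a p hp
      rw [hopen, tokSum_cons]
      have h₀ : (openSum Sum.isLeft (x :: L) fun q t => P.gapValueFrom f acc a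
          (.inr (P.moment p) :: P.lowerMoments (.inr q :: t))) = 0 := by
        refine (openSum_congr _ _ fun z _ => ?_).trans (openSum_zero _ (x :: L))
        rw [lowerMoments_inr, gapValueFrom]
      rw [h₀, add_zero]
      simp only [lowerMoments_inl]
      rcases x with c | c
      · rw [chainSum_inl, if_pos Sum.isLeft_inl, P.ractMoment_of_ne_nil a hp]
        simp only [gapValueFrom, ih₁]
      · rw [chainSum_inr, if_neg (by simp), zero_add]

theorem tokSum_gapValue_inl (a : A) (L : List (A ⊕ B)) :
    (tokSum Sum.isLeft (.inl a :: L) fun t => P.gapValue f (P.lowerMoments t))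
      = P.chainSum f [] a [] L := by
  have h₀ : (openSum Sum.isLeft (.inl a :: L) fun q t =>
      P.gapValue f (P.lowerMoments (.inr q :: t))) = 0 := by
    refine (openSum_congr _ _ fun z _ => ?_).trans (openSum_zero _ (.inl a :: L))
    rw [lowerMoments_inr, gapValue]
    simp
  rw [tokSum_cons, h₀, add_zero, if_pos Sum.isLeft_inl, ← (P.tokSum_gapValue_aux L).1]
  rfl

theorem tokSum_gapValue_inr (b : B) (L : List (A ⊕ B)) :
    (tokSum Sum.isLeft (.inr b :: L) fun t => P.gapValue f (P.lowerMoments t)) = 0 := by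
  have h₀ : (openSum Sum.isLeft (.inr b :: L) fun q t =>
      P.gapValue f (P.lowerMoments (.inr q :: t))) = 0 := by
    refine (openSum_congr _ _ fun z _ => ?_).trans (openSum_zero _ (.inr b :: L))
    rw [lowerMoments_inr, gapValue]
    simp
  rw [tokSum_cons, h₀, add_zero, if_neg (by simp)]

end OpValuedProbSpace

end

/-! ### The recursion determines the linear restriction -/

section

namespace OpValuedProbSpace

variable {R : Type u} {B : Type v} {A : Type w} [CommRing R]
  [NonUnitalRing B] [Module R B] [IsScalarTower R B B] [SMulCommClass R B B]
  [NonUnitalRing A] [Module R A] [IsScalarTower R A A] [SMulCommClass R A A]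
  (P : OpValuedProbSpace R B A)

/-- The complexity of a list of elements of `A` and `B`, which decreases when some elements are
replaced by their moments or a product of an element of `A` and an element of `B` is contracted. -/
def _root_.OperadicCumulants.weight {A B : Type*} (L : List (A ⊕ B)) : ℕ :=
  L.length + L.countP Sum.isLeft

@[simp] theorem _root_.OperadicCumulants.weight_nil {A B : Type*} :
    weight ([] : List (A ⊕ B)) = 0 := rfl

@[simp] theorem _root_.OperadicCumulants.weight_inl {A B : Type*} (a : A) (L : List (A ⊕ B)) :
    weight (.inl a :: L) = weight L + 2 := by
  rw [weight, List.length_cons, List.countP_cons_of_pos rfl, weight]; omega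

@[simp] theorem _root_.OperadicCumulants.weight_inr {A B : Type*} (b : B) (L : List (A ⊕ B)) :
    weight (.inr b :: L) = weight L + 1 := by
  rw [weight, List.length_cons, List.countP_cons_of_neg (by simp), weight]; omega

@[simp] theorem _root_.OperadicCumulants.weight_append {A B : Type*} (L L' : List (A ⊕ B)) :
    weight (L ++ L') = weight L + weight L' := by
  simp [weight]; omega

theorem _root_.OperadicCumulants.weight_pos {A B : Type*} {L : List (A ⊕ B)} (hL : L ≠ []) :
    0 < weight L := Nat.add_pos_left (List.length_pos_of_ne_nil hL) _

theorem weight_lowerMoments (t : List ((A ⊕ B) ⊕ List (A ⊕ B)))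
    (ht : IsTokenList Sum.isLeft t) : weight (P.lowerMoments t) ≤ weight (tokenLetters t) := by
  induction t with
  | nil => rfl
  | cons y t ih =>
    rw [isTokenList_cons] at ht
    have ih := ih ht.2
    rcases y with x | a
    · rw [lowerMoments_inl, tokenLetters]
      rcases x with c | c
      · simpa using ih
      · simpa using ih
    · have ha := weight_pos ht.1
      rw [lowerMoments_inr, tokenLetters, weight_inr, weight_append]
      omega

/-- All terms in a sum over tokenizations have smaller weight than the list itself, except the term
of the tokenization into single letters. -/
theorem tokSum_lowerMoments (L : List (A ⊕ B)) (δ : List (A ⊕ B) → B)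
    (hδ : ∀ L', weight L' < weight L → δ L' = 0) :
    (tokSum Sum.isLeft L fun t => δ (P.lowerMoments t)) = δ L := by
  induction L generalizing δ with
  | nil => simp [lowerMoments]
  | cons x L ih =>
    have h₁ : (openSum Sum.isLeft L fun q t =>
        δ (.inr (P.moment (x :: q)) :: P.lowerMoments t)) = 0 := by
      refine (openSum_congr _ _ fun z hz => ?_).trans (openSum_zero _ L)
      obtain ⟨hz₁, hz₂, hz₃⟩ := (mem_tokens_aux Sum.isLeft L).2 z hz
      refine hδ _ ?_
      have h₂ := P.weight_lowerMoments _ hz₂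
      have h₃ := weight_pos hz₁
      rw [← hz₃]
      rcases x with a | b <;> simp <;> omega
    rw [tokSum_cons, openSum_cons]
    simp only [lowerMoments_inr, lowerMoments_inl]
    rw [h₁, add_zero]
    rcases x with a | b
    · have h₂ : (tokSum Sum.isLeft L fun t =>
          δ (.inr (P.moment [.inl a]) :: P.lowerMoments t)) = 0 := by
        refine (tokSum_congr _ _ fun t ht => ?_).trans (tokSum_zero _ L)
        have h₃ := P.weight_lowerMoments _ (isTokenList_of_mem ht)
        rw [tokenLetters_of_mem ht] at h₃
        refine hδ _ ?_
        simp; omega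
      rw [h₂, add_zero, if_pos Sum.isLeft_inl]
      exact ih (fun L => δ (.inl a :: L)) fun L' hL' => hδ _ (by simpa using hL')
    · rw [if_neg (by simp), zero_add, moment_inr_singleton]
      exact ih (fun L => δ (.inr b :: L)) fun L' hL' => hδ _ (by simpa using hL')

/-- The element of `B` in a list with one element. -/
def _root_.OperadicCumulants.singleValue {A B : Type*} [Zero B] : List (A ⊕ B) → B
  | [.inr b] => b
  | _ => 0

theorem tokSum_singleValue (L : List (A ⊕ B)) (hL : L ≠ []) :
    (tokSum Sum.isLeft L fun t => singleValue (P.lowerMoments t)) = P.moment L := by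
  classical
  rw [← tokSum_single Sum.isLeft L hL P.moment]
  refine tokSum_congr _ _ fun t ht => ?_
  have h₁ := isTokenList_of_mem ht
  have h₂ := tokenLetters_of_mem ht
  split_ifs with h
  · rw [h]; rfl
  · rcases t with _ | ⟨y, _ | ⟨z, t⟩⟩
    · rfl
    · rcases y with (a | b) | p
      · rfl
      · simp at h₁
      · rw [tokenLetters, tokenLetters, List.append_nil] at h₂
        subst h₂
        exact absurd rfl h
    · simp [lowerMoments, singleValue]

/-- A list which starts and ends with elements of `A` and contains an element of `B` contains an
element of `A` followed by an element of `B` and a nonempty list. -/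
theorem _root_.OperadicCumulants.exists_eq_append_inl_inr {A B : Type*} (a : A) (L : List (A ⊕ B))
    (hB : ∃ b, Sum.inr b ∈ L) (hL : ∀ L' b, L ≠ L' ++ [.inr b]) :
    ∃ L₁ a' b L₂, Sum.inl a :: L = L₁ ++ .inl a' :: .inr b :: L₂ ∧ L₂ ≠ [] := by
  induction L generalizing a with
  | nil => simp at hB
  | cons y L ih =>
    rcases y with c | c
    · obtain ⟨L₁, a', b, L₂, h, h'⟩ := ih c (by simpa using hB) fun L' b h =>
        hL (.inl c :: L') b (by rw [h, List.cons_append])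
      exact ⟨.inl a :: L₁, a', b, L₂, by rw [h, List.cons_append], h'⟩
    · refine ⟨[], a, c, L, rfl, ?_⟩
      rintro rfl
      exact hL [] c rfl

variable {F : List (A ⊕ B) → B}

theorem gapValueFrom_map_inl (f : List A → B) (acc : List A) (a : A) (l : List A) :
    P.gapValueFrom f acc a (l.map .inl) = f (acc ++ a :: l) := by
  induction l generalizing acc a with
  | nil => rw [List.map_nil, gapValueFrom]
  | cons c l ih => rw [List.map_cons, gapValueFrom, ih, List.append_assoc]; rfl

theorem _root_.OperadicCumulants.exists_map_inl {A B : Type*} (L : List (A ⊕ B))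
    (h : ∀ b, Sum.inr b ∉ L) : ∃ l : List A, L = l.map .inl := by
  induction L with
  | nil => exact ⟨[], rfl⟩
  | cons y L ih =>
    obtain ⟨l, rfl⟩ := ih fun b hb => h b (List.mem_cons_of_mem _ hb)
    rcases y with a | b
    · exact ⟨a :: l, rfl⟩
    · exact absurd List.mem_cons_self (h b)

theorem tokSum_sub_singleValue (h₁ : ∀ L, L ≠ [] → shape L ≠ [none] →
      P.moment L = tokSum Sum.isLeft L fun t => F (P.lowerMoments t))
    (L : List (A ⊕ B)) (hL : L ≠ []) (hL' : shape L ≠ [none]) :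
    (tokSum Sum.isLeft L fun t => F (P.lowerMoments t) - singleValue (P.lowerMoments t)) = 0 := by
  have h₂ : ∀ t, F (P.lowerMoments t) = (F (P.lowerMoments t) - singleValue (P.lowerMoments t))
      + singleValue (P.lowerMoments t) := fun t => (sub_add_cancel _ _).symm
  have h₃ := h₁ L hL hL'
  rw [tokSum_congr _ _ fun t _ => h₂ t, tokSum_add, P.tokSum_singleValue L hL] at h₃
  exact left_eq_add.1 (h₃.trans (add_comm _ _))

/-- The recursion for the moments determines the values at all lists from those at lists of elements
of `A`.  By induction on the weight, the difference of the two sides is minus the sum of the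
tokenization sums of `signedProd` and `gapValue`, which vanishes at the ends in `B` by cancellation,
and otherwise is unchanged by a contraction that decreases the weight. -/
theorem eq_signedProd_add_gapValue (h₀ : F [] = 0) (hB : ∀ b, F [.inr b] = 0)
    (h₁ : ∀ L, L ≠ [] → shape L ≠ [none] →
      P.moment L = tokSum Sum.isLeft L fun t => F (P.lowerMoments t)) (L : List (A ⊕ B)) :
    F L - singleValue L = signedProd L + P.gapValue (fun l => F (l.map .inl)) L := by
  set f : List A → B := fun l => F (l.map .inl) with hf
  generalize hn : weight L = n
  induction n using Nat.strong_induction_on generalizing L with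
  | _ n ih =>
    subst hn
    -- The terms of smaller weight agree, by induction.
    have hδ : ∀ L' : List (A ⊕ B), weight L' ≤ weight L →
        ∀ L'' : List (A ⊕ B), weight L'' < weight L' →
        F L'' - singleValue L'' - (signedProd L'' + P.gapValue f L'') = 0 := fun L' hL' L'' hL'' =>
      sub_eq_zero.2 (ih _ (hL''.trans_le hL') L'' rfl)
    have hsum : ∀ L' : List (A ⊕ B), weight L' ≤ weight L → L' ≠ [] → shape L' ≠ [none] →
        F L' - singleValue L' - (signedProd L' + P.gapValue f L')
          = -((tokSum Sum.isLeft L' fun t => signedProd (P.lowerMoments t))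
            + tokSum Sum.isLeft L' fun t => P.gapValue f (P.lowerMoments t)) := by
      intro L' hL' hne hs
      rw [← P.tokSum_lowerMoments L' (fun L => F L - singleValue L
        - (signedProd L + P.gapValue f L)) (hδ L' hL'), ← tokSum_add, eq_neg_iff_add_eq_zero,
        ← tokSum_add]
      simp only [sub_add_cancel]
      exact P.tokSum_sub_singleValue h₁ L' hne hs
    rcases L with _ | ⟨x, L⟩
    · simp [h₀, singleValue, signedProd, gapValue]
    rcases x with a | b
    · by_cases hL : ∃ b, Sum.inr b ∈ L
      · rw [← sub_eq_zero, hsum _ le_rfl (List.cons_ne_nil _ _) (by simp [shape]),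
          P.tokSum_signedProd, P.tokSum_gapValue_inl, neg_eq_zero]
        by_cases hend : ∃ L' b, L = L' ++ [.inr b]
        · obtain ⟨L', b, rfl⟩ := hend
          rw [P.cutSum_append_inr b _ _ (List.cons_ne_nil _ _), chainSum_append_inr, add_zero]
        · push Not at hend
          obtain ⟨L₁, a', b, L₂, h, hne⟩ := exists_eq_append_inl_inr a L hL hend
          -- Contract a product of an element of `A` and an element of `B`.
          have key : ∃ a₁ L', weight (.inl a₁ :: L' : List (A ⊕ B)) < weight (.inl a :: L) ∧
              P.cutSum [.inl a] L = P.cutSum [.inl a₁] L' ∧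
              P.chainSum f [] a [] L = P.chainSum f [] a₁ [] L' := by
            rcases L₁ with _ | ⟨c, L₁⟩
            · simp only [List.nil_append, List.cons.injEq, Sum.inl.injEq] at h
              obtain ⟨rfl, rfl⟩ := h
              exact ⟨P.ract a b, L₂, by simp, P.cutSum_contract_head [] L₂ a b hne,
                P.chainSum_contract_head L₂ [] a b hne⟩
            · simp only [List.cons_append, List.cons.injEq] at h
              obtain ⟨rfl, rfl⟩ := h
              exact ⟨a, L₁ ++ .inl (P.ract a' b) :: L₂, by simp,
                P.cutSum_contract _ L₁ L₂ a' b hne, P.chainSum_contract L₁ L₂ [] a [] a' b hne⟩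
          obtain ⟨a₁, L', hw, e₁, e₂⟩ := key
          have h₂ := hsum (.inl a₁ :: L') hw.le (List.cons_ne_nil _ _) (by simp [shape])
          rw [sub_eq_zero.2 (ih _ hw _ rfl), P.tokSum_signedProd, P.tokSum_gapValue_inl,
            eq_comm, neg_eq_zero] at h₂
          rw [e₁, e₂, h₂]
      · push Not at hL
        obtain ⟨l, rfl⟩ := exists_map_inl L hL
        rw [gapValue, gapValueFrom_map_inl]
        simp [signedProd, singleValue, hf]
    · by_cases hL : L = []
      · subst hL
        simp [hB, singleValue, signedProd, gapValue]
      · rw [← sub_eq_zero, hsum _ le_rfl (List.cons_ne_nil _ _) (by simpa [shape] using hL),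
          P.tokSum_signedProd, P.tokSum_gapValue_inr, P.cutSum_inr b L hL, add_zero, neg_zero]

/-- For lists of elements of `A`, the recursion for the moments involves only sums over the
arguments of the cumulant. -/
theorem cutSum_add_chainSum (h₀ : F [] = 0) (hB : ∀ b, F [.inr b] = 0)
    (h₁ : ∀ L, L ≠ [] → shape L ≠ [none] →
      P.moment L = tokSum Sum.isLeft L fun t => F (P.lowerMoments t)) (a : A) (L : List (A ⊕ B)) :
    P.cutSum [.inl a] L + P.chainSum (fun l => F (l.map .inl)) [] a [] L = 0 := by
  rw [← P.tokSum_signedProd, ← P.tokSum_gapValue_inl, ← tokSum_add,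
    ← P.tokSum_sub_singleValue h₁ (.inl a :: L) (List.cons_ne_nil _ _) (by simp [shape])]
  exact tokSum_congr _ _ fun t _ => (P.eq_signedProd_add_gapValue h₀ hB h₁ _).symm

/-! ### Moments of lists of elements of `A` -/

/-- The sum over the ways to cut `L` into two lists, the second of which is not empty. -/
def _root_.OperadicCumulants.splitSum {α X : Type*} [AddCommMonoid X] :
    List α → (List α → List α → X) → X
  | [], _ => 0
  | x :: L, φ => φ [] (x :: L) + splitSum L fun L₁ L₂ => φ (x :: L₁) L₂

theorem _root_.OperadicCumulants.splitSum_add {α X : Type*} [AddCommMonoid X] (L : List α)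
    (φ ψ : List α → List α → X) :
    splitSum L (fun L₁ L₂ => φ L₁ L₂ + ψ L₁ L₂) = splitSum L φ + splitSum L ψ := by
  induction L generalizing φ ψ with
  | nil => simp [splitSum]
  | cons x L ih => rw [splitSum, splitSum, splitSum, ih]; abel

theorem _root_.OperadicCumulants.map_splitSum {α X : Type*} [AddCommMonoid X] (g : X →+ X)
    (L : List α) (φ : List α → List α → X) :
    g (splitSum L φ) = splitSum L fun L₁ L₂ => g (φ L₁ L₂) := by
  induction L generalizing φ with
  | nil => simp [splitSum]
  | cons x L ih => rw [splitSum, splitSum, map_add, ih]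

/-- The signed sums over all cuts of the initial segments containing `p`, each multiplied with the
moment of the rest, cancel except for the term of the uncut list. -/
theorem moment_eq_cutSum (p L : List (A ⊕ B)) : P.moment (p ++ L)
    = -(P.cutSum p L + splitSum L fun L₁ L₂ => P.cutSum p L₁ * P.moment L₂) := by
  induction L generalizing p with
  | nil => simp [cutSum, splitSum]
  | cons x L ih =>
    have h₁ := ih (p ++ [x])
    have h₂ := ih [x]
    rw [List.append_assoc, List.singleton_append] at h₁
    rw [List.singleton_append] at h₂
    have h₃ : (splitSum L fun L₁ L₂ => P.cutSum p (x :: L₁) * P.moment L₂)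
        = (splitSum L fun L₁ L₂ => P.cutSum (p ++ [x]) L₁ * P.moment L₂)
          + AddMonoidHom.mulLeft (-P.moment p)
            (splitSum L fun L₁ L₂ => P.cutSum [x] L₁ * P.moment L₂) := by
      rw [map_splitSum, ← splitSum_add]
      congr 1
      funext L₁ L₂
      rw [cutSum, AddMonoidHom.coe_mulLeft]
      simp only [sub_mul, neg_mul, mul_assoc]
      abel
    rw [splitSum, h₃, cutSum, h₁, cutSum, h₂, AddMonoidHom.coe_mulLeft]
    simp only [neg_mul, mul_neg, mul_add]
    abel

/-- As `chainSum`, but the elements after the last chosen one may be skipped, and their moment is a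
factor on the right. -/
def chainSumTail (f : List A → B) : List A → A → List A → List A → B
  | acc, a, [], [] => f (acc ++ [a])
  | acc, a, c :: gap, [] => f (acc ++ [a]) * P.moment ((c :: gap).map .inl)
  | acc, a, gap, a' :: L =>
    chainSumTail f (acc ++ [P.ractMoment a (gap.map .inl)]) a' [] L
      + chainSumTail f acc a (gap ++ [a']) L

theorem chainSumTail_nil (f : List A → B) (acc : List A) (a : A) {gap : List A} (h : gap ≠ []) :
    P.chainSumTail f acc a gap [] = f (acc ++ [a]) * P.moment (gap.map .inl) := by
  obtain ⟨c, gap, rfl⟩ := List.exists_cons_of_ne_nil h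
  rw [chainSumTail]

theorem chainSumTail_cons (f : List A → B) (acc : List A) (a : A) (gap : List A) (a' : A)
    (L : List A) : P.chainSumTail f acc a gap (a' :: L)
      = P.chainSumTail f (acc ++ [P.ractMoment a (gap.map .inl)]) a' [] L
        + P.chainSumTail f acc a (gap ++ [a']) L := by
  cases gap <;> rw [chainSumTail]

open Classical in
/-- `chainSumTail` as a sum over the position of the last chosen element, which ends an initial
segment of `L`, or is `a` itself. -/
theorem chainSumTail_eq (f : List A → B) (acc : List A) (a : A) (gap L : List A) :
    P.chainSumTail f acc a gap L = P.chainSum f acc a (gap.map .inl) (L.map .inl)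
      + ((splitSum (L.map .inl) fun L₁ L₂ =>
          P.chainSum f acc a (gap.map .inl) L₁ * P.moment L₂)
        + if gap = [] then 0 else f (acc ++ [a]) * P.moment ((gap ++ L).map .inl)) := by
  induction L generalizing acc a gap with
  | nil =>
    by_cases h : gap = []
    · subst h; simp [chainSumTail, chainSum, splitSum]
    · rw [P.chainSumTail_nil f acc a h, List.map_nil, P.chainSum_nil _ _ (by simpa using h),
        if_neg h]
      simp [splitSum]
  | cons c L ih =>
    have hg : gap ++ [c] ≠ [] := by simp
    rw [chainSumTail_cons, ih, ih, if_pos rfl, if_neg hg, List.map_cons, chainSum_inl, splitSum]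
    have h₁ : (splitSum (L.map .inl) fun L₁ L₂ =>
        P.chainSum f acc a (gap.map .inl) (.inl c :: L₁) * P.moment L₂)
        = (splitSum (L.map .inl) fun L₁ L₂ => P.chainSum f
            (acc ++ [P.ractMoment a (gap.map .inl)]) c [] L₁ * P.moment L₂)
          + splitSum (L.map .inl) fun L₁ L₂ =>
            P.chainSum f acc a (gap.map .inl ++ [.inl c]) L₁ * P.moment L₂ := by
      rw [← splitSum_add]
      congr 1
      funext L₁ L₂
      rw [chainSum_inl, add_mul]
    rw [h₁]
    have h₂ : P.chainSum f acc a (gap.map .inl) [] = if gap = [] then f (acc ++ [a]) else 0 := by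
      split_ifs with h
      · subst h; rw [List.map_nil, chainSum]
      · exact P.chainSum_nil _ _ (by simpa using h)
    rw [h₂]
    by_cases h : gap = []
    · subst h
      simp
      abel
    · simp [h]
      abel

/-- The moment of a list of elements of `A` is the sum of the values of the cumulant at the sublists
containing the first element, with the moments of the gaps between the arguments inserted. -/
theorem moment_eq_chainSumTail (h₀ : F [] = 0) (hB : ∀ b, F [.inr b] = 0)
    (h₁ : ∀ L, L ≠ [] → shape L ≠ [none] →
      P.moment L = tokSum Sum.isLeft L fun t => F (P.lowerMoments t)) (a : A) (l : List A) :
    P.moment ((a :: l).map .inl) = P.chainSumTail (fun l => F (l.map .inl)) [] a [] l := by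
  have h := P.moment_eq_cutSum [.inl a] (l.map .inl)
  have h₂ : ∀ L, P.cutSum [.inl a] L = -P.chainSum (fun l => F (l.map .inl)) [] a [] L := fun L =>
    eq_neg_of_add_eq_zero_left (P.cutSum_add_chainSum h₀ hB h₁ a L)
  rw [chainSumTail_eq, if_pos rfl, add_zero, List.map_cons]
  refine h.trans ?_
  simp only [h₂, neg_mul]
  have h₃ := map_splitSum (-AddMonoidHom.id B) (l.map .inl) fun L₁ L₂ =>
    P.chainSum (fun l => F (l.map .inl)) [] a [] L₁ * P.moment L₂
  simp only [AddMonoidHom.neg_apply, AddMonoidHom.id_apply] at h₃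
  rw [← h₃, List.map_nil]
  abel

end OpValuedProbSpace

end

/-! ### Gluing noncrossing partitions -/

section

section Noncrossing

variable {I : Type*} [LinearOrder I] {X : Type*}

theorem mem_part_comm {s : Finset I} (π : Finpartition s) {x y : I} :
    x ∈ π.part y ↔ y ∈ π.part x := by
  simp only [Finpartition.mem_part_iff_exists, and_comm]

theorem mem_part_trans {s : Finset I} (π : Finpartition s) {x y z : I} (hxy : x ∈ π.part y)
    (hyz : y ∈ π.part z) : x ∈ π.part z := by
  have hy := π.part_subset _ hyz
  have hz : z ∈ s := by
    by_contra hz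
    rw [π.part_eq_empty.2 hz] at hyz
    exact absurd hyz (Finset.notMem_empty _)
  rwa [← (π.mem_part_iff_part_eq_part hy hz).1 hyz]

theorem isNoncrossing_iff {s : Finset I} (π : Finpartition s) : IsNoncrossing π ↔
    ∀ w x y z, w < x → x < y → y < z → y ∈ π.part w → z ∈ π.part x → x ∈ π.part w := by
  constructor
  · intro h w x y z hwx hxy hyz hw hx
    by_contra hne
    have hw' : w ∈ s := π.part_nonempty.1 ⟨y, hw⟩
    have hx' : x ∈ s := π.part_nonempty.1 ⟨z, hx⟩
    refine h _ (π.part_mem.2 hw') _ (π.part_mem.2 hx') (fun he => hne ?_)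
      ⟨w, π.mem_part hw', x, π.mem_part hx', y, hw, z, hx, hwx, hxy, hyz⟩
    rw [he]
    exact π.mem_part hx'
  · rintro h p hp q hq hne ⟨w, hw, x, hx, y, hy, z, hz, hwx, hxy, hyz⟩
    have h₁ := π.part_eq_of_mem hp hw
    have h₂ := π.part_eq_of_mem hq hx
    rw [← h₁] at hy
    rw [← h₂] at hz
    have h₃ := h w x y z hwx hxy hyz hy hz
    rw [h₁] at h₃
    exact hne (h₁.symm.trans ((π.part_eq_of_mem hp hw).trans
      (((π.part_eq_of_mem hp h₃).symm).trans h₂)))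

theorem finpartition_ext {s : Finset I} {π π' : Finpartition s}
    (h : ∀ x ∈ s, ∀ y ∈ s, y ∈ π.part x ↔ y ∈ π'.part x) : π = π' := by
  have h₁ : ∀ x ∈ s, π.part x = π'.part x := fun x hx => Finset.ext fun y =>
    ⟨fun hy => (h x hx y (π.part_subset _ hy)).1 hy,
      fun hy => (h x hx y (π'.part_subset _ hy)).2 hy⟩
  have h₂ : ∀ σ : Finpartition s, σ.parts = s.image σ.part := by
    intro σ
    ext p
    rw [Finset.mem_image]
    constructor
    · intro hp
      obtain ⟨x, hx⟩ := σ.nonempty_of_mem_parts hp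
      exact ⟨x, σ.le hp hx, σ.part_eq_of_mem hp hx⟩
    · rintro ⟨x, hx, rfl⟩
      exact σ.part_mem.2 hx
  refine Finpartition.ext ?_
  rw [h₂, h₂]
  exact Finset.image_congr h₁

open Classical in
/-- The partition of `s` into the nonempty level sets of a function. -/
def levelSets (g : I → X) (s : Finset I) : Finpartition s :=
  Finpartition.ofSetSetoid (Setoid.ker g) s

theorem mem_part_levelSets {g : I → X} {s : Finset I} {x y : I} :
    y ∈ (levelSets g s).part x ↔ x ∈ s ∧ y ∈ s ∧ g x = g y := by
  classical
  refine Finpartition.mem_part_ofSetSetoid_iff_rel s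

/-- The restriction of a partition to a set `t`. -/
def restrictPart {s : Finset I} (π : Finpartition s) (t : Finset I) : Finpartition t :=
  levelSets π.part t

theorem mem_part_restrictPart {s : Finset I} (π : Finpartition s) {t : Finset I} (h : t ⊆ s)
    {x y : I} : y ∈ (restrictPart π t).part x ↔ x ∈ t ∧ y ∈ t ∧ y ∈ π.part x := by
  rw [restrictPart, mem_part_levelSets]
  refine and_congr_right fun hx => and_congr_right fun hy => ?_
  rw [mem_part_comm, π.mem_part_iff_part_eq_part (h hx) (h hy)]

open Classical in
/-- The noncrossing partitions of a finite set. -/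
def ncPartitions (s : Finset I) : Finset (Finpartition s) := Finset.univ.filter IsNoncrossing

theorem mem_ncPartitions {s : Finset I} {π : Finpartition s} :
    π ∈ ncPartitions s ↔ IsNoncrossing π := by
  classical
  simp [ncPartitions]

theorem restrictPart_mem {s : Finset I} {π : Finpartition s} (h : π ∈ ncPartitions s)
    {t : Finset I} (ht : t ⊆ s) : restrictPart π t ∈ ncPartitions t := by
  rw [mem_ncPartitions, isNoncrossing_iff] at h ⊢
  intro w x y z hwx hxy hyz hw hx
  rw [mem_part_restrictPart π ht] at hw hx ⊢
  exact ⟨hw.1, hx.1, h w x y z hwx hxy hyz hw.2.2 hx.2.2⟩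

open Classical in
/-- The partition of `s` that is `π` on `G`, and on the complement of `G` the pullback of `π'` along
`φ`. -/
def gluePart (s : Finset I) {G S : Finset I} (φ : I → I) (π : Finpartition G)
    (π' : Finpartition S) : Finpartition s :=
  levelSets (fun x => if x ∈ G then Sum.inl (π.part x) else Sum.inr (π'.part (φ x))) s

/-- Let no element of `H` be between elements of `G`, and let `φ : H → S` be a monotone retraction.
The noncrossing partitions of `s = G ∪ H` in which no block meets both `G` and `H`, and each `x` in
`H` is in the block of `φ x`, correspond to pairs of noncrossing partitions of `G` and `S`. -/
theorem sum_ncPartitions_glue {Y : Type*} [AddCommMonoid Y] {s G H S : Finset I} (φ : I → I)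
    (hs : ∀ x, x ∈ s ↔ x ∈ G ∨ x ∈ H) (hGH : ∀ x ∈ G, x ∉ H)
    (hbet : ∀ x ∈ G, ∀ y ∈ H, ∀ z ∈ G, x < y → ¬ y < z) (hSH : S ⊆ H)
    (hφ : ∀ x ∈ H, φ x ∈ S) (hφS : ∀ x ∈ S, φ x = x)
    (hmono : ∀ x ∈ H, ∀ y ∈ H, x ≤ y → φ x ≤ φ y) (D : Finset (Finpartition s))
    (hD : ∀ π, π ∈ D ↔ π ∈ ncPartitions s ∧ (∀ x ∈ G, ∀ y ∈ H, y ∉ π.part x) ∧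
      ∀ x ∈ H, φ x ∈ π.part x)
    (ψ : Finpartition s → Y) (ψ' : Finpartition G → Finpartition S → Y)
    (hψ : ∀ π ∈ D, ψ π = ψ' (restrictPart π G) (restrictPart π S)) :
    ∑ π ∈ D, ψ π = ∑ π ∈ ncPartitions G, ∑ π' ∈ ncPartitions S, ψ' π π' := by
  have hGs : G ⊆ s := fun x hx => (hs x).2 (Or.inl hx)
  have hHs : H ⊆ s := fun x hx => (hs x).2 (Or.inr hx)
  have hSs : S ⊆ s := hSH.trans hHs
  have gG : ∀ (π : Finpartition G) (π' : Finpartition S), ∀ x ∈ G, ∀ y ∈ G,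
      y ∈ (gluePart s φ π π').part x ↔ y ∈ π.part x := by
    intro π π' x hx y hy
    rw [gluePart, mem_part_levelSets, if_pos hx, if_pos hy, Sum.inl.injEq,
      mem_part_comm, π.mem_part_iff_part_eq_part hx hy]
    exact ⟨fun h => h.2.2, fun h => ⟨hGs hx, hGs hy, h⟩⟩
  have gH : ∀ (π : Finpartition G) (π' : Finpartition S), ∀ x ∈ H, ∀ y ∈ H,
      y ∈ (gluePart s φ π π').part x ↔ φ y ∈ π'.part (φ x) := by
    intro π π' x hx y hy
    rw [gluePart, mem_part_levelSets, if_neg fun h => hGH x h hx, if_neg fun h => hGH y h hy,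
      Sum.inr.injEq, mem_part_comm, π'.mem_part_iff_part_eq_part (hφ x hx) (hφ y hy)]
    exact ⟨fun h => h.2.2, fun h => ⟨hHs hx, hHs hy, h⟩⟩
  have gGH : ∀ (π : Finpartition G) (π' : Finpartition S), ∀ x ∈ G, ∀ y ∈ H,
      y ∉ (gluePart s φ π π').part x := by
    intro π π' x hx y hy h
    rw [gluePart, mem_part_levelSets, if_pos hx, if_neg fun h => hGH y h hy] at h
    simp at h
  rw [← Finset.sum_product']
  refine Finset.sum_nbij' (fun π => (restrictPart π G, restrictPart π S))
    (fun p => gluePart s φ p.1 p.2) ?_ ?_ ?_ ?_ hψ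
  · intro π hπ
    rw [Finset.mem_product]
    exact ⟨restrictPart_mem ((hD π).1 hπ).1 hGs, restrictPart_mem ((hD π).1 hπ).1 hSs⟩
  · rintro ⟨π, π'⟩ hπ
    rw [Finset.mem_product] at hπ
    obtain ⟨h, h'⟩ := hπ
    simp only [mem_ncPartitions, isNoncrossing_iff] at h h'
    rw [hD, mem_ncPartitions, isNoncrossing_iff]
    refine ⟨fun w x y z hwx hxy hyz hw hx => ?_, gGH π π', fun x hx => ?_⟩
    · -- Crossing blocks are both in `G` or both in `H`, by the assumption on the elements between
      -- elements of `G`, and in `H` their images under `φ` cross or coincide.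
      have hw' := (hs w).1 (Finpartition.part_nonempty _ |>.1 ⟨y, hw⟩)
      have hx' := (hs x).1 (Finpartition.part_nonempty _ |>.1 ⟨z, hx⟩)
      have hy' := (hs y).1 (Finpartition.part_subset _ _ hw)
      have hz' := (hs z).1 (Finpartition.part_subset _ _ hx)
      rcases hw' with hw' | hw'
      · rcases hy' with hy' | hy'
        · rcases hx' with hx' | hx'
          · rcases hz' with hz' | hz'
            · rw [gG _ _ _ hw' _ hy'] at hw
              rw [gG _ _ _ hx' _ hz'] at hx
              rw [gG _ _ _ hw' _ hx']
              exact h w x y z hwx hxy hyz hw hx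
            · exact absurd hx (gGH π π' x hx' z hz')
          · exact absurd hxy (hbet w hw' x hx' y hy' hwx)
        · exact absurd hw (gGH π π' w hw' y hy')
      · rcases hy' with hy' | hy'
        · exact absurd ((mem_part_comm _).1 hw) (gGH π π' y hy' w hw')
        · rcases hx' with hx' | hx'
          · rcases hz' with hz' | hz'
            · exact absurd hyz (hbet x hx' y hy' z hz' hxy)
            · exact absurd hx (gGH π π' x hx' z hz')
          · rcases hz' with hz' | hz'
            · exact absurd ((mem_part_comm _).1 hx) (gGH π π' z hz' x hx')
            · rw [gH _ _ _ hw' _ hy'] at hw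
              rw [gH _ _ _ hx' _ hz'] at hx
              rw [gH _ _ _ hw' _ hx']
              have h₁ := hmono w hw' x hx' hwx.le
              have h₂ := hmono x hx' y hy' hxy.le
              have h₃ := hmono y hy' z hz' hyz.le
              rcases h₁.eq_or_lt with h₁ | h₁
              · rw [← h₁]; exact π'.mem_part (hφ w hw')
              rcases h₂.eq_or_lt with h₂ | h₂
              · rw [h₂]; exact hw
              rcases h₃.eq_or_lt with h₃ | h₃
              · rw [← h₃] at hx
                exact mem_part_trans _ ((mem_part_comm _).1 hx) hw
              exact h' _ _ _ _ h₁ h₂ h₃ hw hx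
    · rw [gH _ _ _ hx _ (hSH (hφ x hx)), hφS _ (hφ x hx)]
      exact π'.mem_part (hφ x hx)
  · intro π hπ
    obtain ⟨-, h₁, h₂⟩ := (hD π).1 hπ
    refine finpartition_ext fun x hx y hy => ?_
    rcases (hs x).1 hx with hx' | hx' <;> rcases (hs y).1 hy with hy' | hy'
    · rw [gG _ _ _ hx' _ hy', mem_part_restrictPart π hGs]
      exact ⟨fun h => h.2.2, fun h => ⟨hx', hy', h⟩⟩
    · exact iff_of_false (gGH _ _ x hx' y hy') (h₁ x hx' y hy')
    · rw [mem_part_comm, mem_part_comm π]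
      exact iff_of_false (gGH _ _ y hy' x hx') (h₁ y hy' x hx')
    · rw [gH _ _ _ hx' _ hy', mem_part_restrictPart π hSs]
      have e₁ := h₂ x hx'
      have e₂ := h₂ y hy'
      refine ⟨fun h => ?_, fun h => ⟨hφ x hx', hφ y hy', ?_⟩⟩
      · exact mem_part_trans _ ((mem_part_comm _).1 e₂) (mem_part_trans _ h.2.2 e₁)
      · exact mem_part_trans _ e₂ (mem_part_trans _ h ((mem_part_comm _).1 e₁))
  · rintro ⟨π, π'⟩ -
    refine Prod.ext ?_ ?_
    · refine finpartition_ext fun x hx y hy => ?_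
      rw [mem_part_restrictPart _ hGs, gG _ _ x hx y hy]
      exact ⟨fun h => h.2.2, fun h => ⟨hx, hy, h⟩⟩
    · refine finpartition_ext fun x hx y hy => ?_
      rw [mem_part_restrictPart _ hSs, gH _ _ x (hSH hx) y (hSH hy), hφS x hx, hφS y hy]
      exact ⟨fun h => h.2.2, fun h => ⟨hx, hy, h⟩⟩

end Noncrossing

end

/-! ### Nested evaluations -/

section

section Noncrossing

variable {I : Type*} [LinearOrder I]

theorem part_restrictPart {s t : Finset I} (π : Finpartition s) (h : t ⊆ s) {x : I} (hx : x ∈ t)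
    (hxt : π.part x ⊆ t) : (restrictPart π t).part x = π.part x := by
  ext y
  rw [mem_part_restrictPart π h]
  exact ⟨fun h => h.2.2, fun h => ⟨hx, hxt h, h⟩⟩

theorem sum_ncPartitions_const {Y : Type*} [AddCommMonoid Y] {s : Finset I}
    (hs : ∀ x ∈ s, ∀ y ∈ s, x = y) (c : Y) : ∑ _π ∈ ncPartitions s, c = c := by
  have h : ncPartitions s = {levelSets id s} := by
    refine Finset.eq_singleton_iff_unique_mem.2 ⟨?_, fun π _ => ?_⟩
    · rw [mem_ncPartitions, isNoncrossing_iff]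
      intro w x y z hwx hxy _ hw _
      rw [mem_part_levelSets] at hw
      exact absurd (hs _ hw.1 _ hw.2.1) (hwx.trans hxy).ne
    · refine finpartition_ext fun x hx y hy => ?_
      rw [hs x hx y hy]
      exact iff_of_true (π.mem_part hy) (Finpartition.mem_part _ hy)
  rw [h, Finset.sum_singleton]

end Noncrossing

namespace OpValuedProbSpace

variable {R : Type u} {B : Type v} {A : Type w} [CommRing R]
  [NonUnitalRing B] [Module R B] [IsScalarTower R B B] [SMulCommClass R B B]
  [NonUnitalRing A] [Module R A] [IsScalarTower R A A] [SMulCommClass R A A]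
  (P : OpValuedProbSpace R B A)

variable {I : Type*} [LinearOrder I]

/-- The elements of `t` that are not in `V` and lie between `l` and the next element of `V`. -/
def _root_.OperadicCumulants.gapAfter (t V : Finset I) (l : I) : Finset I :=
  t.filter fun x => x ∉ V ∧ l < x ∧ (∃ v ∈ V, x < v) ∧ ∀ v ∈ V, v < x → v ≤ l

theorem _root_.OperadicCumulants.mem_gapAfter {t V : Finset I} {l x : I} : x ∈ gapAfter t V l ↔
    x ∈ t ∧ x ∉ V ∧ l < x ∧ (∃ v ∈ V, x < v) ∧ ∀ v ∈ V, v < x → v ≤ l := Finset.mem_filter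

/-- The arguments of `f` for the block of the least element `m` of `s` in a nested evaluation. -/
def blockArgs {S : Finset I} (f : List A → B) (π : Finpartition S) (a : I → A) (s : Finset I)
    (m : I) : List A :=
  ((π.part m).sort (· ≤ ·)).map fun l =>
    (P.nestedValues f π a (gapAfter (s.erase m) (π.part m) l)).foldl (fun a b => P.ract a b) (a l)

/-- The values of the outermost blocks after the first one. -/
def tailValues {S : Finset I} (f : List A → B) (π : Finpartition S) (a : I → A) (s : Finset I)
    (m : I) : List B :=
  P.nestedValues f π a ((s.erase m).filter fun x => ∀ v ∈ π.part m, v < x)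

theorem nestedValues_empty {S : Finset I} (f : List A → B) (π : Finpartition S) (a : I → A) :
    P.nestedValues f π a ∅ = [] := by
  rw [nestedValues, dif_neg (by simp)]

theorem tailValues_of_subset {S : Finset I} (f : List A → B) (π : Finpartition S) (a : I → A)
    {s : Finset I} {m : I} (h : s ⊆ π.part m) : P.tailValues f π a s m = [] := by
  have h₁ : ((s.erase m).filter fun x => ∀ v ∈ π.part m, v < x) = ∅ :=
    Finset.eq_empty_of_forall_notMem fun x hx => by
      obtain ⟨h₁, h₂⟩ := Finset.mem_filter.1 hx
      exact (h₂ x (h (Finset.mem_of_mem_erase h₁))).false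
  rw [tailValues, h₁, nestedValues_empty]

theorem nestedValues_eq {S : Finset I} (f : List A → B) (π : Finpartition S) (a : I → A)
    {s : Finset I} {m : I} (hm : m ∈ s) (hmin : ∀ x ∈ s, m ≤ x) :
    P.nestedValues f π a s = f (P.blockArgs f π a s m) :: P.tailValues f π a s m := by
  have h : s.Nonempty := ⟨m, hm⟩
  have h' : s.min' h = m := le_antisymm (Finset.min'_le _ _ hm) (hmin _ (Finset.min'_mem _ _))
  rw [nestedValues, dif_pos h]
  simp only [h']
  rfl

/-- The nested evaluation on `t` depends only on the blocks of the elements of `t` and on the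
values of `f` at lists of the size of such a block. -/
theorem nestedValues_congr {S S' : Finset I} {f f' : List A → B} {π : Finpartition S}
    {π' : Finpartition S'} (a : I → A) (t : Finset I) (h : ∀ x ∈ t, π.part x = π'.part x)
    (hf : ∀ x ∈ t, ∀ l : List A, l.length = (π.part x).card → f l = f' l) :
    P.nestedValues f π a t = P.nestedValues f' π' a t := by
  induction hn : t.card using Nat.strong_induction_on generalizing t with
  | _ n ih =>
    subst hn
    rcases t.eq_empty_or_nonempty with rfl | ht
    · rw [nestedValues_empty, nestedValues_empty]
    have hm := t.min'_mem ht
    have hmin := fun x hx => t.min'_le x hx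
    have key : ∀ t' ⊆ t.erase (t.min' ht), P.nestedValues f π a t' = P.nestedValues f' π' a t' :=
      fun t' ht' => ih _ ((Finset.card_le_card ht').trans_lt (Finset.card_erase_lt_of_mem hm)) t'
        (fun x hx => h x (Finset.mem_of_mem_erase (ht' hx)))
        (fun x hx => hf x (Finset.mem_of_mem_erase (ht' hx))) rfl
    have h₁ : P.blockArgs f π a t (t.min' ht) = P.blockArgs f' π' a t (t.min' ht) := by
      rw [blockArgs, blockArgs, ← h _ hm]
      refine List.map_congr_left fun l _ => ?_
      rw [key (gapAfter _ _ l) (Finset.filter_subset _ _)]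
    rw [P.nestedValues_eq f π a hm hmin, P.nestedValues_eq f' π' a hm hmin, tailValues, tailValues,
      ← h _ hm, key _ (Finset.filter_subset _ _), ← h₁]
    congr 1
    refine hf _ hm _ ?_
    rw [blockArgs, List.length_map, Finset.length_sort]

/-- The nested evaluation, with the arguments `acc` of `f` inserted before those for the block of
the least element `m` of `s`. -/
def prefixedValue {S : Finset I} (f : List A → B) (acc : List A) (π : Finpartition S) (a : I → A)
    (s : Finset I) (m : I) : B :=
  listProd (f (acc ++ P.blockArgs f π a s m) :: P.tailValues f π a s m)

theorem prefixedValue_singleton (f : List A → B) (acc : List A) {s : Finset I}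
    (π : Finpartition s) (a : I → A) {m : I} (hmin : ∀ x ∈ s, m ≤ x) (h : π.part m = {m}) :
    P.prefixedValue f acc π a s m
      = listProd (f (acc ++ [a m]) ::
        P.nestedValues f (restrictPart π (s.erase m)) a (s.erase m)) := by
  have h₁ : gapAfter (s.erase m) {m} m = ∅ := by
    refine Finset.eq_empty_of_forall_notMem fun x hx => ?_
    obtain ⟨-, -, h₁, ⟨v, hv, h₂⟩, -⟩ := mem_gapAfter.1 hx
    rw [Finset.mem_singleton.1 hv] at h₂
    exact lt_asymm h₁ h₂
  have h₂ : ((s.erase m).filter fun x => ∀ v ∈ π.part m, v < x) = s.erase m := by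
    rw [Finset.filter_eq_self]
    intro x hx v hv
    rw [h, Finset.mem_singleton] at hv
    rw [hv]
    exact lt_of_le_of_ne (hmin x (Finset.mem_of_mem_erase hx)) (Finset.ne_of_mem_erase hx).symm
  rw [prefixedValue, tailValues, h₂, blockArgs, h, Finset.sort_singleton, List.map_singleton, h₁,
    nestedValues_empty, List.foldl_nil]
  congr 2
  refine P.nestedValues_congr a _ (fun x hx => (part_restrictPart π (Finset.erase_subset _ _) hx
    fun y hy => Finset.mem_erase.2 ⟨?_, π.part_subset _ hy⟩).symm) fun _ _ _ _ => rfl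
  rintro rfl
  rw [mem_part_comm, h, Finset.mem_singleton] at hy
  exact Finset.ne_of_mem_erase hx hy

/-- If the two least elements of the block of `m` are `m` and `m₁`, the elements `G` between them
contribute to the first argument, and the remaining elements `S` form a nested evaluation. -/
theorem prefixedValue_cons (f : List A → B) (acc : List A) {s G S : Finset I}
    (π : Finpartition s) (a : I → A) {m m₁ : I} (hs : ∀ x, x ∈ s ↔ x = m ∨ x ∈ G ∨ x ∈ S)
    (hG : ∀ x ∈ G, m < x ∧ x < m₁) (hm : m < m₁) (hS : ∀ x ∈ S, m₁ ≤ x) (hm₁ : m₁ ∈ S)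
    (hπ : m₁ ∈ π.part m) (hGπ : ∀ x ∈ G, ∀ y, y = m ∨ y ∈ S → y ∉ π.part x) :
    P.prefixedValue f acc π a s m
      = P.prefixedValue f
        (acc ++ [(P.nestedValues f (restrictPart π G) a G).foldl (fun a b => P.ract a b) (a m)])
        (restrictPart π S) a S m₁ := by
  have hms : m ∈ s := (hs m).2 (Or.inl rfl)
  have hGs : G ⊆ s := fun x hx => (hs x).2 (Or.inr (Or.inl hx))
  have hSs : S ⊆ s := fun x hx => (hs x).2 (Or.inr (Or.inr hx))
  have hmS : ∀ x ∈ S, m < x := fun x hx => hm.trans_le (hS x hx)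
  have hV : π.part m₁ = π.part m :=
    (π.mem_part_iff_part_eq_part (hSs hm₁) hms).1 hπ
  set V := (restrictPart π S).part m₁ with hVdef
  have hmemV : ∀ x, x ∈ V ↔ x ∈ S ∧ x ∈ π.part m := fun x => by
    rw [hVdef, mem_part_restrictPart π hSs, hV]
    exact ⟨fun h => h.2, fun h => ⟨hm₁, h⟩⟩
  have hGV : ∀ x ∈ G, x ∉ π.part m := fun x hx h =>
    hGπ x hx m (Or.inl rfl) ((mem_part_comm π).1 h)
  have hins : π.part m = insert m V := by
    ext x
    rw [Finset.mem_insert, hmemV]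
    constructor
    · intro hx
      rcases (hs x).1 (π.part_subset _ hx) with h | h | h
      · exact Or.inl h
      · exact absurd hx (hGV x h)
      · exact Or.inr ⟨h, hx⟩
    · rintro (rfl | h)
      · exact π.mem_part hms
      · exact h.2
  have hm₁V : m₁ ∈ V := (hmemV m₁).2 ⟨hm₁, hπ⟩
  have hVS : ∀ v ∈ V, m₁ ≤ v := fun v hv => hS v ((hmemV v).1 hv).1
  have hsort : (π.part m).sort (· ≤ ·) = m :: V.sort (· ≤ ·) := by
    rw [hins, Finset.sort_insert]
    · exact fun b hb => (hm.trans_le (hVS b hb)).le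
    · exact fun h => (hm.trans_le (hVS m h)).false
  have hgap₀ : gapAfter (s.erase m) (π.part m) m = G := by
    ext x
    rw [mem_gapAfter]
    constructor
    · rintro ⟨hx, hxV, hmx, -, hle⟩
      rcases (hs x).1 (Finset.mem_of_mem_erase hx) with h | h | h
      · exact absurd h hmx.ne'
      · exact h
      · have hne : m₁ ≠ x := fun he => hxV (he ▸ hπ)
        exact absurd (hle m₁ hπ (lt_of_le_of_ne (hS x h) hne)) hm.not_ge
    · intro hx
      refine ⟨Finset.mem_erase.2 ⟨(hG x hx).1.ne', hGs hx⟩, hGV x hx, (hG x hx).1,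
        ⟨m₁, hπ, (hG x hx).2⟩, fun v hv hvx => ?_⟩
      rw [hins, Finset.mem_insert] at hv
      rcases hv with rfl | hv
      · exact le_rfl
      · exact absurd (hvx.trans (hG x hx).2) (hVS v hv).not_gt
  -- The elements of `S` outside `V` have the same blocks in both partitions.
  have hpart : ∀ x ∈ S, x ∉ π.part m → π.part x = (restrictPart π S).part x := by
    intro x hx hxV
    refine (part_restrictPart π hSs hx fun y hy => ?_).symm
    rcases (hs y).1 (π.part_subset _ hy) with h | h | h
    · rw [h, mem_part_comm] at hy
      exact absurd hy hxV
    · exact absurd ((mem_part_comm π).1 hy) (hGπ y h x (Or.inr hx))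
    · exact h
  have hmemS : ∀ x ∈ s, m₁ < x → x ∈ S := fun x hx hlt => by
    rcases (hs x).1 hx with h | h | h
    · exact absurd (h ▸ hlt) hm.not_gt
    · exact absurd (hG x h).2 hlt.not_gt
    · exact h
  have hgap : ∀ l ∈ V, gapAfter (s.erase m) (π.part m) l = gapAfter (S.erase m₁) V l := by
    intro l hl
    have hml := hVS l hl
    ext x
    rw [mem_gapAfter, mem_gapAfter, hins, Finset.mem_erase, Finset.mem_erase]
    constructor
    · rintro ⟨hx, hxV, hlx, ⟨v, hv, hxv⟩, hle⟩
      rw [Finset.mem_insert] at hv hxV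
      have hm₁x := hml.trans_lt hlx
      refine ⟨⟨hm₁x.ne', hmemS x hx.2 hm₁x⟩, fun h => hxV (Or.inr h), hlx, ⟨v, ?_, hxv⟩,
        fun v hv => hle v (Finset.mem_insert_of_mem hv)⟩
      rcases hv with rfl | hv
      · exact absurd (hm.trans (hm₁x.trans hxv)) (lt_irrefl _)
      · exact hv
    · rintro ⟨hx, hxV, hlx, ⟨v, hv, hxv⟩, hle⟩
      refine ⟨⟨(hmS x hx.2).ne', hSs hx.2⟩, ?_, hlx, ⟨v, Finset.mem_insert_of_mem hv, hxv⟩, ?_⟩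
      · rw [Finset.mem_insert, not_or]
        exact ⟨(hmS x hx.2).ne', hxV⟩
      · intro v hv hvx
        rcases Finset.mem_insert.1 hv with rfl | hv
        · exact hm.le.trans hml
        · exact hle v hv hvx
  have htail : ((s.erase m).filter fun x => ∀ v ∈ π.part m, v < x)
      = (S.erase m₁).filter fun x => ∀ v ∈ V, v < x := by
    ext x
    rw [Finset.mem_filter, Finset.mem_filter, hins, Finset.mem_erase, Finset.mem_erase]
    constructor
    · rintro ⟨hx, hlt⟩
      have hm₁x := hlt m₁ (Finset.mem_insert_of_mem hm₁V)
      exact ⟨⟨hm₁x.ne', hmemS x hx.2 hm₁x⟩, fun v hv => hlt v (Finset.mem_insert_of_mem hv)⟩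
    · rintro ⟨hx, hlt⟩
      refine ⟨⟨(hmS x hx.2).ne', hSs hx.2⟩, fun v hv => ?_⟩
      rcases Finset.mem_insert.1 hv with rfl | hv
      · exact hmS x hx.2
      · exact hlt v hv
  have hargs : P.blockArgs f π a s m
      = (P.nestedValues f (restrictPart π G) a G).foldl (fun a b => P.ract a b) (a m) ::
        P.blockArgs f (restrictPart π S) a S m₁ := by
    rw [blockArgs, hsort, List.map_cons, hgap₀, blockArgs, ← hVdef]
    refine congrArg₂ List.cons (congrArg (List.foldl _ _) ?_) ?_
    · refine P.nestedValues_congr a _ (fun x hx => (part_restrictPart π hGs hx fun y hy => ?_).symm)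
        fun _ _ _ _ => rfl
      rcases (hs y).1 (π.part_subset _ hy) with h | h | h
      · exact absurd hy (hGπ x hx y (Or.inl h))
      · exact h
      · exact absurd hy (hGπ x hx y (Or.inr h))
    · refine List.map_congr_left fun l hl => ?_
      rw [hgap l ((Finset.mem_sort _).1 hl)]
      congr 1
      refine P.nestedValues_congr a _ (fun x hx => ?_) fun _ _ _ _ => rfl
      obtain ⟨hx₁, hx₂, hx₃, -⟩ := mem_gapAfter.1 hx
      refine hpart x (Finset.mem_of_mem_erase hx₁) ?_
      rw [hins, Finset.mem_insert, not_or]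
      exact ⟨(hmS x (Finset.mem_of_mem_erase hx₁)).ne', hx₂⟩
  have htails : P.tailValues f π a s m = P.tailValues f (restrictPart π S) a S m₁ := by
    rw [tailValues, htail, tailValues, ← hVdef]
    refine P.nestedValues_congr a _ (fun x hx => ?_) fun _ _ _ _ => rfl
    obtain ⟨hx₁, hx₂⟩ := Finset.mem_filter.1 hx
    refine hpart x (Finset.mem_of_mem_erase hx₁) ?_
    rw [hins, Finset.mem_insert, not_or]
    exact ⟨(hmS x (Finset.mem_of_mem_erase hx₁)).ne', fun h => (hx₂ x h).false⟩
  rw [prefixedValue, hargs, htails, prefixedValue, List.append_assoc, List.singleton_append]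

end OpValuedProbSpace

end

/-! ### The moment-cumulant formula -/

section

namespace OpValuedProbSpace

variable {R : Type u} {B : Type v} {A : Type w} [CommRing R]
  [NonUnitalRing B] [Module R B] [IsScalarTower R B B] [SMulCommClass R B B]
  [NonUnitalRing A] [Module R A] [IsScalarTower R A A] [SMulCommClass R A A]
  (P : OpValuedProbSpace R B A)

variable {I : Type*} [LinearOrder I]

theorem chainSumTail_add {f : List A → B}
    (hf : ∀ l l' x y, f (l ++ (x + y) :: l') = f (l ++ x :: l') + f (l ++ y :: l'))
    (acc acc' : List A) (x y a : A) (gap L : List A) :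
    P.chainSumTail f (acc ++ (x + y) :: acc') a gap L
      = P.chainSumTail f (acc ++ x :: acc') a gap L
        + P.chainSumTail f (acc ++ y :: acc') a gap L := by
  induction L generalizing acc' a gap with
  | nil =>
    rcases gap with _ | ⟨c, gap⟩
    · simp only [chainSumTail, List.append_assoc, List.cons_append, hf]
    · simp only [chainSumTail, List.append_assoc, List.cons_append, hf, add_mul]
  | cons c L ih =>
    simp only [chainSumTail_cons, List.append_assoc, List.cons_append, ih]
    abel

/-- The sum over the noncrossing partitions of `s` in which the elements of `gap` are not in the
block of the least element `m`, by recursion on the elements of `s` after `gap`.  For smaller sets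
the nested evaluations are assumed to sum up to the moments. -/
theorem chainSumTail_eq_sum_prefixedValue {f : List A → B} (a : I → A)
    (hf : ∀ l l' x y, f (l ++ (x + y) :: l') = f (l ++ x :: l') + f (l ++ y :: l')) (n : ℕ)
    (ih : ∀ (l : List I) (s : Finset I), l.length < n → l.Pairwise (· < ·) → l ≠ [] →
      (∀ x, x ∈ s ↔ x ∈ l) → ∑ π ∈ ncPartitions s, listProd (P.nestedValues f π a s)
        = P.moment ((l.map a).map .inl))
    (rest gap : List I) (acc : List A) (m : I) (s : Finset I) (hn : (gap ++ rest).length < n)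
    (hl : (m :: (gap ++ rest)).Pairwise (· < ·)) (hs : ∀ x, x ∈ s ↔ x ∈ m :: (gap ++ rest))
    (D : Finset (Finpartition s))
    (hD : ∀ π, π ∈ D ↔ π ∈ ncPartitions s ∧ ∀ x ∈ gap, x ∉ π.part m) :
    P.chainSumTail f acc (a m) (gap.map a) (rest.map a)
      = ∑ π ∈ D, P.prefixedValue f acc π a s m := by
  classical
  induction rest generalizing gap acc m s with
  | nil =>
    rw [List.append_nil] at hn hl hs
    rw [List.pairwise_cons] at hl
    have hmin : ∀ x ∈ s, m ≤ x := fun x hx => by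
      rcases List.mem_cons.1 ((hs x).1 hx) with rfl | h
      · exact le_rfl
      · exact (hl.1 x h).le
    have hms : m ∈ s := (hs m).2 List.mem_cons_self
    have hG : ∀ x, x ∈ s.erase m ↔ x ∈ gap := fun x => by
      rw [Finset.mem_erase, hs, List.mem_cons]
      exact ⟨fun h => h.2.resolve_left h.1, fun h => ⟨(hl.1 x h).ne', Or.inr h⟩⟩
    have hpart : ∀ π ∈ D, π.part m = {m} := fun π hπ => by
      ext x
      rw [Finset.mem_singleton]
      constructor
      · intro hx
        rcases List.mem_cons.1 ((hs x).1 (π.part_subset _ hx)) with h | h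
        · exact h
        · exact absurd hx (((hD π).1 hπ).2 x h)
      · rintro rfl
        exact π.mem_part hms
    rw [sum_ncPartitions_glue (G := s.erase m) (H := {m}) (S := {m}) id
      (ψ' := fun π _ => listProd (f (acc ++ [a m]) :: P.nestedValues f π a (s.erase m)))]
    · have h₁ : ∀ c : B, ∑ _π ∈ ncPartitions ({m} : Finset I), c = c := fun c =>
        sum_ncPartitions_const (fun x hx y hy =>
          (Finset.mem_singleton.1 hx).trans (Finset.mem_singleton.1 hy).symm) c
      simp only [h₁]
      rcases gap with _ | ⟨c, gap⟩
      · have h₂ : s.erase m = ∅ := Finset.eq_empty_of_forall_notMem fun x hx => by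
          simpa using (hG x).1 hx
        rw [h₂]
        simp only [nestedValues_empty]
        rw [sum_ncPartitions_const (by simp)]
        rfl
      · have hc : c ∈ s.erase m := (hG c).2 List.mem_cons_self
        have h₂ : ∀ π : Finpartition (s.erase m),
            P.nestedValues f π a (s.erase m) ≠ [] := fun π => by
          rw [P.nestedValues_eq f π a (Finset.min'_mem _ ⟨c, hc⟩) fun x hx => Finset.min'_le _ _ hx]
          exact List.cons_ne_nil _ _
        simp only [listProd_cons _ _ (h₂ _)]
        rw [← Finset.mul_sum, ih (c :: gap) _ hn hl.2 (List.cons_ne_nil _ _) hG]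
        rfl
    · intro x
      rw [Finset.mem_erase, Finset.mem_singleton]
      by_cases h : x = m <;> simp [h, hms]
    · intro x hx h
      exact Finset.ne_of_mem_erase hx (Finset.mem_singleton.1 h)
    · intro x hx y hy z _ hxy
      rw [Finset.mem_singleton.1 hy] at hxy
      exact absurd hxy (hmin x (Finset.mem_of_mem_erase hx)).not_gt
    · exact subset_rfl
    · exact fun x hx => hx
    · exact fun x _ => rfl
    · exact fun x _ y _ h => h
    · intro π
      rw [hD]
      refine and_congr_right fun _ => ?_
      constructor
      · intro h
        refine ⟨fun x hx y hy hxy => ?_, fun x hx => ?_⟩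
        · rw [Finset.mem_singleton.1 hy, mem_part_comm] at hxy
          exact h x ((hG x).1 hx) hxy
        · rw [Finset.mem_singleton.1 hx]
          exact π.mem_part hms
      · rintro ⟨h, -⟩ x hx hxm
        exact h x ((hG x).2 hx) m (Finset.mem_singleton_self m) ((mem_part_comm π).1 hxm)
    · intro π hπ
      exact P.prefixedValue_singleton f acc π a hmin (hpart π hπ)
  | cons m₁ rest ihr =>
    have hl' := hl
    rw [List.pairwise_cons, List.pairwise_append, List.pairwise_cons] at hl
    obtain ⟨hm, hgap, ⟨hm₁, hrest⟩, hgr⟩ := hl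
    have hms : m ∈ s := (hs m).2 List.mem_cons_self
    rw [List.map_cons, chainSumTail_cons,
      ← Finset.sum_filter_add_sum_filter_not D fun π => m₁ ∈ π.part m]
    have hmm₁ : m < m₁ := hm m₁ (by simp)
    -- The next element `m₁` belongs to the block of `m` or extends the gap.
    congr 1
    · -- If it does, no block connects the gap `G` with `m` or the elements `S` from `m₁` on, and
      -- the partition is determined by its restrictions to `G` and `S`, as `m` is in the block of
      -- `m₁`.
      set G := gap.toFinset with hGdef
      set S := (m₁ :: rest).toFinset with hSdef
      have hG : ∀ x, x ∈ G ↔ x ∈ gap := fun x => List.mem_toFinset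
      have hS : ∀ x, x ∈ S ↔ x ∈ m₁ :: rest := fun x => List.mem_toFinset
      have hm₁S : m₁ ∈ S := (hS m₁).2 List.mem_cons_self
      have hSle : ∀ x ∈ S, m₁ ≤ x := fun x hx => by
        rcases List.mem_cons.1 ((hS x).1 hx) with rfl | h
        · exact le_rfl
        · exact (hm₁ x h).le
      have hGlt : ∀ x ∈ G, m < x ∧ x < m₁ := fun x hx =>
        ⟨hm x (by simp [(hG x).1 hx]), hgr x ((hG x).1 hx) m₁ List.mem_cons_self⟩
      have hs' : ∀ x, x ∈ s ↔ x = m ∨ x ∈ G ∨ x ∈ S := fun x => by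
        rw [hs, hG, hS, List.mem_cons, List.mem_append]
      have hcond : ∀ π, π ∈ D.filter (fun π => m₁ ∈ π.part m) ↔ π ∈ ncPartitions s ∧
          (∀ x ∈ G, ∀ y ∈ insert m S, y ∉ π.part x) ∧
          ∀ x ∈ insert m S, max x m₁ ∈ π.part x := by
        intro π
        rw [Finset.mem_filter, hD, and_assoc]
        refine and_congr_right fun hπ => ?_
        rw [mem_ncPartitions, isNoncrossing_iff] at hπ
        constructor
        · rintro ⟨h₁, h₂⟩
          have hGm : ∀ x ∈ G, x ∉ π.part m := fun x hx => h₁ x ((hG x).1 hx)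
          refine ⟨fun x hx y hy hxy => ?_, fun x hx => ?_⟩
          · rcases Finset.mem_insert.1 hy with rfl | hy
            · exact hGm x hx ((mem_part_comm π).1 hxy)
            · rcases (hSle y hy).eq_or_lt with rfl | hlt
              · exact hGm x hx (mem_part_trans π ((mem_part_comm π).1 hxy) h₂)
              · exact hGm x hx (hπ m x m₁ y (hGlt x hx).1 (hGlt x hx).2 hlt h₂ hxy)
          · rcases Finset.mem_insert.1 hx with rfl | hx
            · rwa [max_eq_right hmm₁.le]
            · rw [max_eq_left (hSle x hx)]
              exact π.mem_part ((hs' x).2 (Or.inr (Or.inr hx)))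
        · rintro ⟨h₁, h₂⟩
          refine ⟨fun x hx hxm => h₁ x ((hG x).2 hx) m (Finset.mem_insert_self _ _)
            ((mem_part_comm π).1 hxm), ?_⟩
          have := h₂ m (Finset.mem_insert_self _ _)
          rwa [max_eq_right hmm₁.le] at this
      rw [sum_ncPartitions_glue (G := G) (H := insert m S) (S := S) (fun x => max x m₁)
        (ψ' := fun π π' => P.prefixedValue f
          (acc ++ [(P.nestedValues f π a G).foldl (fun a b => P.ract a b) (a m)]) π' a S m₁)]
      · have h₁ : ∀ acc' : List A,
            ∑ π' ∈ ncPartitions S, P.prefixedValue f acc' π' a S m₁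
              = P.chainSumTail f acc' (a m₁) [] (rest.map a) := fun acc' => by
          refine (ihr [] acc' m₁ S ?_ (List.pairwise_cons.2 ⟨hm₁, hrest⟩) hS _ ?_).symm
          · rw [List.length_append, List.length_cons] at hn
            rw [List.nil_append]
            omega
          · simp
        simp only [h₁]
        rcases gap with _ | ⟨c, gap⟩
        · have h₂ : G = ∅ := rfl
          rw [h₂]
          simp only [nestedValues_empty]
          rw [sum_ncPartitions_const (by simp)]
          rfl
        · have hc : c ∈ G := (hG c).2 List.mem_cons_self
          have h₂ : ∀ π : Finpartition G, P.nestedValues f π a G ≠ [] := fun π => by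
            rw [P.nestedValues_eq f π a (Finset.min'_mem _ ⟨c, hc⟩)
              fun x hx => Finset.min'_le _ _ hx]
            exact List.cons_ne_nil _ _
          -- By additivity the sum over the partitions of the gap can be taken inside the argument.
          let g : A →+ B := AddMonoidHom.mk'
            (fun x => P.chainSumTail f (acc ++ [x]) (a m₁) [] (rest.map a))
            fun x y => P.chainSumTail_add hf acc [] x y _ _ _
          have h₃ : ∀ x, P.chainSumTail f (acc ++ [x]) (a m₁) [] (rest.map a) = g x := fun x => rfl
          simp only [P.foldl_ract _ _ (h₂ _), h₃]
          rw [← map_sum, ← map_sum (P.ract (a m)), ih (c :: gap) G ?_ hgap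
            (List.cons_ne_nil _ _) hG]
          · rfl
          · rw [List.length_append] at hn
            omega
      · intro x
        rw [hs', Finset.mem_insert]
        tauto
      · intro x hx h
        rcases Finset.mem_insert.1 h with h | h
        · exact (hGlt x hx).1.ne' h
        · exact (hGlt x hx).2.not_ge (hSle x h)
      · intro x hx y hy z hz hxy hyz
        rcases Finset.mem_insert.1 hy with h | h
        · exact lt_asymm (hGlt x hx).1 (h ▸ hxy)
        · exact ((hSle y h).trans_lt hyz).not_gt (hGlt z hz).2
      · exact Finset.subset_insert _ _
      · intro x hx
        rcases Finset.mem_insert.1 hx with h | h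
        · rw [h, max_eq_right hmm₁.le]; exact hm₁S
        · rw [max_eq_left (hSle x h)]; exact h
      · exact fun x hx => max_eq_left (hSle x hx)
      · exact fun x _ y _ h => max_le_max_right _ h
      · exact hcond
      · intro π hπ
        obtain ⟨-, h₁, h₂⟩ := (hcond π).1 hπ
        refine P.prefixedValue_cons f acc π a hs' hGlt hmm₁ hSle hm₁S (Finset.mem_filter.1 hπ).2
          fun x hx y hy => h₁ x hx y ?_
        rwa [Finset.mem_insert]
    · have h := ihr (gap ++ [m₁]) acc m s (by simpa using hn) (by simpa using hl')
        (by simpa using hs) (D.filter fun π => m₁ ∉ π.part m) fun π => by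
          rw [Finset.mem_filter, hD, and_assoc]
          simp [or_imp, forall_and]
      rw [List.map_append] at h
      exact h

/-- If the moments are the sums over the arguments of `f`, they are the sums of the nested
evaluations of `f` along the noncrossing partitions. -/
theorem sum_nestedValues_eq_moment {f : List A → B} (a : I → A)
    (hf : ∀ l l' x y, f (l ++ (x + y) :: l') = f (l ++ x :: l') + f (l ++ y :: l'))
    (hrec : ∀ a l, P.moment ((a :: l).map .inl) = P.chainSumTail f [] a [] l)
    (l : List I) (s : Finset I) (hl : l.Pairwise (· < ·)) (hne : l ≠ [])
    (hs : ∀ x, x ∈ s ↔ x ∈ l) :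
    ∑ π ∈ ncPartitions s, listProd (P.nestedValues f π a s) = P.moment ((l.map a).map .inl) := by
  induction hn : l.length using Nat.strong_induction_on generalizing l s with
  | _ n ih =>
    obtain ⟨m, l, rfl⟩ := List.exists_cons_of_ne_nil hne
    have hmin : ∀ x ∈ s, m ≤ x := fun x hx => by
      rcases List.mem_cons.1 ((hs x).1 hx) with rfl | h
      · exact le_rfl
      · exact ((List.pairwise_cons.1 hl).1 x h).le
    have h := P.chainSumTail_eq_sum_prefixedValue a hf n
      (fun l s h h₁ h₂ h₃ => ih _ h l s h₁ h₂ h₃ rfl) l [] [] m s (by simp [← hn]) hl hs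
      (ncPartitions s) (by simp)
    rw [List.map_nil] at h
    rw [List.map_cons, hrec, h]
    refine Finset.sum_congr rfl fun π _ => ?_
    rw [P.nestedValues_eq f π a ((hs m).2 List.mem_cons_self) hmin]
    rfl

theorem moment_map_inl (l : List A) (hl : l ≠ []) : P.moment (l.map .inl) = P.E (listProd l) := by
  have h : ∀ l : List A, P.contract (l.map .inl) = ([], l) := by
    intro l
    induction l with
    | nil => rfl
    | cons a l ih => rw [List.map_cons, contract, ih]; rfl
  obtain ⟨a, l, rfl⟩ := List.exists_cons_of_ne_nil hl
  rw [moment, insertion, h]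
  rfl

/-- The moment-cumulant formula for a function satisfying the recursion `chainSumTail`. -/
theorem sum_multiplicative_eq {f : List A → B}
    (hf : ∀ l l' x y, f (l ++ (x + y) :: l') = f (l ++ x :: l') + f (l ++ y :: l'))
    (hrec : ∀ a l, P.moment ((a :: l).map .inl) = P.chainSumTail f [] a [] l)
    (l : List A) (hne : l ≠ []) :
    ∑ π ∈ NC l.length, P.multiplicative f π l.get = P.E (listProd l) := by
  classical
  have h₁ : NC l.length = ncPartitions Finset.univ := by
    ext π
    rw [mem_ncPartitions]
    refine Finset.mem_filter.trans ?_
    exact and_iff_right (Finset.mem_univ _)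
  have h₂ := P.sum_nestedValues_eq_moment l.get hf hrec (List.finRange l.length) Finset.univ
    (List.pairwise_lt_finRange _) (by simpa using hne) (by simp)
  rw [List.map_get_finRange, P.moment_map_inl l hne] at h₂
  rw [h₁, ← h₂]
  rfl

/-- A multiplicative function on a partition with more than one block involves only values at lists
shorter than the number of elements. -/
theorem multiplicative_congr {f f' : List A → B} {n : ℕ}
    (π : Finpartition (Finset.univ : Finset (Fin n))) (hπ : π.parts ≠ {Finset.univ}) (a : Fin n → A)
    (hf : ∀ l : List A, l ≠ [] → l.length < n → f l = f' l) :
    P.multiplicative f π a = P.multiplicative f' π a := by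
  rw [multiplicative, multiplicative]
  congr 1
  refine P.nestedValues_congr a _ (fun _ _ => rfl) fun x _ l hl => hf l ?_ ?_
  · rw [← List.length_pos_iff, hl]
    exact Finset.card_pos.2 ⟨x, π.mem_part (Finset.mem_univ x)⟩
  · rw [hl]
    refine lt_of_le_of_ne ((Finset.card_le_univ _).trans_eq (Fintype.card_fin n)) fun h => hπ ?_
    have h₁ : π.part x = Finset.univ := (Finset.card_eq_iff_eq_univ _).1 (by simpa using h)
    refine Finset.eq_singleton_iff_unique_mem.2
      ⟨?_, fun p hp => ?_⟩
    · have := π.part_mem.2 (Finset.mem_univ x)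
      rwa [h₁] at this
    obtain ⟨y, hy⟩ := π.nonempty_of_mem_parts hp
    have hyx : y ∈ π.part x := by rw [h₁]; exact Finset.mem_univ y
    rw [← π.part_eq_of_mem hp hy]
    exact ((π.mem_part_iff_part_eq_part (Finset.mem_univ y) (Finset.mem_univ x)).1 hyx).trans h₁

theorem multiplicative_indiscrete (f : List A → B) (l : List A) (hl : l ≠ [])
    (π : Finpartition (Finset.univ : Finset (Fin l.length))) (hπ : π.parts = {Finset.univ}) :
    P.multiplicative f π l.get = f l := by
  have hpos : 0 < l.length := List.length_pos_iff.2 hl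
  have hpart : ∀ x, π.part x = Finset.univ := fun x => by
    have := π.part_mem.2 (Finset.mem_univ x)
    rwa [hπ, Finset.mem_singleton] at this
  have hgap : ∀ t x, gapAfter t (π.part ⟨0, hpos⟩) x = ∅ := fun t x =>
    Finset.eq_empty_of_forall_notMem fun y hy => (mem_gapAfter.1 hy).2.1 (by simp [hpart])
  rw [multiplicative, P.nestedValues_eq f π l.get (Finset.mem_univ (⟨0, hpos⟩ : Fin l.length))
    (fun x _ => Fin.mk_le_of_le_val (Nat.zero_le _)),
    P.tailValues_of_subset f π l.get (by rw [hpart]), listProd_singleton, blockArgs]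
  simp only [hgap, nestedValues_empty, List.foldl_nil]
  rw [hpart, Fin.sort_univ]
  exact congrArg f (List.map_get_finRange l)

/-- The free cumulants are determined by the moment-cumulant formula. -/
theorem cumulant_eq {f : List A → B} (hf₀ : f [] = 0)
    (hf : ∀ l l' x y, f (l ++ (x + y) :: l') = f (l ++ x :: l') + f (l ++ y :: l'))
    (hrec : ∀ a l, P.moment ((a :: l).map .inl) = P.chainSumTail f [] a [] l)
    (l : List A) : P.cumulant l = f l := by
  classical
  induction hn : l.length using Nat.strong_induction_on generalizing l with
  | _ n ih =>
    subst hn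
    rcases eq_or_ne l [] with rfl | hl
    · rw [cumulant, hf₀]
      have : ∀ (g : List A → B)
          (π : Finpartition (Finset.univ : Finset (Fin ([] : List A).length))),
          P.multiplicative g π ([] : List A).get = 0 := fun g π => by
        have h : P.nestedValues g π ([] : List A).get ∅ = [] := P.nestedValues_empty g π _
        exact congrArg listProd h
      simp [this, listProd]
    · have hpos : 0 < l.length := List.length_pos_iff.2 hl
      have hne : (Finset.univ : Finset (Fin l.length)) ≠ ⊥ :=
        Finset.nonempty_iff_ne_empty.1 ⟨⟨0, hpos⟩, Finset.mem_univ _⟩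
      have hmem : Finpartition.indiscrete hne ∈ NC l.length := by
        rw [NC, Finset.mem_filter]
        refine ⟨Finset.mem_univ _, fun p hp q hq hpq => absurd ?_ hpq⟩
        rw [Finpartition.indiscrete_parts, Finset.mem_singleton] at hp hq
        rw [hp, hq]
      have h₁ : ∑ π ∈ (NC l.length).filter (fun π => π.parts ≠ {Finset.univ}),
          P.multiplicative f π l.get + f l = P.E (listProd l) := by
        rw [← P.sum_multiplicative_eq hf hrec l hl,
          ← Finset.sum_filter_add_sum_filter_not (NC l.length) fun π => π.parts ≠ {Finset.univ}]
        congr 1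
        rw [Finset.sum_eq_single_of_mem (Finpartition.indiscrete hne)
          (Finset.mem_filter.2 ⟨hmem, by simp⟩)]
        · exact (P.multiplicative_indiscrete f l hl _ rfl).symm
        · intro π hπ hπ'
          exact absurd (Finpartition.ext (not_not.1 (Finset.mem_filter.1 hπ).2)) hπ'
      rw [cumulant, ← h₁, sub_eq_iff_eq_add, add_comm]
      congr 1
      refine Finset.sum_congr (by ext π; simp only [Finset.mem_filter]) fun π hπ => ?_
      refine P.multiplicative_congr π (Finset.mem_filter.1 hπ).2 _ fun l' _ hl' => ?_
      rw [dif_pos hl', ih _ hl' l' rfl]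

end OpValuedProbSpace

end

section

/-! ### The linear restriction of the free cumulant morphism -/

theorem signedProd_eq_zero {A B : Type*} [NonUnitalRing B] {L : List (A ⊕ B)}
    (h : ∃ a, Sum.inl a ∈ L) : signedProd L = 0 := by
  induction L with
  | nil => rfl
  | cons y L ih =>
    rcases y with a | b
    · rfl
    · obtain ⟨a, ha⟩ := h
      have ha' : Sum.inl a ∈ L := by simpa using ha
      rw [signedProd_inr_cons b L (List.ne_nil_of_mem ha'), ih ⟨a, ha'⟩, mul_zero, neg_zero]

theorem signedProd_map_inr {R A B : Type*} [CommRing R] [NonUnitalRing B] [Module R B]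
    [IsScalarTower R B B] [SMulCommClass R B B] (b : List B) (hb : b ≠ []) :
    signedProd (b.map .inr : List (A ⊕ B)) = (-1 : R) ^ b.length • listProd b := by
  induction b with
  | nil => exact absurd rfl hb
  | cons x b ih =>
    rcases eq_or_ne b [] with rfl | hb
    · simp [signedProd]
    · rw [List.map_cons, signedProd_inr_cons _ _ (by simpa using hb), ih hb, listProd_cons _ _ hb,
        List.length_cons, pow_succ, mul_neg_one, neg_smul, mul_smul_comm]

theorem singleValue_eq_zero {A B : Type*} [Zero B] {L : List (A ⊕ B)}
    (h : ∃ a, Sum.inl a ∈ L) : singleValue L = 0 := by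
  rcases L with _ | ⟨a | b, _ | ⟨y, L⟩⟩ <;> try rfl
  simp at h

theorem word_append_add {R : Type u} {A : Type v} [CommRing R] [AddCommGroup A] [Module R A]
    (w w' : List (Option A)) (x y : A) : word R (w ++ some (x + y) :: w')
      = word R (w ++ some x :: w') + word R (w ++ some y :: w') := by
  have h : letter R (some (x + y)) = letter R (some x) + letter R (some y) := by
    simp [letter]
  rcases w with _ | ⟨z, w⟩
  · simp only [List.nil_append, word, h, TensorProduct.add_tmul]
  · simp only [List.cons_append, word, List.map_append, List.map_cons, List.prod_append,
      List.prod_cons, h, map_add, add_mul, mul_add, TensorProduct.tmul_add]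

section RestrictionValue

variable {R : Type u} {B : Type v} {A : Type w} [CommRing R] [NonUnitalRing B] [Module R B]
  [NonUnitalRing A] [Module R A]

/-- The value of the linear restriction of `K` at a list of elements of `A` and `B`: the word has a
letter `*` for each element of `B`, and these elements are the arguments. -/
def restrictionValue (K : Words R A →ₗ[R] DecTrees R (EndB R B)) (L : List (A ⊕ B)) : B :=
  evalAt (corollaPart (K (word R (shape L)))) (inputs L)

theorem restrictionValue_map_inl_add (K : Words R A →ₗ[R] DecTrees R (EndB R B)) (l l' : List A)
    (x y : A) : restrictionValue K ((l ++ (x + y) :: l').map .inl)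
      = restrictionValue K ((l ++ x :: l').map .inl)
        + restrictionValue K ((l ++ y :: l').map .inl) := by
  have hs : ∀ l : List A, shape (l.map (Sum.inl : A → A ⊕ B)) = l.map some := fun l => by
    simp [shape]
  have hi : ∀ l : List A, inputs (l.map (Sum.inl : A → A ⊕ B)) = [] := fun l => by
    simp [inputs]
  rw [restrictionValue, restrictionValue, restrictionValue, hs, hs, hs, hi, hi, hi,
    List.map_append, List.map_cons, word_append_add, map_add, map_add, List.map_append,
    List.map_cons, List.map_append, List.map_cons]
  exact evalList_add _ _ _

-- The empty word stands for zero.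
theorem restrictionValue_nil (K : Words R A →ₗ[R] DecTrees R (EndB R B)) :
    restrictionValue K ([] : List (A ⊕ B)) = 0 := by
  have h : corollaPart (K (word R (shape ([] : List (A ⊕ B))))) = 0 := by
    rw [shape, List.map_nil, word, map_zero, map_zero]
  rw [restrictionValue, h]
  rfl

theorem restrictionValue_inr {K : Words R A →ₗ[R] DecTrees R (EndB R B)}
    (hK : IsCooperadHom (coAs R A) (cofree R (EndB R B)) K) (b : B) :
    restrictionValue K [(.inr b : A ⊕ B)] = 0 := by
  have h : corollaPart (K (word R (shape [(Sum.inr b : A ⊕ B)]))) = 0 :=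
    OpValuedProbSpace.proj_hom_coaug hK
  rw [restrictionValue, h]
  rfl

end RestrictionValue

namespace OpValuedProbSpace

variable {R : Type u} {B : Type v} {A : Type w} [CommRing R]
  [NonUnitalRing B] [Module R B] [IsScalarTower R B B] [SMulCommClass R B B]
  [NonUnitalRing A] [Module R A] [IsScalarTower R A A] [SMulCommClass R A A]
  (P : OpValuedProbSpace R B A)

theorem gapValueFrom_eq_zero (f : List A → B) (acc : List A) (a : A) (L : List (A ⊕ B))
    (h : [none, none] <:+: shape L ∨ [none] <:+ shape L) : P.gapValueFrom f acc a L = 0 := by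
  fun_induction gapValueFrom P f acc a L with
  | case1 => simp [shape] at h
  | case2 acc a a' L ih =>
    exact ih (by simpa [shape, List.infix_cons_iff, List.suffix_cons_iff] using h)
  | case3 acc a b a' L ih =>
    exact ih (by simpa [shape, List.infix_cons_iff, List.suffix_cons_iff] using h)
  | case4 => rfl
  | case5 => rfl

theorem gapValue_eq_zero (f : List A → B) (L : List (A ⊕ B))
    (h : [none, none] <:+: shape L ∨ [none] <+: shape L ∨ [none] <:+ shape L) :
    P.gapValue f L = 0 := by
  rcases L with _ | ⟨a | b, L⟩
  · rfl
  · refine P.gapValueFrom_eq_zero f [] a L ?_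
    simpa [shape, List.infix_cons_iff, List.suffix_cons_iff] using h
  · rfl

theorem gapValue_gapList (f : List A → B) (a : A) (g : List (Option B × A)) :
    P.gapValue f (gapList a g) = f (P.insertion (gapList a g)) := by
  have h : ∀ (g : List (Option B × A)) (acc : List A) (a : A),
      P.gapValueFrom f acc a (g.flatMap fun x => x.1.toList.map .inr ++ [.inl x.2])
        = f (acc ++ P.insertion (gapList a g)) := by
    intro g
    induction g with
    | nil => intro acc a; rfl
    | cons x g ih =>
      intro acc a
      obtain ⟨_ | b, a'⟩ := x
      · refine (ih (acc ++ [a]) a').trans ?_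
        rw [List.append_assoc]
        rfl
      · refine (ih (acc ++ [P.ract a b]) a').trans ?_
        rw [List.append_assoc]
        rfl
  exact h g [] a

variable {K : Words R A →ₗ[R] DecTrees R (EndB R B)}

/-- The linear restriction of the free cumulant morphism at lists of elements of `A` is given by the
free cumulants. -/
theorem cumulant_eq_evalAt (hK : IsCooperadHom (coAs R A) (cofree R (EndB R B)) K)
    (h : treeComposition R B ∘ₗ K = P.momentMap) (l : List A) :
    P.cumulant l = restrictionValue K (l.map .inl) :=
  P.cumulant_eq (f := fun l => restrictionValue K (l.map .inl)) (restrictionValue_nil K)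
    (restrictionValue_map_inl_add K) (P.moment_eq_chainSumTail (restrictionValue_nil K)
      (restrictionValue_inr hK) (P.moment_eq_tokSum hK h)) l

theorem sum_multiplicative_cumulant (hK : IsCooperadHom (coAs R A) (cofree R (EndB R B)) K)
    (h : treeComposition R B ∘ₗ K = P.momentMap) (l : List A) (hl : l ≠ []) :
    P.E (listProd l) = ∑ π ∈ NC l.length, P.multiplicative P.cumulant π l.get := by
  rw [funext (P.cumulant_eq_evalAt hK h)]
  exact (P.sum_multiplicative_eq (restrictionValue_map_inl_add K)
    (P.moment_eq_chainSumTail (restrictionValue_nil K) (restrictionValue_inr hK)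
      (P.moment_eq_tokSum hK h)) l hl).symm

/-- The linear restriction of the free cumulant morphism at arbitrary words. -/
theorem evalAt_freeCumulant (hK : IsCooperadHom (coAs R A) (cofree R (EndB R B)) K)
    (h : treeComposition R B ∘ₗ K = P.momentMap) (L : List (A ⊕ B)) :
    evalAt (corollaPart (K (word R (shape L)))) (inputs L)
      = signedProd L + P.gapValue P.cumulant L + singleValue L := by
  rw [← sub_eq_iff_eq_add, funext (P.cumulant_eq_evalAt hK h)]
  exact P.eq_signedProd_add_gapValue (F := restrictionValue K) (restrictionValue_nil K)
    (restrictionValue_inr hK) (P.moment_eq_tokSum hK h) L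

theorem evalAt_freeCumulant_replicate (hK : IsCooperadHom (coAs R A) (cofree R (EndB R B)) K)
    (h : treeComposition R B ∘ₗ K = P.momentMap) (b : List B) (hb : 2 ≤ b.length) :
    evalAt (corollaPart (K (word R (List.replicate b.length none)))) b
      = (-1 : R) ^ b.length • listProd b := by
  have hs : shape (b.map (Sum.inr : B → A ⊕ B)) = List.replicate b.length none := by
    simp [shape, Function.comp_def]
  have hi : inputs (b.map (Sum.inr : B → A ⊕ B)) = b := by
    simp [inputs, Function.comp_def]
  have h₁ := P.evalAt_freeCumulant hK h (b.map .inr)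
  obtain ⟨x, y, b, rfl⟩ : ∃ x y b', b = x :: y :: b' := by
    rcases b with _ | ⟨x, _ | ⟨y, b⟩⟩ <;> simp at hb ⊢
  rw [hs, hi, signedProd_map_inr (R := R) _ (List.cons_ne_nil _ _)] at h₁
  rw [h₁]
  simp [gapValue, singleValue]

theorem evalAt_freeCumulant_gapList (hK : IsCooperadHom (coAs R A) (cofree R (EndB R B)) K)
    (h : treeComposition R B ∘ₗ K = P.momentMap) (a : A) (g : List (Option B × A)) :
    evalAt (corollaPart (K (word R (shape (gapList a g))))) (inputs (gapList a g))
      = P.cumulant (P.insertion (gapList a g)) := by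
  have ha : ∃ a', Sum.inl a' ∈ gapList a g := ⟨a, List.mem_cons_self⟩
  rw [P.evalAt_freeCumulant hK h, signedProd_eq_zero ha, singleValue_eq_zero ha, zero_add,
    add_zero, P.gapValue_gapList]

/-- All three contributions to the value of the linear restriction vanish: there is an element of
`A`, and no arguments of the form required by `gapValue`. -/
theorem proj_freeCumulant_eq_zero (hK : IsCooperadHom (coAs R A) (cofree R (EndB R B)) K)
    (h : treeComposition R B ∘ₗ K = P.momentMap) (w : List (Option A)) (hw : ∃ a, some a ∈ w)
    (hw' : [none, none] <:+: w ∨ [none] <+: w ∨ [none] <:+ w) :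
    corollaPart (K (word R w)) = 0 := by
  refine ext_evalAt (proj_hom_mem_range hK w) (Submodule.zero_mem _) fun b hb => ?_
  obtain ⟨L, rfl, rfl⟩ := exists_shape_inputs w b hb
  have ha : ∃ a, Sum.inl a ∈ L := by
    obtain ⟨a, ha⟩ := hw
    obtain ⟨y, hy, hya⟩ := List.mem_map.1 ha
    rcases y with a' | b
    · exact ⟨a', hy⟩
    · exact absurd hya (by simp)
  rw [P.evalAt_freeCumulant hK h, signedProd_eq_zero ha, singleValue_eq_zero ha,
    P.gapValue_eq_zero _ _ hw', add_zero, add_zero]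
  rfl

end OpValuedProbSpace

end

end OperadicCumulants

end

open OperadicCumulants in
theorem mainTheorem1 {R B A : Type*} [CommRing R]
    [NonUnitalRing B] [Module R B] [IsScalarTower R B B] [SMulCommClass R B B]
    [NonUnitalRing A] [Module R A] [IsScalarTower R A A] [SMulCommClass R A A]
    (P : OpValuedProbSpace R B A) :
    -- the moment morphism and the canonical twist are determined by their linear restrictions
    (∃! M : Words R A →ₗ[R] DecTrees R (EndB R B), P.IsMomentMorphism M) ∧
    (∃! Φ : DecTrees R (EndB R B) →ₗ[R] DecTrees R (EndB R B), IsCanonicalTwist R B Φ) ∧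
    -- the defining relation of the free cumulants
    (∀ l : List A, l ≠ [] →
      P.E (listProd l) = ∑ π ∈ NC l.length, P.multiplicative P.cumulant π l.get) ∧
    ∀ (M : Words R A →ₗ[R] DecTrees R (EndB R B))
      (Φ : DecTrees R (EndB R B) →ₗ[R] DecTrees R (EndB R B)),
      P.IsMomentMorphism M → IsCanonicalTwist R B Φ →
      -- the canonical twist is an isomorphism, and `K = Φ⁻¹ ∘ M` is the free cumulant morphism
      ∃ (Φinv : DecTrees R (EndB R B) →ₗ[R] DecTrees R (EndB R B))
        (K : Words R A →ₗ[R] DecTrees R (EndB R B)),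
        IsCooperadHom (cofree R (EndB R B)) (cofree R (EndB R B)) Φinv ∧
        Φinv ∘ₗ Φ = LinearMap.id ∧ Φ ∘ₗ Φinv = LinearMap.id ∧
        K = Φinv ∘ₗ M ∧
        IsCooperadHom (coAs R A) (cofree R (EndB R B)) K ∧
        -- words of `n ≥ 2` letters `*`
        (∀ b : List B, 2 ≤ b.length →
          evalAt (corollaPart (K (word R (List.replicate b.length none)))) b
            = (-1 : R) ^ b.length • listProd b) ∧
        -- words `a₁ *^{α₁} a₂ ⋯ *^{α_{m-1}} a_m` with all `α_j ∈ {0, 1}`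
        (∀ (a : A) (g : List (Option B × A)),
          evalAt (corollaPart (K (word R (shape (gapList a g))))) (inputs (gapList a g))
            = P.cumulant (P.insertion (gapList a g))) ∧
        -- all other words containing an element of `A`
        (∀ w : List (Option A), (∃ a, some a ∈ w) →
          ([none, none] <:+: w ∨ [none] <+: w ∨ [none] <:+ w) →
          corollaPart (K (word R w)) = 0) := by
  -- For `K = Φ⁻¹ ∘ M`, the composition of trees turns `K` into the moments.
  have hex : ∀ (M : Words R A →ₗ[R] DecTrees R (EndB R B))
      (Φ : DecTrees R (EndB R B) →ₗ[R] DecTrees R (EndB R B)),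
      P.IsMomentMorphism M → IsCanonicalTwist R B Φ →
      ∃ (Φinv : DecTrees R (EndB R B) →ₗ[R] DecTrees R (EndB R B)),
        IsCooperadHom (cofree R (EndB R B)) (cofree R (EndB R B)) Φinv ∧
        Φinv ∘ₗ Φ = LinearMap.id ∧ Φ ∘ₗ Φinv = LinearMap.id ∧
        IsCooperadHom (coAs R A) (cofree R (EndB R B)) (Φinv ∘ₗ M) ∧
        treeComposition R B ∘ₗ Φinv ∘ₗ M = P.momentMap := by
    intro M Φ hM hΦ
    obtain ⟨Φinv, hinv, h₁, h₂⟩ := hΦ.exists_inverse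
    have hK := hinv.comp hM.isHom
    refine ⟨Φinv, hinv, h₁, h₂, hK, P.treeComposition_comp hM hΦ hK ?_⟩
    rw [← LinearMap.comp_assoc, h₂, LinearMap.id_comp]
  refine ⟨P.exists_unique_isMomentMorphism, exists_unique_isCanonicalTwist, fun l hl => ?_,
    fun M Φ hM hΦ => ?_⟩
  · obtain ⟨M, hM, -⟩ := P.exists_unique_isMomentMorphism
    obtain ⟨Φ, hΦ, -⟩ := exists_unique_isCanonicalTwist (R := R) (B := B)
    obtain ⟨Φinv, -, -, -, hK, h⟩ := hex M Φ hM hΦ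
    exact P.sum_multiplicative_cumulant hK h l hl
  · obtain ⟨Φinv, hinv, h₁, h₂, hK, h⟩ := hex M Φ hM hΦ
    exact ⟨Φinv, Φinv ∘ₗ M, hinv, h₁, h₂, rfl, hK, P.evalAt_freeCumulant_replicate hK h,
      P.evalAt_freeCumulant_gapList hK h, P.proj_freeCumulant_eq_zero hK h⟩
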